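/- Let $\mathbb{T}^2=\mathbb{R}^2/\mathbb{Z}^2$, let $\mathcal{P}(\mathbb{T}^2)$ be the space of probability measures on $\mathbb{T}^2$ with the topology of weak convergence, and let $\nu,T>0$. Let $\mathcal{N}$ be the Green function of $\mathbb{T}^2$, that is $-\Delta\mathcal{N}=\delta_0-1$ and $\int_{\mathbb{T}^2}\mathcal{N}\,dx=0$ (with $\mathcal{N}(0)=+\infty$), and let $\mathcal{K}=(-\partial_2\mathcal{N},\partial_1\mathcal{N})$. For $\gamma\in\mathcal{P}(\mathbb{T}^2)$ put $$e(\gamma)=\frac12\int_{(\mathbb{T}^2)^2}\mathcal{N}(x-y)\,\gamma(dx)\gamma(dy)\in(-\infty,\infty],$$ $$\langle\nabla f,\mathbf{R}(\gamma)\rangle=\frac12\int_{x\neq y}(\nabla f(x)-\nabla f(y))\cdot\mathcal{K}(x-y)\,\gamma(dx)\gamma(dy),\qquad f\in C^\infty(\mathbb{T}^2).$$ The entropy is $S(\gamma)=\int_{\mathbb{T}^2}\gamma(x)\log\gamma(x)\,dx$ if $\gamma(dx)=\gamma(x)dx$, and $S(\gamma)=\infty$ otherwise. The Fisher information is $I(\gamma)=\int_{\mathbb{T}^2}\frac{|\nabla\gamma(x)|^2}{\gamma(x)}dx$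 if $\gamma(dx)=\gamma(x)dx$ and the distributional gradient $\nabla\gamma$ is in $L^1(\mathbb{T}^2)$, and $I(\gamma)=\infty$ otherwise. For $\rho\in C([0,T];\mathcal{P}(\mathbb{T}^2))$ put $$Q_T(\rho)=\sup_{0\le t\le T}\Big(e(\rho(t))+\frac{\nu}{2}\int_0^t\|\rho(s)-1\|_2^2\,ds\Big),$$ where $\|\gamma-1\|_2=\infty$ if $\gamma$ has no density in $L^2(\mathbb{T}^2)$, and $$\begin{aligned}\overline{\mathbb{A}}_T(\rho)=\sup_{\phi\in C^\infty([0,T]\times\mathbb{T}^2)}\Big(&\langle\phi(T),\rho(T)\rangle-\langle\phi(0),\rho(0)\rangle-\int_0^T\langle\partial_t\phi(s),\rho(s)\rangle ds-\nu\int_0^T\langle\Delta\phi(s),\rho(s)\rangle ds\\&-\int_0^T\langle\nabla\phi(s),\mathbf{R}(\rho(s))\rangle ds-\nu\int_0^T\int_{\mathbb{T}^2}|\nabla\phi(s)|^2\,d\rho(s)\,ds\Big).\end{aligned}$$ Suppose that $\rho\in C([0,T];\mathcal{P}(\mathbb{T}^2))$, $Q_T(\rho)<\infty$ and $\overline{\mathbb{A}}_T(\rho)<\infty$.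 Then for each $t\in(0,T]$, $$S(\rho(t))\le 2\overline{\mathbb{A}}_T(\rho)+\log\left(\frac{2Q_T(\rho)}{\nu t}+1\right).$$ In addition, for each $\alpha>0$, $$\int_0^T t^\alpha I(\rho(t))\,dt<\infty.$$ -/

import Mathlib

open MeasureTheory Set
open scoped ENNReal ContDiff

noncomputable section

namespace VortexLDP

/-- The flat torus `ℝ² / ℤ²`. Its `volume` is the product Haar measure, of total mass one. -/
abbrev T2 : Type := UnitAddTorus (Fin 2)

/-- The probability measures on the torus; the topology of `ProbabilityMeasure` is that of weak
convergence, which on the compact torus is the topology of the quadratic Wasserstein distance. -/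
abbrev PT2 : Type := ProbabilityMeasure T2

/-- The projection `ℝ² → ℝ² / ℤ²`. -/
def toT2 (y : Fin 2 → ℝ) : T2 := fun i => (y i : UnitAddCircle)

/-- The partial derivative in the `i`-th coordinate direction of a function on the torus. -/
def pd (i : Fin 2) (f : T2 → ℝ) (x : T2) : ℝ :=
  deriv (fun h : ℝ => f (x + toT2 (Pi.single i h))) 0

/-- The Laplacian of a function on the torus. -/
def lap (f : T2 → ℝ) (x : T2) : ℝ := ∑ i, pd i (pd i f) x

/-- `f ∈ C^∞(𝕋²)`: the periodic lift of `f` to `ℝ²` is smooth. -/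
def IsSmooth (f : T2 → ℝ) : Prop := ContDiff ℝ ∞ (fun y : Fin 2 → ℝ => f (toT2 y))

/-- Smooth time-dependent functions on the torus. By Seeley's extension theorem, the restrictions
of these functions to `[0,T] × 𝕋²` are exactly the elements of `C^∞([0,T] × 𝕋²)`. -/
def IsSmoothInTime (φ : ℝ → T2 → ℝ) : Prop :=
  ContDiff ℝ ∞ (fun p : ℝ × (Fin 2 → ℝ) => φ p.1 (toT2 p.2))

/-- The heat kernel of `∂ₜ - Δ` on the torus,
`p_t(x) = ∑_{k ∈ ℤ²} exp(-4π²|k|²t) exp(2πi k·x)` for `t > 0`, as a product of two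
one-dimensional theta functions (`HurwitzZeta.cosKernel a s = ∑ₙ exp(2πi n a) exp(-πn²s)`). -/
def heatKernel (t : ℝ) (x : T2) : ℝ :=
  ∏ i, HurwitzZeta.cosKernel (x i) (4 * Real.pi * t)

/-- The Green function `𝒩` of the torus, `-Δ𝒩 = δ₀ - 1` with `∫ 𝒩 = 0`, namely
`𝒩(x) = ∫₀^∞ (p_t(x) - 1) dt`, written as positive part minus negative part (the latter is
bounded in `x`). It is finite and smooth off `0`, and `𝒩(0) = +∞`. -/
def green (x : T2) : EReal :=
  ((∫⁻ t in Ioi (0 : ℝ), ENNReal.ofReal (heatKernel t x - 1) : ℝ≥0∞) : EReal)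
    - ((∫⁻ t in Ioi (0 : ℝ), ENNReal.ofReal (1 - heatKernel t x) : ℝ≥0∞) : EReal)

/-- The Biot–Savart kernel `𝒦 = (-∂₂𝒩, ∂₁𝒩)`; only its values at `x ≠ 0` matter. -/
def biotSavart (x : T2) : Fin 2 → ℝ :=
  ![-pd 1 (fun z => (green z).toReal) x, pd 0 (fun z => (green z).toReal) x]

/-- The energy `e(γ) = ½ ∬ 𝒩(x-y) γ(dx) γ(dy) ∈ (-∞, ∞]`, diagonal included, as positive part
minus (finite) negative part. -/
def energy (γ : PT2) : EReal :=
  ((1 / 2 : ℝ) : EReal) *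
    (((∫⁻ p, (green (p.1 - p.2)).toENNReal ∂((γ : Measure T2).prod (γ : Measure T2)) : ℝ≥0∞) :
        EReal)
      - ((∫⁻ p, (-green (p.1 - p.2)).toENNReal ∂((γ : Measure T2).prod (γ : Measure T2)) :
        ℝ≥0∞) : EReal))

/-- The Lebesgue density of the absolutely continuous part of `γ`. -/
def density (γ : PT2) (x : T2) : ℝ := ((γ : Measure T2).rnDeriv volume x).toReal

open Classical in
/-- `‖γ - 1‖₂²`, equal to `∞` if `γ` has no density or if its density is not in `L²`. -/
def l2DistSq (γ : PT2) : ℝ≥0∞ :=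
  if (γ : Measure T2) ≪ volume then ∫⁻ x, ENNReal.ofReal ((density γ x - 1) ^ 2) else ⊤

/-- `Q_T(ρ) = sup_{0 ≤ t ≤ T} ( e(ρ(t)) + (ν/2) ∫₀ᵗ ‖ρ(s) - 1‖₂² ds )`. -/
def QT (ν T : ℝ) (ρ : ℝ → PT2) : EReal :=
  ⨆ t ∈ Icc (0 : ℝ) T,
    (energy (ρ t) + ((ENNReal.ofReal (ν / 2) * ∫⁻ s in Ioc 0 t, l2DistSq (ρ s) : ℝ≥0∞) : EReal))

/-- The symmetrized nonlinearity
`⟨∇f, R(γ)⟩ = ½ ∬_{x ≠ y} (∇f(x) - ∇f(y)) · 𝒦(x-y) γ(dx) γ(dy)`. -/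
def pairR (f : T2 → ℝ) (γ : PT2) : ℝ :=
  (1 / 2) * ∫ p in {p : T2 × T2 | p.1 ≠ p.2},
    (∑ i, (pd i f p.1 - pd i f p.2) * biotSavart (p.1 - p.2) i)
      ∂((γ : Measure T2).prod (γ : Measure T2))

/-- The expression inside the supremum that defines the action. -/
def actionTest (ν T : ℝ) (ρ : ℝ → PT2) (φ : ℝ → T2 → ℝ) : ℝ :=
  (∫ x, φ T x ∂(ρ T : Measure T2)) - (∫ x, φ 0 x ∂(ρ 0 : Measure T2))
    - (∫ s in (0 : ℝ)..T, ∫ x, deriv (fun r => φ r x) s ∂(ρ s : Measure T2))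
    - ν * (∫ s in (0 : ℝ)..T, ∫ x, lap (φ s) x ∂(ρ s : Measure T2))
    - (∫ s in (0 : ℝ)..T, pairR (φ s) (ρ s))
    - ν * (∫ s in (0 : ℝ)..T, ∫ x, (∑ i, (pd i (φ s) x) ^ 2) ∂(ρ s : Measure T2))

/-- The action `Ā_T(ρ) ∈ [0, ∞]`, in variational form. -/
def action (ν T : ℝ) (ρ : ℝ → PT2) : EReal :=
  ⨆ (φ : ℝ → T2 → ℝ) (_ : IsSmoothInTime φ), (actionTest ν T ρ φ : EReal)

open Classical in
/-- The entropy `S(γ) = ∫ γ log γ dx`, equal to `∞` if `γ` has no density. The negative part of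
`γ log γ` is bounded, so the difference below is the integral in `(-∞, ∞]`. -/
def entropy (γ : PT2) : EReal :=
  if (γ : Measure T2) ≪ volume then
    ((∫⁻ x, ENNReal.ofReal (density γ x * Real.log (density γ x)) : ℝ≥0∞) : EReal)
      - ((∫⁻ x, ENNReal.ofReal (-(density γ x * Real.log (density γ x))) : ℝ≥0∞) : EReal)
  else ⊤

/-- `g ∈ L¹` is the distributional gradient of the function `f` on the torus. -/
def IsWeakGradient (f : T2 → ℝ) (g : Fin 2 → T2 → ℝ) : Prop :=
  (∀ i, Integrable (g i)) ∧
    ∀ φ : T2 → ℝ, IsSmooth φ → ∀ i, ∫ x, f x * pd i φ x = -∫ x, g i x * φ x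

/-- The Fisher information `I(γ) = ∫ |∇γ|² / γ dx` if `γ` has a density whose distributional
gradient is in `L¹`, and `∞` otherwise. The gradient is unique up to null sets, so the infimum
runs over equal values, and it is `∞` when there is no admissible gradient. The convention
`0 / 0 = 0` of `ℝ≥0∞` is used where `γ = 0`. -/
def fisher (γ : PT2) : ℝ≥0∞ :=
  ⨅ (g : Fin 2 → T2 → ℝ) (_ : (γ : Measure T2) ≪ volume ∧ IsWeakGradient (density γ) g),
    ∫⁻ x, ENNReal.ofReal (∑ i, (g i x) ^ 2) / ENNReal.ofReal (density γ x)

end VortexLDP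

end

/-! Formally, one tests the action with `φ = ½ log ρ`. The time terms give half the increment of the
entropy. The nonlinearity is transport by a divergence-free field and contributes nothing. The
viscous term gives `-(ν/2) I`, and the quadratic term gives only `+(ν/4) I`. Hence the entropy at
time `t` plus a multiple of the Fisher information integrated over `[s, t]` is at most the entropy
at time `s` plus twice the action. The entropy at time `s` is at most `log (1 + ‖ρ(s) - 1‖₂²)`, and
some `s ≤ t` has squared distance at most its average, which `Q_T` bounds by `2Q/(νt)`. This is the
first claim. The same inequality bounds the integral of `I` over `[τ, T]` by a constant plus a
multiple of `log (2Q/(ντ) + 1)`, and a dyadic summation in `τ` gives the second.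

To make this rigorous, `ρ` is mollified by strictly positive even trigonometric polynomials `J`, and
the test function is `½ J * log (J * ρ)`. It involves finitely many spatial modes, whose
coefficients are merely continuous in time. Convexity of the entropy (`half_ent_sub_le`) replaces
the chain rule: along a partition, with coefficients frozen at right endpoints, the increments of
the entropy telescope into an inequality (`step_le`, `chain_le`).

The cost of mollifying is a commutator between `J` and the velocity field (`integral_conv_mul_le`,
`sum_pairTerm_conv_le`). Young's inequality moves one part of it into the Fisher information. What
remains is the mean square increment of the velocity under `ρ`, and Ladyzhenskaya's inequality
bounds it by `(1 + ‖ρ - 1‖₂²) √defect`, where the defect is the part of the negative Sobolev norm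
lost under `J`. The defect tends to zero and stays below a multiple of the energy, while `‖ρ - 1‖₂²`
is integrable in time. Finiteness of `Q_T` supplies both facts, so by dominated convergence the time
integral of the commutator vanishes (`tendsto_integral_comm`).

Two Fourier identities link these estimates to kernels given in physical space. Both come from
writing the Green function as a time integral of the heat kernel: `energy_eq` identifies the energy
with half the squared negative Sobolev norm, and `hasSum_pairR` expands the nonlinearity over
frequencies when the density is in `L²`.

Removing the mollifier uses lower semicontinuity. The entropy is handled by its dual inequality
(`entropy_le_of_variational`), and the Fisher information by weak limits of score functions in
`L²(γ)` (`exists_score`, `fisher_le_liminf`). -/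

namespace VortexLDP

open Filter Topology HurwitzZeta
open scoped ComplexConjugate

/-! ## Smooth functions on the torus -/

section Smooth

instance isProbabilityMeasure_unitAddCircle :
    IsProbabilityMeasure (volume : Measure UnitAddCircle) :=
  ⟨by simp [AddCircle.measure_univ]⟩

/-- The `i`-th unit vector times `h`, projected to the torus. -/
noncomputable def shift (i : Fin 2) (h : ℝ) : T2 := toT2 (Pi.single i h)

lemma toT2_add (x y : Fin 2 → ℝ) : toT2 (x + y) = toT2 x + toT2 y := by
  ext i; simp [toT2]

lemma continuous_toT2 : Continuous toT2 := by
  unfold toT2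
  refine continuous_pi fun i => ?_
  exact (AddCircle.continuous_mk' 1).comp (continuous_apply i)

/-- Smoothness on the torus is a condition on the periodic lift. The quotient map carries continuity
back to the torus and lets every point be lifted. -/
lemma isOpenQuotientMap_toT2 : IsOpenQuotientMap toT2 := by
  have : IsOpenQuotientMap (Pi.map (fun (_ : Fin 2) (y : ℝ) => (y : UnitAddCircle))) :=
    IsOpenQuotientMap.piMap fun i => QuotientAddGroup.isOpenQuotientMap_mk
  exact this

lemma toT2_surjective : Function.Surjective toT2 := isOpenQuotientMap_toT2.surjective

lemma continuous_shift (i : Fin 2) : Continuous (shift i) := by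
  unfold shift
  refine continuous_toT2.comp ?_
  exact continuous_single (A := fun _ : Fin 2 => ℝ) i

lemma shift_add (i : Fin 2) (a b : ℝ) : shift i (a + b) = shift i a + shift i b := by
  rw [shift, Pi.single_add, toT2_add]; rfl

lemma shift_zero (i : Fin 2) : shift i 0 = 0 := by
  ext j; simp [shift, toT2]

lemma pd_def (i : Fin 2) (f : T2 → ℝ) (x : T2) :
    pd i f x = deriv (fun h : ℝ => f (x + shift i h)) 0 := rfl

namespace IsSmooth

variable {f g : T2 → ℝ}

lemma continuous (hf : IsSmooth f) : Continuous f :=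
  isOpenQuotientMap_toT2.isQuotientMap.continuous_iff.2 (ContDiff.continuous hf)

lemma lift_shift (y : Fin 2 → ℝ) (i : Fin 2) (h : ℝ) :
    f (toT2 y + shift i h) = (fun y => f (toT2 y)) (y + h • Pi.single i (1:ℝ)) := by
  have : h • Pi.single i (1:ℝ) = (Pi.single i h : Fin 2 → ℝ) := by
    rw [← Pi.single_smul]; simp
  simp only [this, toT2_add, shift]

lemma hasDerivAt_fderiv (hf : IsSmooth f) (y : Fin 2 → ℝ) (i : Fin 2) :
    HasDerivAt (fun h : ℝ => f (toT2 y + shift i h))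
      (fderiv ℝ (fun y => f (toT2 y)) y (Pi.single i 1)) 0 := by
  simp only [lift_shift]
  have h1 : HasFDerivAt (fun y => f (toT2 y)) (fderiv ℝ (fun y => f (toT2 y)) y)
      (y + (0:ℝ) • Pi.single i (1:ℝ)) := by
    rw [zero_smul, add_zero]
    exact ((ContDiff.differentiable hf (by simp)) y).hasFDerivAt
  have h2 : HasDerivAt (fun h : ℝ => y + h • Pi.single i (1:ℝ)) (Pi.single i (1:ℝ)) 0 := by
    simpa using ((hasDerivAt_id (0:ℝ)).smul_const (Pi.single i (1:ℝ) : Fin 2 → ℝ)).const_add y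
  exact h1.comp_hasDerivAt (0:ℝ) h2

lemma pd_toT2 (hf : IsSmooth f) (y : Fin 2 → ℝ) (i : Fin 2) :
    pd i f (toT2 y) = fderiv ℝ (fun y => f (toT2 y)) y (Pi.single i 1) :=
  (hf.hasDerivAt_fderiv y i).deriv

lemma hasDerivAt_zero (hf : IsSmooth f) (x : T2) (i : Fin 2) :
    HasDerivAt (fun h : ℝ => f (x + shift i h)) (pd i f x) 0 := by
  obtain ⟨y, rfl⟩ := toT2_surjective x
  rw [hf.pd_toT2]; exact hf.hasDerivAt_fderiv y i

lemma hasDerivAt (hf : IsSmooth f) (x : T2) (i : Fin 2) (t : ℝ) :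
    HasDerivAt (fun h : ℝ => f (x + shift i h)) (pd i f (x + shift i t)) t := by
  have h := hf.hasDerivAt_zero (x + shift i t) i
  have h2 := HasDerivAt.comp_sub_const (f := fun h => f (x + shift i t + shift i h)) t t
    (by rw [sub_self]; exact h)
  refine h2.congr_of_eventuallyEq (Eventually.of_forall fun u => ?_)
  simp only [add_assoc, ← shift_add]; congr 3; ring

protected lemma pd (hf : IsSmooth f) (i : Fin 2) : IsSmooth (pd i f) := by
  unfold IsSmooth
  simp only [hf.pd_toT2]
  exact (ContDiff.fderiv_right (m := ∞) hf (by simp)).clm_apply contDiff_const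

protected lemma add (hf : IsSmooth f) (hg : IsSmooth g) : IsSmooth (fun x => f x + g x) :=
  ContDiff.add hf hg

protected lemma sub (hf : IsSmooth f) (hg : IsSmooth g) : IsSmooth (fun x => f x - g x) :=
  ContDiff.sub hf hg

protected lemma mul (hf : IsSmooth f) (hg : IsSmooth g) : IsSmooth (fun x => f x * g x) :=
  ContDiff.mul hf hg

protected lemma const_mul (c : ℝ) (hf : IsSmooth f) : IsSmooth (fun x => c * f x) :=
  ContDiff.mul contDiff_const hf

protected lemma sum {ι : Type*} (s : Finset ι) {F : ι → T2 → ℝ} (h : ∀ i ∈ s, IsSmooth (F i)) :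
    IsSmooth (fun x => ∑ i ∈ s, F i x) :=
  ContDiff.sum fun i hi => h i hi

protected lemma log (hf : IsSmooth f) (h : ∀ x, f x ≠ 0) : IsSmooth (fun x => Real.log (f x)) :=
  ContDiff.log hf fun y => h (toT2 y)

lemma pd_add (hf : IsSmooth f) (hg : IsSmooth g) (i : Fin 2) (x : T2) :
    VortexLDP.pd i (fun x => f x + g x) x = VortexLDP.pd i f x + VortexLDP.pd i g x :=
  ((hf.hasDerivAt_zero x i).add (hg.hasDerivAt_zero x i)).deriv

lemma pd_sub (hf : IsSmooth f) (hg : IsSmooth g) (i : Fin 2) (x : T2) :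
    VortexLDP.pd i (fun x => f x - g x) x = VortexLDP.pd i f x - VortexLDP.pd i g x :=
  ((hf.hasDerivAt_zero x i).sub (hg.hasDerivAt_zero x i)).deriv

lemma pd_mul (hf : IsSmooth f) (hg : IsSmooth g) (i : Fin 2) (x : T2) :
    VortexLDP.pd i (fun x => f x * g x) x =
      VortexLDP.pd i f x * g x + f x * VortexLDP.pd i g x := by
  have := ((hf.hasDerivAt_zero x i).mul (hg.hasDerivAt_zero x i)).deriv
  simp only [shift_zero, add_zero] at this
  exact this

lemma pd_const_mul (c : ℝ) (hf : IsSmooth f) (i : Fin 2) (x : T2) :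
    VortexLDP.pd i (fun x => c * f x) x = c * VortexLDP.pd i f x :=
  ((hf.hasDerivAt_zero x i).const_mul c).deriv

lemma pd_sum {ι : Type*} (s : Finset ι) {F : ι → T2 → ℝ} (h : ∀ i ∈ s, IsSmooth (F i))
    (j : Fin 2) (x : T2) :
    VortexLDP.pd j (fun x => ∑ i ∈ s, F i x) x = ∑ i ∈ s, VortexLDP.pd j (F i) x :=
  (HasDerivAt.fun_sum fun i hi => (h i hi).hasDerivAt_zero x j).deriv

lemma pd_log (hf : IsSmooth f) (h : ∀ x, f x ≠ 0) (i : Fin 2) (x : T2) :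
    VortexLDP.pd i (fun x => Real.log (f x)) x = VortexLDP.pd i f x / f x := by
  have := ((hf.hasDerivAt_zero x i).log (by simpa [shift_zero] using h x)).deriv
  simp only [shift_zero, add_zero] at this
  exact this

end IsSmooth

lemma integrable_of_continuous {X : Type*} [TopologicalSpace X] [CompactSpace X]
    [MeasurableSpace X] [OpensMeasurableSpace X] (μ : Measure X)
    [IsFiniteMeasure μ] {E : Type*} [NormedAddCommGroup E] [SecondCountableTopologyEither X E]
    {f : X → E} (hf : Continuous f) : Integrable f μ := by
  obtain ⟨C, hC⟩ := isCompact_univ.exists_bound_of_continuousOn hf.continuousOn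
  exact Integrable.of_bound hf.aestronglyMeasurable C (Eventually.of_forall fun x => hC x (mem_univ x))

/-- The integral of a derivative over the torus vanishes. -/
lemma integral_pd_eq_zero {f : T2 → ℝ} (hf : IsSmooth f) (i : Fin 2) : ∫ x, pd i f x = 0 := by
  obtain ⟨C, hC⟩ := isCompact_univ.exists_bound_of_continuousOn (hf.pd i).continuous.continuousOn
  have key := (hasDerivAt_integral_of_dominated_loc_of_deriv_le (μ := (volume : Measure T2))
    (F := fun h x => f (x + shift i h)) (F' := fun h x => pd i f (x + shift i h)) (x₀ := (0:ℝ))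
    (bound := fun _ => C) (s := univ) univ_mem
    (Eventually.of_forall fun h =>
      (hf.continuous.comp (continuous_id.add continuous_const)).aestronglyMeasurable)
    (integrable_of_continuous _ (hf.continuous.comp (continuous_id.add continuous_const)))
    ((hf.pd i).continuous.comp (continuous_id.add continuous_const)).aestronglyMeasurable
    (Eventually.of_forall fun x h _ => hC _ (mem_univ _))
    (integrable_const C)
    (Eventually.of_forall fun x h _ => hf.hasDerivAt x i h)).2
  simp only [shift_zero, add_zero] at key
  have hconst : (fun h : ℝ => ∫ x, f (x + shift i h)) = fun _ => ∫ x, f x := by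
    ext h; exact integral_add_right_eq_self f _
  rw [hconst] at key
  exact key.unique (hasDerivAt_const (0:ℝ) _)

/-- Integration by parts on the torus. -/
lemma integral_mul_pd {f g : T2 → ℝ} (hf : IsSmooth f) (hg : IsSmooth g) (i : Fin 2) :
    ∫ x, f x * pd i g x = -∫ x, pd i f x * g x := by
  have h := integral_pd_eq_zero (hf.mul hg) i
  simp only [hf.pd_mul hg] at h
  have h2 := integral_add
    (integrable_of_continuous (volume : Measure T2) ((hf.pd i).continuous.mul hg.continuous))
    (integrable_of_continuous (volume : Measure T2) (hf.continuous.mul (hg.pd i).continuous))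
  simp only [Pi.mul_apply] at h2
  linarith

end Smooth

/-! ## Characters and trigonometric polynomials -/

section Characters

/-- The character `x ↦ exp(2πi k·x)` of the torus. -/
noncomputable def ch (k : Fin 2 → ℤ) (x : T2) : ℂ := UnitAddTorus.mFourier k x

/-- `x ↦ cos(2π k·x)`. -/
noncomputable def cs (k : Fin 2 → ℤ) (x : T2) : ℝ := (ch k x).re

/-- `x ↦ sin(2π k·x)`. -/
noncomputable def sn (k : Fin 2 → ℤ) (x : T2) : ℝ := (ch k x).im

variable (k l : Fin 2 → ℤ) (x y : T2)

lemma continuous_ch : Continuous (ch k) := (UnitAddTorus.mFourier k).continuous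

lemma ch_eq_prod : ch k x = ∏ i, fourier (k i) (x i) := rfl

lemma ch_add : ch k (x + y) = ch k x * ch k y := by
  simp [ch_eq_prod, fourier_apply, AddCircle.toCircle_add]; ring

lemma ch_neg : ch k (-x) = conj (ch k x) := by
  simp [ch_eq_prod, fourier_apply, AddCircle.toCircle_neg, Circle.coe_inv_eq_conj, -Circle.coe_inv]

lemma ch_sub : ch k (x - y) = ch k x * conj (ch k y) := by
  rw [sub_eq_add_neg, ch_add, ch_neg]

lemma ch_index_neg : ch (-k) x = conj (ch k x) := UnitAddTorus.mFourier_neg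

lemma ch_index_add : ch (k + l) x = ch k x * ch l x := UnitAddTorus.mFourier_add

lemma ch_index_zero : ch 0 x = 1 := by simp [ch_eq_prod]

lemma norm_ch : ‖ch k x‖ = 1 := by
  rw [ch_eq_prod, norm_prod]; simp only [fourier_apply, Circle.norm_coe, Finset.prod_const_one]

lemma ch_toT2 (y : Fin 2 → ℝ) :
    ch k (toT2 y) = Complex.exp (2 * Real.pi * Complex.I * (∑ i, k i * y i : ℝ)) := by
  simp [ch_eq_prod, toT2, ← Complex.exp_add]; ring_nf

lemma ch_shift (i : Fin 2) (h : ℝ) :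
    ch k (shift i h) = Complex.exp (2 * Real.pi * Complex.I * k i * h) := by
  rw [shift, ch_toT2]; fin_cases i <;> simp [Pi.single_apply] <;> ring_nf

lemma hasDerivAt_ch (i : Fin 2) :
    HasDerivAt (fun h : ℝ => ch k (x + shift i h)) (2 * Real.pi * Complex.I * k i * ch k x) 0 := by
  simp only [ch_add, ch_shift]
  have h1 : HasDerivAt (fun h : ℝ => Complex.exp (2 * Real.pi * Complex.I * k i * h))
      (2 * Real.pi * Complex.I * k i) 0 := by
    have h2 : HasDerivAt (fun h : ℝ => (2 * Real.pi * Complex.I * k i * h : ℂ))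
        (2 * Real.pi * Complex.I * k i) 0 := by
      simpa using (Complex.ofRealCLM.hasDerivAt (x := (0:ℝ))).const_mul
        (2 * Real.pi * Complex.I * k i : ℂ)
    simpa using h2.cexp
  simpa only [mul_comm (ch k x)] using h1.const_mul (ch k x)

lemma cs_sq_add_sn_sq : cs k x ^ 2 + sn k x ^ 2 = 1 := by
  have := norm_ch k x
  rw [← sq_eq_sq₀ (norm_nonneg _) zero_le_one, ← Complex.normSq_eq_norm_sq,
    Complex.normSq_apply] at this
  simp only [cs, sn]; linarith

lemma continuous_cs : Continuous (cs k) := Complex.continuous_re.comp (continuous_ch k)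

lemma continuous_sn : Continuous (sn k) := Complex.continuous_im.comp (continuous_ch k)

lemma abs_cs_le : |cs k x| ≤ 1 := (Complex.abs_re_le_norm _).trans (norm_ch k x).le

lemma cs_sub : cs k (x - y) = cs k x * cs k y + sn k x * sn k y := by
  simp [cs, sn, ch_sub]

lemma cs_neg : cs k (-x) = cs k x := by simp [cs, ch_neg]

lemma sn_neg : sn k (-x) = -sn k x := by simp [sn, ch_neg]

lemma contDiff_ch_toT2 : ContDiff ℝ ∞ (fun y => ch k (toT2 y)) := by
  simp only [ch_toT2]
  have h : ContDiff ℝ ∞ (fun y : Fin 2 → ℝ => ∑ i, (k i : ℝ) * y i) := by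
    simp only [Fin.sum_univ_two]
    fun_prop
  exact (contDiff_const.mul (Complex.ofRealCLM.contDiff.comp h)).cexp

lemma isSmooth_cs : IsSmooth (cs k) := Complex.reCLM.contDiff.comp (contDiff_ch_toT2 k)

lemma isSmooth_sn : IsSmooth (sn k) := Complex.imCLM.contDiff.comp (contDiff_ch_toT2 k)

lemma pd_cs (i : Fin 2) : pd i (cs k) x = -(2 * Real.pi * k i * sn k x) := by
  have h := (Complex.reCLM.hasFDerivAt.comp_hasDerivAt (0 : ℝ) (hasDerivAt_ch k x i)).deriv
  simp only [Function.comp_def, Complex.reCLM_apply] at h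
  rw [pd_def]; simp only [cs]; rw [h]; simp [sn]

lemma pd_sn (i : Fin 2) : pd i (sn k) x = 2 * Real.pi * k i * cs k x := by
  have h := (Complex.imCLM.hasFDerivAt.comp_hasDerivAt (0 : ℝ) (hasDerivAt_ch k x i)).deriv
  simp only [Function.comp_def, Complex.imCLM_apply] at h
  rw [pd_def]; simp only [sn]; rw [h]; simp [cs]

/-- If `k i ≠ 0`, the real and imaginary parts of the character are, up to a nonzero factor, `i`-th
partial derivatives of smooth functions, and these integrate to zero. -/
lemma integral_ch_of_ne {k : Fin 2 → ℤ} (hk : k ≠ 0) : ∫ x, ch k x = 0 := by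
  obtain ⟨i, hi⟩ := Function.ne_iff.1 hk
  have hi' : (2 * Real.pi * k i : ℝ) ≠ 0 := by
    have : (k i : ℝ) ≠ 0 := by exact_mod_cast hi
    have := Real.pi_ne_zero
    positivity
  have h1 := integral_pd_eq_zero (isSmooth_cs k) i
  have h2 := integral_pd_eq_zero (isSmooth_sn k) i
  simp only [pd_cs, pd_sn, integral_neg, integral_const_mul, neg_eq_zero, mul_eq_zero, hi',
    false_or] at h1 h2
  have hint : Integrable (ch k) (volume : Measure T2) := integrable_of_continuous _ (continuous_ch k)
  rw [← integral_re_add_im hint]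
  simp only [RCLike.re_to_complex, RCLike.im_to_complex]
  change ((∫ x, cs k x : ℝ) : ℂ) + ((∫ x, sn k x : ℝ) : ℂ) * _ = 0
  rw [h1, h2]; simp

lemma integral_ch : ∫ x, ch k x = if k = 0 then 1 else 0 := by
  split_ifs with h
  · subst h; simp [ch_index_zero]
  · exact integral_ch_of_ne h

lemma integral_ch_mul_conj : ∫ x, ch k x * conj (ch l x) = if k = l then 1 else 0 := by
  simp only [← ch_index_neg, ← ch_index_add, integral_ch, ← sub_eq_add_neg, sub_eq_zero]

/-- A trigonometric polynomial with frequencies in `B`. -/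
noncomputable def trig (B : Finset (Fin 2 → ℤ)) (β : (Fin 2 → ℤ) → ℂ) (x : T2) : ℂ :=
  ∑ k ∈ B, β k * ch k x

lemma continuous_trig (B : Finset (Fin 2 → ℤ)) (β : (Fin 2 → ℤ) → ℂ) : Continuous (trig B β) :=
  continuous_finsetSum _ fun k _ => continuous_const.mul (continuous_ch k)

/-- Parseval's identity for trigonometric polynomials. -/
lemma integral_norm_trig_sq (B : Finset (Fin 2 → ℤ)) (β : (Fin 2 → ℤ) → ℂ) :
    ∫ x, ‖trig B β x‖ ^ 2 = ∑ k ∈ B, ‖β k‖ ^ 2 := by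
  have h : ∀ x, ((‖trig B β x‖ ^ 2 : ℝ) : ℂ) =
      ∑ k ∈ B, ∑ l ∈ B, β k * conj (β l) * (ch k x * conj (ch l x)) := by
    intro x
    rw [Complex.ofReal_pow, ← Complex.mul_conj', trig, map_sum, Finset.sum_mul_sum]
    refine Finset.sum_congr rfl fun k _ => Finset.sum_congr rfl fun l _ => ?_
    rw [map_mul]; ring
  have hint : ∀ k l, Integrable (fun x => β k * conj (β l) * (ch k x * conj (ch l x)))
      (volume : Measure T2) := fun k l => integrable_of_continuous _
    (continuous_const.mul ((continuous_ch k).mul (Complex.continuous_conj.comp (continuous_ch l))))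
  apply Complex.ofReal_injective
  rw [← integral_complex_ofReal]
  simp only [h]
  rw [integral_finsetSum _ fun k _ => integrable_finsetSum _ fun l _ => hint k l]
  simp_rw [integral_finsetSum B fun l _ => hint _ l, integral_const_mul, integral_ch_mul_conj]
  simp only [mul_ite, mul_one, mul_zero, Finset.sum_ite_eq, Complex.ofReal_sum, Complex.ofReal_pow]
  refine Finset.sum_congr rfl fun k hk => ?_
  rw [if_pos hk, Complex.mul_conj']

/-- Cauchy–Schwarz for integrals of real functions. -/
lemma integral_mul_le_sqrt {X : Type*} [MeasurableSpace X] (μ : Measure X) {f g : X → ℝ}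
    (hf : AEStronglyMeasurable f μ) (hg : AEStronglyMeasurable g μ)
    (hf2 : Integrable (fun x => f x ^ 2) μ) (hg2 : Integrable (fun x => g x ^ 2) μ) :
    ∫ x, |f x * g x| ∂μ ≤ √(∫ x, f x ^ 2 ∂μ) * √(∫ x, g x ^ 2 ∂μ) := by
  have h := integral_mul_norm_le_Lp_mul_Lq (μ := μ) (p := 2) (q := 2) (f := f) (g := g)
    Real.HolderConjugate.two_two
    (by simpa using (memLp_two_iff_integrable_sq hf).2 hf2)
    (by simpa using (memLp_two_iff_integrable_sq hg).2 hg2)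
  simp only [Real.norm_eq_abs, Real.rpow_two, sq_abs] at h
  simpa only [abs_mul, Real.sqrt_eq_rpow] using h

lemma integrable_mul_of_sq {X : Type*} [MeasurableSpace X] (μ : Measure X) {f g : X → ℝ}
    (hf : AEStronglyMeasurable f μ) (hg : AEStronglyMeasurable g μ)
    (hf2 : Integrable (fun x => f x ^ 2) μ) (hg2 : Integrable (fun x => g x ^ 2) μ) :
    Integrable (fun x => f x * g x) μ :=
  ((memLp_two_iff_integrable_sq hf).2 hf2).integrable_mul ((memLp_two_iff_integrable_sq hg).2 hg2)

/-- Bessel's inequality for a real square integrable function. -/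
lemma bessel {f : T2 → ℝ} (hf : AEStronglyMeasurable f volume)
    (hf2 : Integrable (fun x => f x ^ 2)) (B : Finset (Fin 2 → ℤ)) :
    ∑ k ∈ B, ‖∫ x, (f x : ℂ) * ch k x‖ ^ 2 ≤ ∫ x, f x ^ 2 := by
  set b : (Fin 2 → ℤ) → ℂ := fun k => ∫ x, (f x : ℂ) * ch k x with hb
  -- Pairing `f` with the polynomial built from its own conjugate coefficients reproduces their
  -- square sum `Σ`. Cauchy–Schwarz then gives `Σ ≤ ‖f‖₂ √Σ`.
  set U : T2 → ℂ := trig B (fun k => conj (b k)) with hU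
  have hUc : Continuous U := continuous_trig _ _
  have hf1 : Integrable f := by
    simpa using integrable_mul_of_sq volume hf aestronglyMeasurable_const hf2
      (g := fun _ => (1:ℝ)) (by simp)
  have hi : ∀ k, Integrable (fun x => (f x : ℂ) * ch k x) := fun k =>
    hf1.ofReal.mul_bdd (c := 1) (continuous_ch k).aestronglyMeasurable
      (Eventually.of_forall fun x => (norm_ch k x).le)
  have h1 : ∫ x, (f x : ℂ) * U x = ((∑ k ∈ B, ‖b k‖ ^ 2 : ℝ) : ℂ) := by
    have : ∀ x, (f x : ℂ) * U x = ∑ k ∈ B, conj (b k) * ((f x : ℂ) * ch k x) := by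
      intro x; rw [hU, trig, Finset.mul_sum]; refine Finset.sum_congr rfl fun k _ => by ring
    simp only [this]
    rw [integral_finsetSum _ fun k _ => (hi k).const_mul _, Complex.ofReal_sum]
    refine Finset.sum_congr rfl fun k _ => ?_
    rw [integral_const_mul, Complex.ofReal_pow, ← Complex.conj_mul']
  have h2 : ∫ x, f x * (U x).re = ∑ k ∈ B, ‖b k‖ ^ 2 := by
    have h3 := congrArg Complex.re h1
    have hint : Integrable (fun x => (f x : ℂ) * U x) := by
      obtain ⟨C, hC⟩ := isCompact_univ.exists_bound_of_continuousOn hUc.continuousOn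
      exact hf1.ofReal.mul_bdd (c := C) hUc.aestronglyMeasurable
        (Eventually.of_forall fun x => hC x (mem_univ _))
    rw [← RCLike.re_eq_complex_re, ← integral_re hint, RCLike.re_eq_complex_re,
      Complex.ofReal_re] at h3
    simpa using h3
  have hS : ∫ x, (U x).re ^ 2 ≤ ∑ k ∈ B, ‖b k‖ ^ 2 := by
    have := integral_norm_trig_sq B (fun k => conj (b k))
    simp only [RCLike.norm_conj] at this
    rw [← this]
    refine integral_mono (integrable_of_continuous _ ((Complex.continuous_re.comp hUc).pow 2))
      (integrable_of_continuous _ (hUc.norm.pow 2)) fun x => ?_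
    exact sq_le_sq' (by have := Complex.abs_re_le_norm (U x); rw [abs_le] at this; exact this.1)
      ((le_abs_self _).trans (Complex.abs_re_le_norm (U x)))
  have hS0 : 0 ≤ ∑ k ∈ B, ‖b k‖ ^ 2 := Finset.sum_nonneg fun _ _ => by positivity
  have hF0 : 0 ≤ ∫ x, f x ^ 2 := integral_nonneg fun _ => sq_nonneg _
  have h4 : ∑ k ∈ B, ‖b k‖ ^ 2 ≤ √(∫ x, f x ^ 2) * √(∑ k ∈ B, ‖b k‖ ^ 2) := by
    calc _ = ∫ x, f x * (U x).re := h2.symm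
      _ ≤ ∫ x, |f x * (U x).re| := by
          refine (le_abs_self _).trans ?_
          simpa only [Real.norm_eq_abs] using norm_integral_le_integral_norm (fun x => f x * (U x).re)
      _ ≤ √(∫ x, f x ^ 2) * √(∫ x, (U x).re ^ 2) := integral_mul_le_sqrt _ hf
          (Complex.continuous_re.comp hUc).aestronglyMeasurable hf2
          (integrable_of_continuous _ ((Complex.continuous_re.comp hUc).pow 2))
      _ ≤ _ := by gcongr
  have h5 : (√(∑ k ∈ B, ‖b k‖ ^ 2)) ^ 2 = ∑ k ∈ B, ‖b k‖ ^ 2 := Real.sq_sqrt hS0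
  have h6 : (√(∫ x, f x ^ 2)) ^ 2 = ∫ x, f x ^ 2 := Real.sq_sqrt hF0
  have h7 := Real.sqrt_nonneg (∑ k ∈ B, ‖b k‖ ^ 2)
  have h8 := Real.sqrt_nonneg (∫ x, f x ^ 2)
  rw [← h5, ← h6]
  nlinarith [sq_nonneg (√(∑ k ∈ B, ‖b k‖ ^ 2) - √(∫ x, f x ^ 2))]

end Characters

/-! ## Ladyzhenskaya's inequality -/

section Ladyzhenskaya

lemma integral_T2_eq {E : Type*} [NormedAddCommGroup E] [NormedSpace ℝ E] (f : T2 → E) :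
    ∫ x, f x = ∫ p : UnitAddCircle × UnitAddCircle, f ![p.1, p.2] := by
  have h := (volume_preserving_finTwoArrow UnitAddCircle).symm
  rw [← h.integral_comp (MeasurableEquiv.measurableEmbedding _)]
  rfl

/-- A smooth function is controlled pointwise by averages over a circle through the point. -/
lemma sq_le_integral_shift {v : T2 → ℝ} (hv : IsSmooth v) (i : Fin 2) (x : T2) :
    v x ^ 2 ≤ ∫ h in (0 : ℝ)..1, (v (x + shift i h) ^ 2 + 2 * |v (x + shift i h)| *
      |pd i v (x + shift i h)|) := by
  have hc : Continuous fun h => v (x + shift i h) :=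
    hv.continuous.comp (continuous_const.add (continuous_shift i))
  have hd : Continuous fun h => pd i v (x + shift i h) :=
    (hv.pd i).continuous.comp (continuous_const.add (continuous_shift i))
  set D : ℝ → ℝ := fun h => 2 * |v (x + shift i h)| * |pd i v (x + shift i h)| with hD
  have hc2 : Continuous fun h => v (x + shift i h) ^ 2 := hc.pow 2
  have hDc : Continuous D := (continuous_const.mul hc.abs).mul hd.abs
  have hD0 : ∀ h, 0 ≤ D h := fun h => by positivity
  -- The fundamental theorem of calculus along the circle compares `v²` at `x` with `v²` at any
  -- other point of it. Averaging over `h` then gives the claim.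
  have h1 : ∀ h ∈ Icc (0:ℝ) 1, v x ^ 2 ≤ v (x + shift i h) ^ 2 + ∫ r in (0:ℝ)..1, D r := by
    intro h hh
    have hder : ∀ r ∈ uIcc (0:ℝ) h, HasDerivAt (fun r => v (x + shift i r) ^ 2)
        (2 * v (x + shift i r) * pd i v (x + shift i r)) r := by
      intro r _
      have h := (hv.hasDerivAt x i r).fun_pow 2
      simpa using h
    have h2 := intervalIntegral.integral_eq_sub_of_hasDerivAt hder
      (((continuous_const.mul hc).mul hd).intervalIntegrable _ _)
    simp only [shift_zero, add_zero] at h2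
    have h3 : -∫ r in (0:ℝ)..h, 2 * v (x + shift i r) * pd i v (x + shift i r) ≤
        ∫ r in (0:ℝ)..h, D r := by
      rw [← intervalIntegral.integral_neg]
      refine intervalIntegral.integral_mono_on hh.1
        (((continuous_const.mul hc).mul hd).neg.intervalIntegrable _ _)
        (hDc.intervalIntegrable _ _) fun r _ => ?_
      refine (neg_le_abs _).trans ?_
      simp [hD, abs_mul]
    have h4 : ∫ r in (0:ℝ)..h, D r ≤ ∫ r in (0:ℝ)..1, D r := by
      refine intervalIntegral.integral_mono_interval le_rfl hh.1 hh.2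
        (Eventually.of_forall hD0) (hDc.intervalIntegrable _ _)
    linarith
  have h5 : ∫ _ in (0:ℝ)..1, v x ^ 2 ≤
      ∫ h in (0:ℝ)..1, (v (x + shift i h) ^ 2 + ∫ r in (0:ℝ)..1, D r) :=
    intervalIntegral.integral_mono_on zero_le_one (continuous_const.intervalIntegrable _ _)
      ((hc2.add continuous_const).intervalIntegrable _ _) h1
  rw [intervalIntegral.integral_add (hc2.intervalIntegrable _ _)
    (continuous_const.intervalIntegrable _ _)] at h5
  rw [intervalIntegral.integral_add (hc2.intervalIntegrable _ _)
    (hDc.intervalIntegrable _ _)]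
  simpa using h5

lemma integral_shift_zero (G : T2 → ℝ) (a b : UnitAddCircle) :
    ∫ h in (0 : ℝ)..1, G (![a, b] + shift 0 h) = ∫ s : UnitAddCircle, G ![s, b] := by
  have h1 : ∀ h : ℝ, ![a, b] + shift 0 h = ![a + h, b] := by
    intro h; ext j; fin_cases j <;> simp [shift, toT2]
  simp only [h1]
  have h2 := UnitAddCircle.intervalIntegral_preimage 0 (fun s : UnitAddCircle => G ![a + s, b])
  simp only [zero_add] at h2
  rw [h2]
  exact integral_add_left_eq_self (fun s : UnitAddCircle => G ![s, b]) a

lemma integral_shift_one (G : T2 → ℝ) (a b : UnitAddCircle) :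
    ∫ h in (0 : ℝ)..1, G (![a, b] + shift 1 h) = ∫ s : UnitAddCircle, G ![a, s] := by
  have h1 : ∀ h : ℝ, ![a, b] + shift 1 h = ![a, b + h] := by
    intro h; ext j; fin_cases j <;> simp [shift, toT2]
  simp only [h1]
  have h2 := UnitAddCircle.intervalIntegral_preimage 0 (fun s : UnitAddCircle => G ![a, b + s])
  simp only [zero_add] at h2
  rw [h2]
  exact integral_add_left_eq_self (fun s : UnitAddCircle => G ![a, s]) b

/-- Ladyzhenskaya's inequality on the torus. -/
lemma integral_pow_four_le {v : T2 → ℝ} (hv : IsSmooth v) :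
    ∫ x, v x ^ 4 ≤ (∫ x, (v x ^ 2 + 2 * |v x| * |pd 0 v x|)) *
      (∫ x, (v x ^ 2 + 2 * |v x| * |pd 1 v x|)) := by
  set G : Fin 2 → T2 → ℝ := fun i x => v x ^ 2 + 2 * |v x| * |pd i v x| with hG
  have hGc : ∀ i, Continuous (G i) := fun i => (hv.continuous.pow 2).add
    ((continuous_const.mul hv.continuous.abs).mul (hv.pd i).continuous.abs)
  have hvec : Continuous fun p : UnitAddCircle × UnitAddCircle => (![p.1, p.2] : T2) := by
    refine continuous_pi fun j => ?_
    fin_cases j <;> simp <;> fun_prop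
  have hA0 : ∀ b, 0 ≤ ∫ s : UnitAddCircle, G 0 ![s, b] := fun b =>
    integral_nonneg fun s => by simp only [hG]; positivity
  -- One square is bounded along each direction. The first bound depends on `a` alone and the second
  -- on `b` alone, so the integral of the product factorises.
  have hpt : ∀ a b : UnitAddCircle, v ![a, b] ^ 4 ≤
      (∫ s : UnitAddCircle, G 1 ![a, s]) * (∫ s : UnitAddCircle, G 0 ![s, b]) := by
    intro a b
    have h0 := sq_le_integral_shift hv 0 ![a, b]
    have h1 := sq_le_integral_shift hv 1 ![a, b]
    rw [integral_shift_zero (G 0)] at h0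
    rw [integral_shift_one (G 1)] at h1
    calc v ![a, b] ^ 4 = v ![a, b] ^ 2 * v ![a, b] ^ 2 := by ring
      _ ≤ _ := mul_le_mul h1 h0 (sq_nonneg _) ((sq_nonneg _).trans h1)
  have hc0 : Continuous fun b => ∫ s : UnitAddCircle, G 0 ![s, b] :=
    (continuous_parametric_integral_of_continuous (μ := (volume : Measure UnitAddCircle))
      (f := fun b s => G 0 ![s, b]) ((hGc 0).comp (hvec.comp continuous_swap))
      isCompact_univ).congr (by simp)
  have hc1 : Continuous fun a => ∫ s : UnitAddCircle, G 1 ![a, s] :=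
    (continuous_parametric_integral_of_continuous (μ := (volume : Measure UnitAddCircle))
      (f := fun a s => G 1 ![a, s]) ((hGc 1).comp hvec) isCompact_univ).congr (by simp)
  rw [integral_T2_eq, integral_T2_eq (G 0), integral_T2_eq (G 1)]
  calc _ ≤ ∫ p : UnitAddCircle × UnitAddCircle,
        (∫ s : UnitAddCircle, G 1 ![p.1, s]) * (∫ s : UnitAddCircle, G 0 ![s, p.2]) :=
        integral_mono (integrable_of_continuous _ ((hv.continuous.comp hvec).pow 4))
          (integrable_of_continuous _ ((hc1.comp continuous_fst).mul (hc0.comp continuous_snd)))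
          fun p => hpt p.1 p.2
    _ = (∫ a : UnitAddCircle, ∫ s : UnitAddCircle, G 1 ![a, s]) *
          ∫ b : UnitAddCircle, ∫ s : UnitAddCircle, G 0 ![s, b] :=
        integral_prod_mul (μ := (volume : Measure UnitAddCircle))
          (ν := (volume : Measure UnitAddCircle)) (fun a => ∫ s : UnitAddCircle, G 1 ![a, s])
          (fun b => ∫ s : UnitAddCircle, G 0 ![s, b])
    _ = _ := by
        rw [mul_comm]
        congr 1
        · exact (integral_prod_symm (μ := (volume : Measure UnitAddCircle))
            (ν := (volume : Measure UnitAddCircle)) (fun p => G 0 ![p.1, p.2])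
            (integrable_of_continuous _ ((hGc 0).comp hvec))).symm
        · exact (integral_prod (μ := (volume : Measure UnitAddCircle))
            (ν := (volume : Measure UnitAddCircle)) (fun p => G 1 ![p.1, p.2])
            (integrable_of_continuous _ ((hGc 1).comp hvec))).symm

end Ladyzhenskaya

/-! ## One-dimensional theta functions -/

section Theta

/-- One term of the exponential series suffices. The case `n = 2` controls the Fourier coefficients,
and `n = 3` the smallness of the kernel at small times. -/
lemma exp_neg_le_inv_pow {y : ℝ} (hy : 0 < y) (n : ℕ) :
    Real.exp (-y) ≤ n.factorial * (y ^ n)⁻¹ := by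
  have h := Real.pow_div_factorial_le_exp y hy.le n
  have hn : (0:ℝ) < n.factorial := by exact_mod_cast n.factorial_pos
  have hyn : 0 < y ^ n := by positivity
  rw [Real.exp_neg, inv_le_comm₀ (Real.exp_pos y) (by positivity)]
  rwa [mul_inv, inv_inv, mul_comm, ← div_eq_mul_inv]

lemma hasSum_cosKernel (x : UnitAddCircle) {s : ℝ} (hs : 0 < s) :
    HasSum (fun n : ℤ => (Real.exp (-Real.pi * n ^ 2 * s) : ℂ) * fourier n x)
      (cosKernel x s : ℂ) := by
  induction x using QuotientAddGroup.induction_on with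
  | H a =>
    have h := hasSum_int_cosKernel a hs
    refine h.congr_fun fun n => ?_
    have : (fourier n ((a : ℝ) : UnitAddCircle) : ℂ) =
        Complex.exp (2 * Real.pi * Complex.I * a * n) := by
      rw [fourier_coe_apply]; congr 1; push_cast; ring
    rw [this]; ring

/-- The derivative in space of the one-dimensional heat kernel `cosKernel`. -/
noncomputable def dcos (x : UnitAddCircle) (s : ℝ) : ℝ :=
  (∑' n : ℤ, (2 * Real.pi * Complex.I * n * Real.exp (-Real.pi * n ^ 2 * s) : ℂ) * fourier n x).re

lemma norm_fourier_apply (n : ℤ) (x : UnitAddCircle) : ‖(fourier n x : ℂ)‖ = 1 := by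
  simp only [fourier_apply, Circle.norm_coe]

lemma norm_dcos_coeff (n : ℤ) (s : ℝ) :
    ‖(2 * Real.pi * Complex.I * n * Real.exp (-Real.pi * n ^ 2 * s) : ℂ)‖ =
      2 * Real.pi * |(n:ℝ)| * Real.exp (-Real.pi * n ^ 2 * s) := by
  rw [← Complex.ofReal_intCast]
  simp [Complex.norm_real, abs_of_pos Real.pi_pos, -Complex.ofReal_exp, -Complex.ofReal_intCast,
    abs_of_pos (Real.exp_pos _)]

/-- The quadratic term of the exponential trades the Gaussian for a summable power of `n`, with
constant `2/π² ≤ 1`. At `n = 0` both sides vanish by the convention for division by zero. -/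
lemma abs_int_mul_exp_le (n : ℤ) {s : ℝ} (hs : 0 < s) :
    |(n:ℝ)| * Real.exp (-Real.pi * n ^ 2 * s) ≤ (1 / |(n:ℝ)| ^ 3) * s⁻¹ ^ 2 := by
  rcases eq_or_ne n 0 with rfl | hn
  · simp
  have hn' : 0 < |(n:ℝ)| := by simpa using hn
  have hpi : (0:ℝ) < Real.pi := Real.pi_pos
  have hpi3 := Real.pi_gt_three
  have h1 := exp_neg_le_inv_pow (y := Real.pi * n ^ 2 * s) (by rw [← sq_abs]; positivity) 2
  have h2 : -Real.pi * (n:ℝ) ^ 2 * s = -(Real.pi * n ^ 2 * s) := by ring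
  rw [h2]
  refine (mul_le_mul_of_nonneg_left h1 hn'.le).trans ?_
  rw [← sq_abs (n:ℝ)]
  have h3 : |(n:ℝ)| * (((2:ℕ).factorial : ℝ) * ((Real.pi * |(n:ℝ)| ^ 2 * s) ^ 2)⁻¹) =
      (2 / Real.pi ^ 2) * ((1 / |(n:ℝ)| ^ 3) * s⁻¹ ^ 2) := by
    simp only [Nat.factorial]; push_cast; field_simp
  rw [h3]
  refine mul_le_of_le_one_left (by positivity) ?_
  rw [div_le_one (by positivity)]; nlinarith

lemma summable_one_div_abs_pow {p : ℕ} (hp : 1 < p) : Summable fun n : ℤ => 1 / |(n:ℝ)| ^ p := by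
  have h := (Real.summable_one_div_int_pow (p := p)).2 hp
  refine h.abs.congr fun n => ?_
  rw [abs_div, abs_one, abs_pow]

lemma summable_dcos_bound {s : ℝ} (hs : 0 < s) :
    Summable fun n : ℤ => 2 * Real.pi * |(n:ℝ)| * Real.exp (-Real.pi * n ^ 2 * s) := by
  simp only [mul_assoc (2 * Real.pi)]
  refine Summable.mul_left _ (Summable.of_nonneg_of_le (fun n => by positivity)
    (fun n => abs_int_mul_exp_le n hs) ((summable_one_div_abs_pow (by norm_num)).mul_right _))

/-- Since `dcos` is defined as a real part, one must see that the series is real: conjugation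
amounts to replacing `n` by `-n`. -/
lemma hasSum_dcos (x : UnitAddCircle) {s : ℝ} (hs : 0 < s) :
    HasSum (fun n : ℤ => (2 * Real.pi * Complex.I * n * Real.exp (-Real.pi * n ^ 2 * s) : ℂ) *
      fourier n x) (dcos x s : ℂ) := by
  have hsum : Summable (fun n : ℤ =>
      (2 * Real.pi * Complex.I * n * Real.exp (-Real.pi * n ^ 2 * s) : ℂ) * fourier n x) := by
    refine Summable.of_norm ((summable_dcos_bound hs).congr fun n => ?_)
    rw [norm_mul, norm_fourier_apply, mul_one, norm_dcos_coeff]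
  have h1 := hsum.hasSum
  have h2 := ((Equiv.neg ℤ).hasSum_iff.2 (h1.map (starRingEnd ℂ) Complex.continuous_conj))
  have h3 : (fun n : ℤ => (2 * Real.pi * Complex.I * n * Real.exp (-Real.pi * n ^ 2 * s) : ℂ) *
      fourier n x) = ((starRingEnd ℂ) ∘ fun n : ℤ =>
      (2 * Real.pi * Complex.I * n * Real.exp (-Real.pi * n ^ 2 * s) : ℂ) * fourier n x) ∘
      (Equiv.neg ℤ) := by
    ext n
    simp only [Function.comp_apply, Equiv.neg_apply, map_mul, Complex.conj_ofReal, map_ofNat,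
      Complex.conj_I, fourier_neg, Complex.conj_conj, map_intCast]
    push_cast; ring_nf
  rw [← h3] at h2
  have h4 := h2.unique h1
  have h5 := Complex.conj_eq_iff_re.1 h4
  rw [dcos, h5]; exact h1

lemma abs_dcos_le (x : UnitAddCircle) {s : ℝ} (hs : 0 < s) :
    |dcos x s| ≤ ∑' n : ℤ, 2 * Real.pi * |(n:ℝ)| * Real.exp (-Real.pi * n ^ 2 * s) := by
  rw [← Real.norm_eq_abs, ← Complex.norm_real, ← (hasSum_dcos x hs).tsum_eq]
  refine tsum_of_norm_bounded (summable_dcos_bound hs).hasSum fun n => ?_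
  rw [norm_mul, norm_fourier_apply, mul_one, norm_dcos_coeff]

lemma exists_abs_dcos_le : ∃ C : ℝ, 0 < C ∧ ∀ (x : UnitAddCircle) (s : ℝ), 0 < s →
    |dcos x s| ≤ C * s⁻¹ ^ 2 := by
  refine ⟨2 * Real.pi * ∑' n : ℤ, 1 / |(n:ℝ)| ^ 3 + 1, ?_, fun x s hs => ?_⟩
  · have : 0 ≤ ∑' n : ℤ, 1 / |(n:ℝ)| ^ 3 := tsum_nonneg fun n => by positivity
    have := Real.pi_pos
    positivity
  refine (abs_dcos_le x hs).trans ?_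
  have h1 : ∑' n : ℤ, 2 * Real.pi * |(n:ℝ)| * Real.exp (-Real.pi * n ^ 2 * s) ≤
      ∑' n : ℤ, 2 * Real.pi * ((1 / |(n:ℝ)| ^ 3) * s⁻¹ ^ 2) := by
    refine (summable_dcos_bound hs).tsum_le_tsum (fun n => ?_)
      (((summable_one_div_abs_pow (by norm_num)).mul_right _).mul_left _)
    rw [mul_assoc (2 * Real.pi)]
    exact mul_le_mul_of_nonneg_left (abs_int_mul_exp_le n hs) (by positivity)
  refine h1.trans ?_
  rw [tsum_mul_left, tsum_mul_right, add_mul, mul_assoc]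
  have : 0 ≤ s⁻¹ ^ 2 := by positivity
  linarith

lemma exp_int_sq_le {n : ℤ} (hn : n ≠ 0) {s : ℝ} (hs : 0 < s) :
    Real.exp (-Real.pi * n ^ 2 * s) ≤ (1 / |(n:ℝ)| ^ 4) * s⁻¹ ^ 2 := by
  have hn' : 0 < |(n:ℝ)| := by simpa using hn
  have h := abs_int_mul_exp_le n hs
  rw [← mul_le_mul_iff_right₀ hn']
  refine h.trans_eq ?_
  field_simp

lemma exists_abs_cosKernel_sub_one_le : ∃ C : ℝ, 0 < C ∧ ∀ (x : UnitAddCircle) (s : ℝ), 0 < s →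
    |cosKernel x s - 1| ≤ C * s⁻¹ ^ 2 := by
  refine ⟨∑' n : ℤ, 1 / |(n:ℝ)| ^ 4 + 1, ?_, fun x s hs => ?_⟩
  · have : 0 ≤ ∑' n : ℤ, 1 / |(n:ℝ)| ^ 4 := tsum_nonneg fun n => by positivity
    positivity
  have h0 := hasSum_ite_sub_hasSum (hasSum_cosKernel x hs) 0
  have h1 : |cosKernel x s - 1| ≤ ∑' n : ℤ, (1 / |(n:ℝ)| ^ 4) * s⁻¹ ^ 2 := by
    rw [← Real.norm_eq_abs, ← Complex.norm_real]
    have h2 : ((cosKernel x s - 1 : ℝ) : ℂ) =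
        (cosKernel x s : ℂ) - (Real.exp (-Real.pi * (0:ℤ) ^ 2 * s) : ℂ) * fourier 0 x := by simp
    rw [h2, ← h0.tsum_eq]
    refine tsum_of_norm_bounded
      ((summable_one_div_abs_pow (by norm_num)).mul_right _).hasSum fun n => ?_
    split_ifs with hn
    · rw [norm_zero]; positivity
    · rw [norm_mul, norm_fourier_apply, mul_one, Complex.norm_real, Real.norm_eq_abs,
        abs_of_pos (Real.exp_pos _)]
      exact exp_int_sq_le hn hs
  refine h1.trans ?_
  rw [tsum_mul_right, add_mul]
  have : 0 ≤ s⁻¹ ^ 2 := by positivity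
  linarith

/-! ### Positivity and small-time behaviour of the theta kernel. -/

lemma evenKernel_nonneg (x : UnitAddCircle) {s : ℝ} (hs : 0 < s) : 0 ≤ evenKernel x s := by
  induction x using QuotientAddGroup.induction_on with
  | H a => exact (hasSum_int_evenKernel a hs).nonneg fun n => (Real.exp_pos _).le

/-- The functional equation turns the oscillating Fourier series into a sum of Gaussians. Positivity
and smallness away from the origin are both read off from that form. -/
lemma cosKernel_eq_evenKernel (x : UnitAddCircle) {s : ℝ} (hs : 0 < s) :
    cosKernel x s = (s ^ (1 / 2 : ℝ))⁻¹ * evenKernel x (1 / s) := by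
  have h := evenKernel_functional_equation x (1 / s)
  rw [one_div_one_div, Real.div_rpow zero_le_one hs.le, Real.one_rpow, one_div_one_div] at h
  have : 0 < s ^ (1 / 2 : ℝ) := Real.rpow_pos_of_pos hs _
  rw [h]; field_simp

lemma cosKernel_nonneg (x : UnitAddCircle) {s : ℝ} (hs : 0 < s) : 0 ≤ cosKernel x s := by
  rw [cosKernel_eq_evenKernel x hs]
  exact mul_nonneg (by positivity) (evenKernel_nonneg x (by positivity))

/-- Off the origin, the heat kernel is small for small times. -/
lemma exists_cosKernel_le_sq {x : UnitAddCircle} (hx : x ≠ 0) :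
    ∃ s₀ C : ℝ, 0 < s₀ ∧ 0 < C ∧ ∀ s, 0 < s → s < s₀ → cosKernel x s ≤ C * s ^ 2 := by
  obtain ⟨p, hp, hO⟩ := isBigO_atTop_evenKernel_sub x
  obtain ⟨C, hC, hb⟩ := hO.exists_pos
  rw [Asymptotics.IsBigOWith] at hb
  obtain ⟨A, hA⟩ := eventually_atTop.1 hb
  refine ⟨min 1 (1 / max A 1), C * (3).factorial * p⁻¹ ^ 3, by positivity, by positivity,
    fun s hs hs0 => ?_⟩
  have hs1 : s < 1 := hs0.trans_le (min_le_left _ _)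
  have hsA : A ≤ 1 / s := by
    have h1 : s < 1 / max A 1 := hs0.trans_le (min_le_right _ _)
    rw [lt_one_div hs (by positivity)] at h1
    exact (le_max_left _ _).trans h1.le
  have h2 := hA (1 / s) hsA
  rw [if_neg hx, sub_zero, Real.norm_eq_abs, Real.norm_eq_abs,
    abs_of_nonneg (evenKernel_nonneg x (by positivity)), abs_of_pos (Real.exp_pos _)] at h2
  -- The cubic bound gives `s³`. One power is spent on the prefactor `s^(-1/2) ≤ s⁻¹`, which leaves
  -- `s²`.
  have h3 := exp_neg_le_inv_pow (y := p * (1 / s)) (by positivity) 3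
  rw [cosKernel_eq_evenKernel x hs]
  have h4 : (s ^ (1 / 2 : ℝ))⁻¹ ≤ s⁻¹ := by
    rw [inv_le_inv₀ (by positivity) hs]
    calc s = s ^ (1:ℝ) := (Real.rpow_one s).symm
      _ ≤ _ := Real.rpow_le_rpow_of_exponent_ge hs hs1.le (by norm_num)
  calc (s ^ (1 / 2 : ℝ))⁻¹ * evenKernel x (1 / s)
      ≤ s⁻¹ * (C * ((3).factorial * ((p * (1 / s)) ^ 3)⁻¹)) := by
        refine mul_le_mul h4 (h2.trans ?_) (evenKernel_nonneg x (by positivity)) (by positivity)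
        rw [neg_mul]; gcongr
    _ = _ := by field_simp

/-- The norms of the differentiated terms do not depend on the point, so one summable bound allows
termwise differentiation on the whole line. -/
lemma hasDerivAt_cosKernel (x : UnitAddCircle) {s : ℝ} (hs : 0 < s) (r : ℝ) :
    HasDerivAt (fun h : ℝ => cosKernel (x + (h : UnitAddCircle)) s)
      (dcos (x + (r : UnitAddCircle)) s) r := by
  have hterm : ∀ (n : ℤ) (h : ℝ), HasDerivAt (fun h : ℝ =>
      (Real.exp (-Real.pi * n ^ 2 * s) : ℂ) * fourier n (x + (h : UnitAddCircle)))
      ((2 * Real.pi * Complex.I * n * Real.exp (-Real.pi * n ^ 2 * s) : ℂ) *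
        fourier n (x + (h : UnitAddCircle))) h := by
    intro n h
    have h1 := (hasDerivAt_fourier (1:ℝ) n h).const_mul
      ((Real.exp (-Real.pi * n ^ 2 * s) : ℂ) * fourier n x)
    have h2 : ∀ u : ℝ, (fourier n (x + (u : UnitAddCircle)) : ℂ) =
        fourier n x * fourier n (u : UnitAddCircle) := fun u => by
      simp [fourier_apply, AddCircle.toCircle_add]
    simp only [h2]
    convert! h1 using 1
    · ext u; ring
    · push_cast; ring
  have key := hasDerivAt_tsum (summable_dcos_bound hs) hterm (fun n h => by
      rw [norm_mul, norm_fourier_apply, mul_one, norm_dcos_coeff]) (y₀ := 0)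
      (hasSum_cosKernel _ hs).summable r
  have e1 : (fun h : ℝ => ∑' n : ℤ, (Real.exp (-Real.pi * n ^ 2 * s) : ℂ) *
      fourier n (x + (h : UnitAddCircle))) =
      fun h : ℝ => ((cosKernel (x + (h : UnitAddCircle)) s : ℝ) : ℂ) := by
    ext h; exact (hasSum_cosKernel _ hs).tsum_eq
  rw [e1, (hasSum_dcos _ hs).tsum_eq] at key
  have h := Complex.reCLM.hasFDerivAt.comp_hasDerivAt r key
  simpa [Function.comp_def] using h

end Theta

/-! ## The heat kernel -/

section Heat

/-- The eigenvalue `4π²|k|²` of `-Δ`. -/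
noncomputable def lam (k : Fin 2 → ℤ) : ℝ := 4 * Real.pi ^ 2 * ((k 0 : ℝ) ^ 2 + (k 1 : ℝ) ^ 2)

lemma lam_nonneg (k : Fin 2 → ℤ) : 0 ≤ lam k := by unfold lam; positivity

lemma one_le_sq_add_sq {k : Fin 2 → ℤ} (hk : k ≠ 0) : (1:ℝ) ≤ (k 0 : ℝ) ^ 2 + (k 1 : ℝ) ^ 2 := by
  have h : 0 < k 0 ^ 2 + k 1 ^ 2 := by
    by_contra h
    apply hk
    have h0 : k 0 = 0 := by nlinarith [sq_nonneg (k 0), sq_nonneg (k 1)]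
    have h1 : k 1 = 0 := by nlinarith [sq_nonneg (k 0), sq_nonneg (k 1)]
    ext i; fin_cases i <;> simp [h0, h1]
  exact_mod_cast h

/-- This spectral gap lets every quantity of negative Sobolev type be dominated by its `L²`
counterpart. -/
lemma one_le_lam {k : Fin 2 → ℤ} (hk : k ≠ 0) : 1 ≤ lam k := by
  have h1 := one_le_sq_add_sq hk
  have h2 := Real.pi_gt_three
  unfold lam
  nlinarith [mul_le_mul h2.le h2.le (by norm_num) (by linarith)]

lemma lam_pos {k : Fin 2 → ℤ} (hk : k ≠ 0) : 0 < lam k := zero_lt_one.trans_le (one_le_lam hk)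

lemma lam_zero : lam 0 = 0 := by simp [lam]

/-- A product of two absolutely convergent Fourier series on the circle is one on the torus. -/
lemma hasSum_mul_fourier {a b : ℤ → ℂ} {A B : ℂ} {x : T2}
    (ha : HasSum (fun n => a n * fourier n (x 0)) A) (hb : HasSum (fun n => b n * fourier n (x 1)) B)
    (ha' : Summable fun n => ‖a n‖) (hb' : Summable fun n => ‖b n‖) :
    HasSum (fun k : Fin 2 → ℤ => a (k 0) * b (k 1) * ch k x) (A * B) := by
  obtain ⟨f, hf⟩ : ∃ f : ℤ → ℂ, f = fun n => a n * fourier n (x 0) := ⟨_, rfl⟩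
  obtain ⟨g, hg⟩ : ∃ g : ℤ → ℂ, g = fun n => b n * fourier n (x 1) := ⟨_, rfl⟩
  have h1 : Summable fun p : ℤ × ℤ => f p.1 * g p.2 := by
    refine summable_mul_of_summable_norm ?_ ?_
    · simpa only [hf, norm_mul, norm_fourier_apply, mul_one] using ha'
    · simpa only [hg, norm_mul, norm_fourier_apply, mul_one] using hb'
  rw [← hf] at ha
  rw [← hg] at hb
  refine ((finTwoArrowEquiv ℤ).hasSum_iff.2 (ha.mul hb h1)).congr_fun fun k => ?_
  rw [hf, hg, ch_eq_prod, Fin.prod_univ_two]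
  change _ = a (k 0) * fourier (k 0) (x 0) * (b (k 1) * fourier (k 1) (x 1))
  ring

lemma summable_mul_coeff {a b : ℤ → ℂ} (ha' : Summable fun n => ‖a n‖)
    (hb' : Summable fun n => ‖b n‖) :
    Summable (fun k : Fin 2 → ℤ => ‖a (k 0) * b (k 1)‖) := by
  have h1 : Summable fun p : ℤ × ℤ => ‖a p.1 * b p.2‖ := ha'.mul_norm hb'
  rw [← (finTwoArrowEquiv ℤ).summable_iff] at h1
  exact h1.congr fun k => by simp [finTwoArrowEquiv]

lemma summable_norm_exp {s : ℝ} (hs : 0 < s) :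
    Summable fun n : ℤ => ‖(Real.exp (-Real.pi * n ^ 2 * s) : ℂ)‖ := by
  have h := (hasSum_cosKernel 0 hs).summable.norm
  simpa only [norm_mul, norm_fourier_apply, mul_one] using h

lemma summable_norm_dcos {s : ℝ} (hs : 0 < s) :
    Summable fun n : ℤ => ‖(2 * Real.pi * Complex.I * n * Real.exp (-Real.pi * n ^ 2 * s) : ℂ)‖ := by
  simpa only [norm_dcos_coeff] using summable_dcos_bound hs

lemma exp_lam_eq (k : Fin 2 → ℤ) (t : ℝ) :
    (Real.exp (-Real.pi * (k 0) ^ 2 * (4 * Real.pi * t)) : ℂ) *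
      Real.exp (-Real.pi * (k 1) ^ 2 * (4 * Real.pi * t)) = Real.exp (-(lam k * t)) := by
  rw [← Complex.ofReal_mul, ← Real.exp_add]; congr 2; unfold lam; ring

variable {t : ℝ}

lemma hasSum_heatKernel (ht : 0 < t) (x : T2) :
    HasSum (fun k => (Real.exp (-(lam k * t)) : ℂ) * ch k x) (heatKernel t x : ℂ) := by
  have hs : 0 < 4 * Real.pi * t := by have := Real.pi_pos; positivity
  have h := hasSum_mul_fourier (hasSum_cosKernel (x 0) hs) (hasSum_cosKernel (x 1) hs)
    (summable_norm_exp hs) (summable_norm_exp hs)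
  simp only [exp_lam_eq] at h
  simpa [heatKernel, Fin.prod_univ_two] using h

lemma summable_exp_lam (ht : 0 < t) : Summable fun k => Real.exp (-(lam k * t)) := by
  have hs : 0 < 4 * Real.pi * t := by have := Real.pi_pos; positivity
  have h := summable_mul_coeff (summable_norm_exp hs) (summable_norm_exp hs)
  simp only [exp_lam_eq] at h
  simpa only [Complex.norm_real, Real.norm_eq_abs, abs_of_pos (Real.exp_pos _)] using h

lemma heatKernel_nonneg (ht : 0 < t) (x : T2) : 0 ≤ heatKernel t x := by
  have hs : 0 < 4 * Real.pi * t := by have := Real.pi_pos; positivity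
  exact Finset.prod_nonneg fun i _ => cosKernel_nonneg _ hs

/-- The partial derivatives of the heat kernel. -/
noncomputable def dheat (i : Fin 2) (t : ℝ) (x : T2) : ℝ :=
  dcos (x i) (4 * Real.pi * t) * cosKernel (x (1 - i)) (4 * Real.pi * t)

lemma hasDerivAt_heatKernel (ht : 0 < t) (i : Fin 2) (x : T2) (r : ℝ) :
    HasDerivAt (fun h => heatKernel t (x + shift i h)) (dheat i t (x + shift i r)) r := by
  have hs : 0 < 4 * Real.pi * t := by have := Real.pi_pos; positivity
  have h1 := hasDerivAt_cosKernel (x i) hs r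
  fin_cases i
  · simpa [heatKernel, dheat, Fin.prod_univ_two, shift, toT2] using
      h1.mul_const (cosKernel (x 1) (4 * Real.pi * t))
  · simpa [heatKernel, dheat, Fin.prod_univ_two, shift, toT2, mul_comm] using
      h1.const_mul (cosKernel (x 0) (4 * Real.pi * t))

lemma hasSum_dheat (ht : 0 < t) (i : Fin 2) (x : T2) :
    HasSum (fun k => (2 * Real.pi * Complex.I * k i * Real.exp (-(lam k * t)) : ℂ) * ch k x)
      (dheat i t x : ℂ) := by
  have hs : 0 < 4 * Real.pi * t := by have := Real.pi_pos; positivity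
  fin_cases i
  · have h := hasSum_mul_fourier (hasSum_dcos (x 0) hs) (hasSum_cosKernel (x 1) hs)
      (summable_norm_dcos hs) (summable_norm_exp hs)
    simp only [mul_assoc _ (Complex.ofReal _) (Complex.ofReal _), exp_lam_eq] at h
    simpa [dheat] using h
  · have h := hasSum_mul_fourier (hasSum_cosKernel (x 0) hs) (hasSum_dcos (x 1) hs)
      (summable_norm_exp hs) (summable_norm_dcos hs)
    simp only [mul_left_comm (Complex.ofReal _) _ (Complex.ofReal _), exp_lam_eq] at h
    simpa [dheat, mul_comm (dcos (x 1) _ : ℂ)] using h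

lemma summable_dheat (ht : 0 < t) (i : Fin 2) :
    Summable fun k : Fin 2 → ℤ =>
      ‖(2 * Real.pi * Complex.I * k i * Real.exp (-(lam k * t)) : ℂ)‖ := by
  have h := (hasSum_dheat ht i 0).summable.norm
  simpa [norm_ch] using h

/-- Replacing `k` by `-k` changes the sign of each coefficient and reflects the character. This
oddness is what makes the symmetrised nonlinearity twice its one-sided version. -/
lemma dheat_neg (ht : 0 < t) (i : Fin 2) (x : T2) : dheat i t (-x) = -dheat i t x := by
  have h1 := hasSum_dheat ht i (-x)
  have h2 := (Equiv.neg (Fin 2 → ℤ)).hasSum_iff.2 (hasSum_dheat ht i x)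
  have h3 : (fun k => (2 * Real.pi * Complex.I * k i * Real.exp (-(lam k * t)) : ℂ) * ch k x) ∘
      (Equiv.neg (Fin 2 → ℤ)) = fun k => -((2 * Real.pi * Complex.I * k i *
        Real.exp (-(lam k * t)) : ℂ) * ch k (-x)) := by
    ext k
    simp only [Function.comp_apply, Equiv.neg_apply, Pi.neg_apply, ch_index_neg, ch_neg]
    have : lam (-k) = lam k := by simp [lam]
    rw [this]; push_cast; ring
  rw [h3] at h2
  have := h1.neg.unique h2
  exact_mod_cast (neg_eq_iff_eq_neg.1 this)

/-- Joint measurability of an absolutely convergent series with measurable coefficients. -/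
lemma measurable_of_hasSum {X ι : Type*} [MeasurableSpace X] [Countable ι] {F : X → ℝ}
    {f : ι → X → ℂ} (hf : ∀ i, Measurable (f i)) (h : ∀ x, HasSum (fun i => f i x) (F x : ℂ)) :
    Measurable F := by
  have h1 : Measurable fun x => (F x : ℂ) := by
    refine measurable_of_tendsto_metrizable' (f := fun (s : Finset ι) x => ∑ i ∈ s, f i x)
      (atTop : Filter (Finset ι)) (fun s => Finset.measurable_fun_sum s fun i _ => hf i) ?_
    rw [tendsto_pi_nhds]; exact h
  exact Complex.measurable_re.comp h1

lemma heatKernel_of_nonpos (ht : t ≤ 0) (x : T2) : heatKernel t x = 0 := by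
  have : 4 * Real.pi * t ≤ 0 := mul_nonpos_of_nonneg_of_nonpos (by positivity) ht
  simp [heatKernel, cosKernel_undef _ this]

lemma dheat_of_nonpos (ht : t ≤ 0) (i : Fin 2) (x : T2) : dheat i t x = 0 := by
  have : 4 * Real.pi * t ≤ 0 := mul_nonpos_of_nonneg_of_nonpos (by positivity) ht
  simp [dheat, cosKernel_undef _ this]

lemma measurable_exp_mul_ch (k : Fin 2 → ℤ) :
    Measurable fun p : ℝ × T2 => (Real.exp (-(lam k * p.1)) : ℂ) * ch k p.2 := by
  refine Measurable.mul ?_ ((continuous_ch k).measurable.comp measurable_snd)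
  exact Complex.measurable_ofReal.comp (Real.measurable_exp.comp (measurable_fst.const_mul _).neg)

lemma measurable_heatKernel : Measurable fun p : ℝ × T2 => heatKernel p.1 p.2 := by
  -- The series represents the kernel only for positive times. For `t ≤ 0` the theta kernels take
  -- the default value zero, which the indicator reproduces.
  refine measurable_of_hasSum (f := fun k p => if 0 < p.1 then
    (Real.exp (-(lam k * p.1)) : ℂ) * ch k p.2 else 0)
    (fun k => Measurable.ite (measurableSet_lt measurable_const measurable_fst)
      (measurable_exp_mul_ch k) measurable_const) fun p => ?_
  by_cases hp : 0 < p.1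
  · simpa only [if_pos hp] using hasSum_heatKernel hp p.2
  · simp only [if_neg hp, heatKernel_of_nonpos (not_lt.1 hp), Complex.ofReal_zero, hasSum_zero]

lemma measurable_dheat (i : Fin 2) : Measurable fun p : ℝ × T2 => dheat i p.1 p.2 := by
  refine measurable_of_hasSum (f := fun k p => if 0 < p.1 then
    (2 * Real.pi * Complex.I * k i : ℂ) * ((Real.exp (-(lam k * p.1)) : ℂ) * ch k p.2) else 0)
    (fun k => Measurable.ite (measurableSet_lt measurable_const measurable_fst)
      ((measurable_exp_mul_ch k).const_mul _) measurable_const) fun p => ?_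
  by_cases hp : 0 < p.1
  · simpa only [if_pos hp, mul_assoc] using hasSum_dheat hp i p.2
  · simp only [if_neg hp, dheat_of_nonpos (not_lt.1 hp), Complex.ofReal_zero, hasSum_zero]

/-- With one-dimensional factors `u` and `v`, `uv - 1 = (u-1)(v-1) + (u-1) + (v-1)`. The decay makes
the time integral defining the Green function converge at infinity. -/
lemma exists_heatKernel_sub_one_le : ∃ C : ℝ, 0 < C ∧ ∀ (t : ℝ) (x : T2), 1 ≤ t →
    |heatKernel t x - 1| ≤ C * t⁻¹ ^ 2 := by
  obtain ⟨C, hC, h⟩ := exists_abs_cosKernel_sub_one_le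
  refine ⟨C * (C + 2), by positivity, fun t x ht => ?_⟩
  have hpi := Real.pi_gt_three
  have hs : 0 < 4 * Real.pi * t := by positivity
  have h0 := h (x 0) _ hs
  have h1 := h (x 1) _ hs
  have hst : (4 * Real.pi * t)⁻¹ ^ 2 ≤ t⁻¹ ^ 2 := by
    gcongr
    nlinarith
  have ht1 : t⁻¹ ^ 2 ≤ 1 := by
    rw [inv_pow]; exact inv_le_one_of_one_le₀ (one_le_pow₀ ht)
  set u := cosKernel (x 0) (4 * Real.pi * t)
  set v := cosKernel (x 1) (4 * Real.pi * t)
  have h0' : |u - 1| ≤ C * t⁻¹ ^ 2 := h0.trans (by gcongr)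
  have h1' : |v - 1| ≤ C * t⁻¹ ^ 2 := h1.trans (by gcongr)
  have h1'' : |v - 1| ≤ C := h1'.trans (by nlinarith)
  have heq : heatKernel t x - 1 = (u - 1) * (v - 1) + (u - 1) + (v - 1) := by
    simp only [heatKernel, Fin.prod_univ_two, u, v]; ring
  rw [heq]
  calc _ ≤ |(u - 1) * (v - 1)| + |u - 1| + |v - 1| := abs_add_three _ _ _
    _ ≤ (C * t⁻¹ ^ 2) * C + C * t⁻¹ ^ 2 + C * t⁻¹ ^ 2 := by
        rw [abs_mul]; gcongr
    _ = _ := by ring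

lemma integral_heatKernel_mul {g : T2 → ℂ} (hg : Continuous g) (ht : 0 < t) :
    HasSum (fun k => (Real.exp (-(lam k * t)) : ℂ) * ∫ x, ch k x * g x)
      (∫ x, (heatKernel t x : ℂ) * g x) := by
  obtain ⟨C, hC⟩ := isCompact_univ.exists_bound_of_continuousOn hg.continuousOn
  have h := hasSum_integral_of_summable_integral_norm (μ := (volume : Measure T2))
    (F := fun k x => (Real.exp (-(lam k * t)) : ℂ) * (ch k x * g x))
    (fun k => integrable_of_continuous _ (continuous_const.mul ((continuous_ch k).mul hg))) (by
      refine Summable.of_nonneg_of_le (fun k => integral_nonneg fun x => norm_nonneg _) (fun k => ?_)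
        ((summable_exp_lam ht).mul_right C)
      have : ∀ x, ‖(Real.exp (-(lam k * t)) : ℂ) * (ch k x * g x)‖ ≤ Real.exp (-(lam k * t)) * C := by
        intro x
        rw [norm_mul, norm_mul, norm_ch, one_mul, Complex.norm_real, Real.norm_eq_abs,
          abs_of_pos (Real.exp_pos _)]
        exact mul_le_mul_of_nonneg_left (hC x (mem_univ x)) (Real.exp_pos _).le
      calc _ ≤ ∫ _ : T2, Real.exp (-(lam k * t)) * C := integral_mono
            (integrable_of_continuous _
              (continuous_const.mul ((continuous_ch k).mul hg)).norm) (integrable_const _) this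
        _ = _ := by simp)
  have h2 : ∀ x, ∑' k, (Real.exp (-(lam k * t)) : ℂ) * (ch k x * g x) =
      (heatKernel t x : ℂ) * g x := fun x => by
    rw [← (hasSum_heatKernel ht x).tsum_eq, ← tsum_mul_right]
    exact tsum_congr fun k => by ring
  simp only [h2] at h
  refine h.congr_fun fun k => ?_
  rw [integral_const_mul]

end Heat

/-! ## The energy in Fourier variables -/

section Energy

/-- The Fourier coefficients of a probability measure on the torus. -/
noncomputable def fc (γ : PT2) (k : Fin 2 → ℤ) : ℂ := ∫ x, ch k x ∂(γ : Measure T2)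

/-- The squared modulus of the Fourier coefficients, with the zero mode removed. -/
noncomputable def fsq (γ : PT2) (k : Fin 2 → ℤ) : ℝ := if k = 0 then 0 else ‖fc γ k‖ ^ 2

lemma fsq_nonneg (γ : PT2) (k : Fin 2 → ℤ) : 0 ≤ fsq γ k := by unfold fsq; split_ifs <;> positivity

lemma fc_zero (γ : PT2) : fc γ 0 = 1 := by simp [fc, ch_index_zero]

lemma integrable_ch (μ : Measure T2) [IsFiniteMeasure μ] (k : Fin 2 → ℤ) : Integrable (ch k) μ :=
  integrable_of_continuous _ (continuous_ch k)

lemma integral_prod_ch_sub (γ : PT2) (k : Fin 2 → ℤ) :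
    ∫ p, ch k (p.1 - p.2) ∂((γ : Measure T2).prod (γ : Measure T2)) = (‖fc γ k‖ ^ 2 : ℝ) := by
  simp only [ch_sub]
  have h := integral_prod_mul (μ := (γ : Measure T2)) (ν := (γ : Measure T2)) (ch k)
    (fun y => conj (ch k y))
  rw [h, integral_conj, Complex.ofReal_pow, ← Complex.mul_conj']; rfl

lemma abs_heatKernel_le {t : ℝ} (ht : 0 < t) (x : T2) :
    |heatKernel t x| ≤ ∑' k, Real.exp (-(lam k * t)) := by
  rw [← Real.norm_eq_abs, ← Complex.norm_real, ← (hasSum_heatKernel ht x).tsum_eq]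
  refine tsum_of_norm_bounded (summable_exp_lam ht).hasSum fun k => ?_
  rw [norm_mul, norm_ch, mul_one, Complex.norm_real, Real.norm_eq_abs, abs_of_pos (Real.exp_pos _)]

/-- Under the product measure a character of `x - y` integrates to a squared modulus, so every mode
contributes nonnegatively. Subtracting one removes the zero mode. -/
lemma hasSum_integral_heatKernel_sub (γ : PT2) {t : ℝ} (ht : 0 < t) :
    HasSum (fun k => Real.exp (-(lam k * t)) * fsq γ k)
      (∫ p, (heatKernel t (p.1 - p.2) - 1) ∂((γ : Measure T2).prod (γ : Measure T2))) := by
  set μ := (γ : Measure T2).prod (γ : Measure T2) with hμ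
  have hm : Measurable fun p : T2 × T2 => heatKernel t (p.1 - p.2) :=
    measurable_heatKernel.comp (measurable_const.prodMk (measurable_fst.sub measurable_snd))
  have hi : Integrable (fun p : T2 × T2 => heatKernel t (p.1 - p.2)) μ :=
    Integrable.of_bound hm.aestronglyMeasurable _
      (Eventually.of_forall fun p => abs_heatKernel_le ht _)
  have hc : ∀ k, Continuous fun p : T2 × T2 => ch k (p.1 - p.2) := fun k =>
    (continuous_ch k).comp (continuous_fst.sub continuous_snd)
  have h := hasSum_integral_of_summable_integral_norm (μ := μ)
    (F := fun k p => (Real.exp (-(lam k * t)) : ℂ) * ch k (p.1 - p.2))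
    (fun k => integrable_of_continuous _ (continuous_const.mul (hc k))) (by
      simp only [norm_mul, norm_ch, mul_one, Complex.norm_real, Real.norm_eq_abs,
        abs_of_pos (Real.exp_pos _), integral_const, smul_eq_mul, probReal_univ, one_mul]
      exact summable_exp_lam ht)
  simp only [integral_const_mul, (hasSum_heatKernel ht _).tsum_eq] at h
  rw [integral_complex_ofReal] at h
  have h2 : HasSum (fun k => Real.exp (-(lam k * t)) * ‖fc γ k‖ ^ 2)
      (∫ p, heatKernel t (p.1 - p.2) ∂μ) := by
    rw [← Complex.hasSum_ofReal]
    refine h.congr_fun fun k => ?_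
    rw [hμ, integral_prod_ch_sub]; push_cast; ring
  have h3 := hasSum_ite_sub_hasSum h2 0
  rw [integral_sub hi (integrable_const _)]
  simp only [fc_zero, lam_zero, zero_mul, neg_zero, Real.exp_zero, norm_one, one_pow, mul_one] at h3
  simp only [integral_const, smul_eq_mul, probReal_univ, one_mul]
  refine h3.congr_fun fun k => ?_
  unfold fsq; split_ifs <;> simp

/-- The Fourier identity is rearranged without subtraction, so that it can be integrated over all
times in `[0, ∞]` even when the energy is infinite. -/
lemma lintegral_heatKernel_pos_part (γ : PT2) {t : ℝ} (ht : 0 < t) :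
    ∫⁻ p, ENNReal.ofReal (heatKernel t (p.1 - p.2) - 1) ∂((γ : Measure T2).prod (γ : Measure T2)) =
      ∫⁻ p, ENNReal.ofReal (1 - heatKernel t (p.1 - p.2))
        ∂((γ : Measure T2).prod (γ : Measure T2)) +
      ∑' k, ENNReal.ofReal (Real.exp (-(lam k * t)) * fsq γ k) := by
  have hS := hasSum_integral_heatKernel_sub γ ht
  set μ := (γ : Measure T2).prod (γ : Measure T2) with hμ
  have hm : Measurable fun p : T2 × T2 => heatKernel t (p.1 - p.2) :=
    measurable_heatKernel.comp (measurable_const.prodMk (measurable_fst.sub measurable_snd))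
  have hi : Integrable (fun p : T2 × T2 => heatKernel t (p.1 - p.2) - 1) μ :=
    (Integrable.of_bound hm.aestronglyMeasurable _
      (Eventually.of_forall fun p => abs_heatKernel_le ht _)).sub (integrable_const _)
  have hn : ∀ k, 0 ≤ Real.exp (-(lam k * t)) * fsq γ k := fun k =>
    mul_nonneg (Real.exp_pos _).le (fsq_nonneg _ _)
  rw [← ENNReal.ofReal_tsum_of_nonneg hn hS.summable, hS.tsum_eq]
  have h1 := integral_eq_lintegral_pos_part_sub_lintegral_neg_part hi
  simp only [neg_sub] at h1
  have hf1 : ∫⁻ p, ENNReal.ofReal (heatKernel t (p.1 - p.2) - 1) ∂μ ≠ ⊤ :=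
    hi.lintegral_lt_top.ne
  have hf2 : ∫⁻ p, ENNReal.ofReal (1 - heatKernel t (p.1 - p.2)) ∂μ ≠ ⊤ := by
    have := hi.neg.lintegral_lt_top.ne
    simpa only [Pi.neg_apply, neg_sub] using this
  have h0 : 0 ≤ ∫ p, (heatKernel t (p.1 - p.2) - 1) ∂μ := hS.nonneg hn
  rw [← ENNReal.toReal_eq_toReal_iff' hf1 (ENNReal.add_ne_top.2 ⟨hf2, ENNReal.ofReal_ne_top⟩),
    ENNReal.toReal_add hf2 ENNReal.ofReal_ne_top, ENNReal.toReal_ofReal h0]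
  linarith

lemma lintegral_exp_neg_Ioi {l : ℝ} (hl : 0 < l) :
    ∫⁻ t in Ioi (0:ℝ), ENNReal.ofReal (Real.exp (-(l * t))) = ENNReal.ofReal (1 / l) := by
  have h1 := integral_exp_mul_Ioi (a := -l) (by linarith) 0
  have h2 := integrableOn_exp_mul_Ioi (a := -l) (by linarith) 0
  simp only [neg_mul] at h1 h2
  rw [← ofReal_integral_eq_lintegral_ofReal h2 (Eventually.of_forall fun t => (Real.exp_pos _).le),
    h1]
  congr 1; simp

/-- The positive part in the definition of the Green function. -/
noncomputable def greenPos (x : T2) : ℝ≥0∞ := ∫⁻ t in Ioi (0 : ℝ), ENNReal.ofReal (heatKernel t x - 1)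

/-- The negative part in the definition of the Green function. -/
noncomputable def greenNeg (x : T2) : ℝ≥0∞ := ∫⁻ t in Ioi (0 : ℝ), ENNReal.ofReal (1 - heatKernel t x)

lemma green_eq (x : T2) : green x = (greenPos x : EReal) - (greenNeg x : EReal) := rfl

lemma measurable_greenPos : Measurable greenPos := by
  have h : Measurable fun p : T2 × ℝ => ENNReal.ofReal (heatKernel p.2 p.1 - 1) :=
    ((measurable_heatKernel.comp measurable_swap).sub_const 1).ennreal_ofReal
  exact h.lintegral_prod_right'

lemma measurable_greenNeg : Measurable greenNeg := by
  have h : Measurable fun p : T2 × ℝ => ENNReal.ofReal (1 - heatKernel p.2 p.1) :=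
    ((measurable_heatKernel.comp measurable_swap).const_sub 1).ennreal_ofReal
  exact h.lintegral_prod_right'

lemma integrableOn_inv_sq_Ioi {a : ℝ} (ha : 0 < a) : IntegrableOn (fun t : ℝ => t⁻¹ ^ 2) (Ioi a) := by
  have h := integrableOn_Ioi_rpow_of_lt (a := -2) (by norm_num) ha
  refine h.congr_fun (fun t ht => ?_) measurableSet_Ioi
  have : 0 < t := ha.trans ht
  change t ^ (-2 : ℝ) = t⁻¹ ^ 2
  rw [Real.rpow_neg this.le, inv_pow]; norm_cast

/-- Positivity of the heat kernel bounds the integrand by one for `t ≤ 1`; the decay towards one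
handles later times. -/
lemma exists_greenNeg_le : ∃ C : ℝ≥0∞, C ≠ ⊤ ∧ ∀ x, greenNeg x ≤ C := by
  obtain ⟨C, hC, h⟩ := exists_heatKernel_sub_one_le
  refine ⟨(∫⁻ _ in Ioc (0:ℝ) 1, 1) + ∫⁻ t in Ioi (1:ℝ), ENNReal.ofReal (C * t⁻¹ ^ 2), ?_, fun x => ?_⟩
  · refine ENNReal.add_ne_top.2 ⟨by simp, ?_⟩
    exact ((integrableOn_inv_sq_Ioi one_pos).const_mul C).lintegral_lt_top.ne
  · rw [greenNeg, ← Ioc_union_Ioi_eq_Ioi zero_le_one, lintegral_union measurableSet_Ioi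
      (Ioc_disjoint_Ioi le_rfl)]
    refine add_le_add (setLIntegral_mono measurable_const fun t ht => ?_)
      (setLIntegral_mono' measurableSet_Ioi fun t ht => ?_)
    · rw [← ENNReal.ofReal_one]
      exact ENNReal.ofReal_le_ofReal (by linarith [heatKernel_nonneg ht.1 x])
    · exact ENNReal.ofReal_le_ofReal ((neg_sub _ _).symm.le.trans
        ((neg_le_abs _).trans (h t x (le_of_lt ht))))

/-- The identity `a⁺ + b = a⁻ + c` is kept in additive form because the positive part of the Green
function may be infinite; only its negative part is known to be finite. -/
lemma green_parts {a b : ℝ≥0∞} (hb : b ≠ ⊤) :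
    ((a : EReal) - (b : EReal)).toENNReal + b = (-((a : EReal) - (b : EReal))).toENNReal + a := by
  lift b to NNReal using hb
  rcases eq_or_ne a ⊤ with rfl | ha
  · have : ((⊤ : ℝ≥0∞) : EReal) - ((b : ℝ≥0∞) : EReal) = ⊤ := by
      change (⊤ : EReal) - ((b : ℝ) : EReal) = ⊤
      exact EReal.top_sub_coe _
    rw [this]; simp
  · lift a to NNReal using ha
    have h1 : ((a : ℝ≥0∞) : EReal) - ((b : ℝ≥0∞) : EReal) = (((a : ℝ) - b : ℝ) : EReal) := rfl
    rw [h1, ← EReal.coe_neg, EReal.toENNReal_of_ne_top (EReal.coe_ne_top _),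
      EReal.toENNReal_of_ne_top (EReal.coe_ne_top _), EReal.toReal_coe, EReal.toReal_coe, neg_sub,
      ← ENNReal.ofReal_coe_nnreal, ← ENNReal.ofReal_coe_nnreal]
    rcases le_total (a:ℝ) b with h | h
    · rw [ENNReal.ofReal_of_nonpos (sub_nonpos.2 h), zero_add,
        ← ENNReal.ofReal_add (sub_nonneg.2 h) (NNReal.coe_nonneg a)]; simp
    · rw [ENNReal.ofReal_of_nonpos (sub_nonpos.2 h), zero_add,
        ← ENNReal.ofReal_add (sub_nonneg.2 h) (NNReal.coe_nonneg b)]; simp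

/-- The squared homogeneous Sobolev norm of order `-1` of a measure. -/
noncomputable def sobolevSq (γ : PT2) : ℝ≥0∞ := ∑' k, ENNReal.ofReal (fsq γ k / lam k)

/-- Tonelli's theorem integrates the fixed-time identity over `t`, and `∫ exp(-λt) dt = 1/λ`
produces the Sobolev weight. The zero mode drops out of `fsq`. -/
lemma lintegral_greenPos (γ : PT2) :
    ∫⁻ p, greenPos (p.1 - p.2) ∂((γ : Measure T2).prod (γ : Measure T2)) =
      ∫⁻ p, greenNeg (p.1 - p.2) ∂((γ : Measure T2).prod (γ : Measure T2)) + sobolevSq γ := by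
  set μ := (γ : Measure T2).prod (γ : Measure T2) with hμ
  have hm : Measurable fun q : (T2 × T2) × ℝ => heatKernel q.2 (q.1.1 - q.1.2) :=
    measurable_heatKernel.comp (measurable_snd.prodMk
      ((measurable_fst.comp measurable_fst).sub (measurable_snd.comp measurable_fst)))
  have h1 : ∫⁻ p, greenPos (p.1 - p.2) ∂μ =
      ∫⁻ t in Ioi (0:ℝ), ∫⁻ p, ENNReal.ofReal (heatKernel t (p.1 - p.2) - 1) ∂μ :=
    lintegral_lintegral_swap (hm.sub_const 1).ennreal_ofReal.aemeasurable
  have h2 : ∫⁻ p, greenNeg (p.1 - p.2) ∂μ =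
      ∫⁻ t in Ioi (0:ℝ), ∫⁻ p, ENNReal.ofReal (1 - heatKernel t (p.1 - p.2)) ∂μ :=
    lintegral_lintegral_swap (hm.const_sub 1).ennreal_ofReal.aemeasurable
  have h3 : sobolevSq γ = ∫⁻ t in Ioi (0:ℝ), ∑' k, ENNReal.ofReal (Real.exp (-(lam k * t)) * fsq γ k) := by
    rw [lintegral_tsum fun k => by fun_prop]
    refine tsum_congr fun k => ?_
    simp only [ENNReal.ofReal_mul (Real.exp_pos _).le]
    rw [lintegral_mul_const' _ _ ENNReal.ofReal_ne_top]
    rcases eq_or_ne k 0 with rfl | hk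
    · simp [fsq]
    · rw [lintegral_exp_neg_Ioi (lam_pos hk), ← ENNReal.ofReal_mul (by have := lam_pos hk; positivity)]
      congr 1; ring
  rw [h1, h2, h3, ← lintegral_add_left']
  · refine setLIntegral_congr_fun measurableSet_Ioi fun t ht => ?_
    exact lintegral_heatKernel_pos_part γ ht
  · exact (Measurable.lintegral_prod_left' (f := fun q : (T2 × T2) × ℝ =>
      ENNReal.ofReal (1 - heatKernel q.2 (q.1.1 - q.1.2))) (μ := μ)
      (hm.const_sub 1).ennreal_ofReal).aemeasurable

/-- The energy is half the squared Sobolev norm of order `-1`. -/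
lemma energy_eq (γ : PT2) : energy γ = ((1 / 2 : ℝ) : EReal) * (sobolevSq γ : EReal) := by
  obtain ⟨C, hC, hle⟩ := exists_greenNeg_le
  have hm : Measurable fun p : T2 × T2 => p.1 - p.2 := measurable_fst.sub measurable_snd
  have hmN : Measurable fun p : T2 × T2 => greenNeg (p.1 - p.2) := measurable_greenNeg.comp hm
  have hmP : Measurable fun p : T2 × T2 => greenPos (p.1 - p.2) := measurable_greenPos.comp hm
  have hP := lintegral_greenPos γ
  set μ := (γ : Measure T2).prod (γ : Measure T2) with hμ
  have hpt : ∀ x, (green x).toENNReal + greenNeg x = (-green x).toENNReal + greenPos x := fun x =>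
    green_parts ((hle x).trans_lt hC.lt_top).ne
  have hle2 : ∀ x, (-green x).toENNReal ≤ greenNeg x := by
    intro x
    have h1 : -green x ≤ (greenNeg x : EReal) := by
      rw [green_eq, EReal.neg_sub (Or.inl (EReal.coe_ennreal_ne_bot _))
        (Or.inr (by simpa using ((hle x).trans_lt hC.lt_top).ne)), add_comm, ← sub_eq_add_neg]
      exact EReal.sub_le_of_le_add (by
        rw [add_comm]; exact le_add_of_nonneg_left (EReal.coe_ennreal_nonneg _))
    simpa using EReal.toENNReal_le_toENNReal h1
  have hadd : ∫⁻ p, (green (p.1 - p.2)).toENNReal ∂μ + ∫⁻ p, greenNeg (p.1 - p.2) ∂μ =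
      ∫⁻ p, (-green (p.1 - p.2)).toENNReal ∂μ + ∫⁻ p, greenPos (p.1 - p.2) ∂μ := by
    rw [← lintegral_add_right _ hmN, ← lintegral_add_right _ hmP]
    exact lintegral_congr fun p => hpt _
  -- This finiteness is what permits cancelling the negative part below, even if the energy is
  -- infinite.
  have hN : ∫⁻ p, greenNeg (p.1 - p.2) ∂μ ≠ ⊤ := by
    have h1 : ∫⁻ p, greenNeg (p.1 - p.2) ∂μ ≤ ∫⁻ _, C ∂μ := lintegral_mono fun p => hle _
    rw [lintegral_const, measure_univ, mul_one] at h1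
    exact (h1.trans_lt hC.lt_top).ne
  have hY : ∫⁻ p, (-green (p.1 - p.2)).toENNReal ∂μ ≠ ⊤ := by
    have h1 : ∫⁻ p, (-green (p.1 - p.2)).toENNReal ∂μ ≤ ∫⁻ p, greenNeg (p.1 - p.2) ∂μ :=
      lintegral_mono fun p => hle2 _
    exact (h1.trans_lt hN.lt_top).ne
  have hX : ∫⁻ p, (green (p.1 - p.2)).toENNReal ∂μ =
      ∫⁻ p, (-green (p.1 - p.2)).toENNReal ∂μ + sobolevSq γ := by
    rw [hP] at hadd
    refine (ENNReal.add_left_inj hN).1 (hadd.trans ?_)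
    ring
  unfold energy
  rw [← hμ, hX]
  congr 1
  lift ∫⁻ p, (-green (p.1 - p.2)).toENNReal ∂μ to NNReal using hY with y
  rcases eq_or_ne (sobolevSq γ) ⊤ with h | h
  · rw [h, add_top]
    change (⊤ : EReal) - ((y : ℝ) : EReal) = ⊤
    exact EReal.top_sub_coe _
  · lift sobolevSq γ to NNReal using h with z
    change (((y + z : NNReal) : ℝ) : EReal) - ((y : ℝ) : EReal) = ((z : ℝ) : EReal)
    rw [← EReal.coe_sub]; congr 1; push_cast; ring

end Energy

/-! ## Positive trigonometric mollifiers -/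

section Mollification

instance isNegInvariant_T2 : (volume : Measure T2).IsNegInvariant :=
  Measure.IsAddHaarMeasure.isNegInvariant_of_innerRegular _

/-- A strictly positive even trigonometric polynomial of integral one. -/
structure Mollifier where
  /-- The frequencies. -/
  B : Finset (Fin 2 → ℤ)
  /-- The coefficients. -/
  j : (Fin 2 → ℤ) → ℝ
  j_nonneg : ∀ k, 0 ≤ j k
  j_le_one : ∀ k, j k ≤ 1
  pos : ∀ z, 0 < ∑ m ∈ B, j m * cs m z
  integral_one : ∫ z, ∑ m ∈ B, j m * cs m z = 1

namespace Mollifier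

variable (J : Mollifier)

/-- The kernel of a mollifier. -/
noncomputable def ker (z : T2) : ℝ := ∑ m ∈ J.B, J.j m * cs m z

/-- The Fourier multiplier of a mollifier. -/
noncomputable def mult (k : Fin 2 → ℤ) : ℝ := ∫ z, J.ker z * cs k z

/-- Mollification of a measure. -/
noncomputable def mol (γ : PT2) (x : T2) : ℝ := ∫ y, J.ker (x - y) ∂(γ : Measure T2)

/-- Mollification of a function. -/
noncomputable def conv (g : T2 → ℝ) (x : T2) : ℝ := ∫ y, J.ker (x - y) * g y

lemma ker_pos (z : T2) : 0 < J.ker z := J.pos z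

lemma continuous_ker : Continuous J.ker :=
  continuous_finsetSum _ fun m _ => continuous_const.mul (continuous_cs m)

lemma integral_ker : ∫ z, J.ker z = 1 := J.integral_one

lemma ker_neg (z : T2) : J.ker (-z) = J.ker z := by simp [ker, cs_neg]

lemma ker_sub_comm (x y : T2) : J.ker (x - y) = J.ker (y - x) := by rw [← ker_neg, neg_sub]

lemma continuous_ker_sub : Continuous fun p : T2 × T2 => J.ker (p.1 - p.2) :=
  J.continuous_ker.comp (continuous_fst.sub continuous_snd)

lemma ker_sub (x y : T2) : J.ker (x - y) =
    ∑ m ∈ J.B, J.j m * (cs m x * cs m y + sn m x * sn m y) := by simp [ker, cs_sub]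

lemma integral_ker_sub_left (y : T2) : ∫ x, J.ker (x - y) = 1 := by
  rw [integral_sub_right_eq_self J.ker y, integral_ker]

lemma integral_ker_sub_right (x : T2) : ∫ y, J.ker (x - y) = 1 := by
  simp only [J.ker_sub_comm x, integral_ker_sub_left]

lemma abs_mult_le (k : Fin 2 → ℤ) : |J.mult k| ≤ 1 := by
  refine (norm_integral_le_integral_norm (fun z => J.ker z * cs k z)).trans
    (le_trans ?_ J.integral_ker.le)
  refine integral_mono (integrable_of_continuous _ (J.continuous_ker.mul (continuous_cs k)).norm)
    (integrable_of_continuous _ J.continuous_ker) fun z => ?_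
  dsimp only
  rw [norm_mul, Real.norm_eq_abs, Real.norm_eq_abs, abs_of_pos (J.ker_pos z)]
  exact mul_le_of_le_one_right (J.ker_pos z).le (abs_cs_le k z)

/-- The kernel is even and the sine odd. Hence the Fourier multiplier of the mollifier is real. -/
lemma integral_ker_mul_sn (k : Fin 2 → ℤ) : ∫ z, J.ker z * sn k z = 0 := by
  have h := integral_neg_eq_self (fun z => J.ker z * sn k z) (volume : Measure T2)
  simp only [ker_neg, sn_neg, mul_neg, integral_neg] at h
  linarith

lemma integral_ker_mul_ch (k : Fin 2 → ℤ) : ∫ z, (J.ker z : ℂ) * ch k z = J.mult k := by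
  have hi : Integrable (fun z => (J.ker z : ℂ) * ch k z) (volume : Measure T2) :=
    integrable_of_continuous _
      ((Complex.continuous_ofReal.comp J.continuous_ker).mul (continuous_ch k))
  rw [← integral_re_add_im hi]
  have h1 : ∀ z, RCLike.re ((J.ker z : ℂ) * ch k z) = J.ker z * cs k z := fun z => by simp [cs]
  have h2 : ∀ z, RCLike.im ((J.ker z : ℂ) * ch k z) = J.ker z * sn k z := fun z => by simp [sn]
  simp only [h1, h2, integral_ker_mul_sn, mult]; simp

lemma integral_ker_sub_mul_ch (k : Fin 2 → ℤ) (y : T2) :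
    ∫ x, (J.ker (x - y) : ℂ) * ch k x = J.mult k * ch k y := by
  have h := integral_add_right_eq_self (fun x => (J.ker (x - y) : ℂ) * ch k x) y
    (μ := (volume : Measure T2))
  simp only [add_sub_cancel_right, ch_add, ← mul_assoc] at h
  rw [← h, integral_mul_const, integral_ker_mul_ch]

variable {J} (γ : PT2)

/-- A mollified measure depends on `γ` through finitely many Fourier coefficients. Smoothness in
space, and continuity in time along a curve, both follow from this form. -/
lemma mol_eq (x : T2) : J.mol γ x =
    ∑ m ∈ J.B, J.j m * ((fc γ m).re * cs m x + (fc γ m).im * sn m x) := by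
  have h1 : ∀ m, (fc γ m).re = ∫ y, cs m y ∂(γ : Measure T2) := fun m => by
    have := integral_re (integrable_ch (γ : Measure T2) m); exact this.symm
  have h2 : ∀ m, (fc γ m).im = ∫ y, sn m y ∂(γ : Measure T2) := fun m => by
    have := integral_im (integrable_ch (γ : Measure T2) m); exact this.symm
  have hi1 : ∀ m, Integrable (cs m) (γ : Measure T2) := fun m =>
    integrable_of_continuous _ (continuous_cs m)
  have hi2 : ∀ m, Integrable (sn m) (γ : Measure T2) := fun m =>
    integrable_of_continuous _ (continuous_sn m)
  simp only [mol, ker_sub]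
  rw [integral_finsetSum _ fun m _ =>
    (((hi1 m).const_mul (cs m x)).fun_add ((hi2 m).const_mul (sn m x))).const_mul _]
  refine Finset.sum_congr rfl fun m _ => ?_
  rw [integral_const_mul, integral_add ((hi1 m).const_mul _) ((hi2 m).const_mul _),
    integral_const_mul, integral_const_mul, h1, h2]
  ring

lemma isSmooth_mol : IsSmooth (J.mol γ) := by
  have : J.mol γ = fun x =>
      ∑ m ∈ J.B, J.j m * ((fc γ m).re * cs m x + (fc γ m).im * sn m x) := funext (mol_eq γ)
  rw [this]
  exact IsSmooth.sum _ fun m _ => (((isSmooth_cs m).const_mul _).add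
    ((isSmooth_sn m).const_mul _)).const_mul _

lemma mol_pos (x : T2) : 0 < J.mol γ x := by
  have hc : Continuous fun y => J.ker (x - y) := J.continuous_ker.comp (continuous_const.sub continuous_id)
  rw [mol, integral_pos_iff_support_of_nonneg (fun y => (J.ker_pos _).le)
    (integrable_of_continuous _ hc)]
  have : Function.support (fun y => J.ker (x - y)) = univ := by
    ext y; simp [(J.ker_pos (x - y)).ne']
  rw [this]; simp

/-- Fubini together with evenness of the kernel: mollification is self-adjoint and can be moved from
the measure to the test function. -/
lemma integral_mol_mul {g : T2 → ℝ} (hg : Continuous g) :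
    ∫ x, J.mol γ x * g x = ∫ y, J.conv g y ∂(γ : Measure T2) := by
  simp only [mol, conv, ← integral_mul_const]
  rw [integral_integral_swap]
  · refine integral_congr_ae (Eventually.of_forall fun y => ?_)
    simp only [J.ker_sub_comm _ y]
  · exact integrable_of_continuous _ (J.continuous_ker_sub.mul (hg.comp continuous_fst))

lemma integral_mol : ∫ x, J.mol γ x = 1 := by
  have h := integral_mol_mul (J := J) γ (g := fun _ => 1) continuous_const
  simpa [conv, integral_ker_sub_right] using h

lemma integral_mol_mul_ch (k : Fin 2 → ℤ) :
    ∫ x, (J.mol γ x : ℂ) * ch k x = J.mult k * fc γ k := by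
  simp only [mol, ← integral_complex_ofReal, ← integral_mul_const]
  rw [integral_integral_swap]
  · simp only [integral_ker_sub_mul_ch, integral_const_mul]; rfl
  · exact integrable_of_continuous _ ((Complex.continuous_ofReal.comp J.continuous_ker_sub).mul
      ((continuous_ch k).comp continuous_fst))

end Mollifier

/-- The squared `L²` distance to the uniform measure, in terms of Fourier coefficients. -/
noncomputable def wsq (γ : PT2) : ℝ≥0∞ := ∑' k, ENNReal.ofReal (fsq γ k)

lemma sum_fsq_le {γ : PT2} (hw : wsq γ ≠ ⊤) (B : Finset (Fin 2 → ℤ)) :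
    ∑ k ∈ B, fsq γ k ≤ (wsq γ).toReal := by
  rw [← ENNReal.ofReal_le_iff_le_toReal hw,
    ENNReal.ofReal_sum_of_nonneg fun k _ => fsq_nonneg γ k]
  exact ENNReal.sum_le_tsum B

lemma sum_norm_fc_sq_le {γ : PT2} (hw : wsq γ ≠ ⊤) (B : Finset (Fin 2 → ℤ)) :
    ∑ k ∈ B, ‖fc γ k‖ ^ 2 ≤ 1 + (wsq γ).toReal := by
  have h1 : ∑ k ∈ B, ‖fc γ k‖ ^ 2 ≤ ∑ k ∈ insert 0 B, ‖fc γ k‖ ^ 2 :=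
    Finset.sum_le_sum_of_subset_of_nonneg (Finset.subset_insert _ _) fun _ _ _ => by positivity
  have h2 : ∑ k ∈ insert 0 B, ‖fc γ k‖ ^ 2 = ∑ k ∈ insert 0 B, fsq γ k + 1 := by
    have : ∀ k, ‖fc γ k‖ ^ 2 = fsq γ k + if k = 0 then 1 else 0 := by
      intro k; unfold fsq; split_ifs with h
      · subst h; simp [fc_zero]
      · simp
    simp only [this, Finset.sum_add_distrib, Finset.sum_ite_eq', Finset.mem_insert_self, if_true]
  have := sum_fsq_le hw (insert 0 B)
  linarith

lemma re_trig (B : Finset (Fin 2 → ℤ)) (β : (Fin 2 → ℤ) → ℂ) (x : T2) :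
    (trig B β x).re = ∑ k ∈ B, ((β k).re * cs k x - (β k).im * sn k x) := by
  simp [trig, cs, sn]

lemma integral_re_trig_sq_le (B : Finset (Fin 2 → ℤ)) (β : (Fin 2 → ℤ) → ℂ) :
    ∫ x, (trig B β x).re ^ 2 ≤ ∑ k ∈ B, ‖β k‖ ^ 2 := by
  rw [← integral_norm_trig_sq]
  have hUc := continuous_trig B β
  refine integral_mono (integrable_of_continuous _ ((Complex.continuous_re.comp hUc).pow 2))
    (integrable_of_continuous _ (hUc.norm.pow 2)) fun x => ?_
  dsimp only
  rw [← sq_abs]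
  exact pow_le_pow_left₀ (abs_nonneg _) (Complex.abs_re_le_norm (trig B β x)) 2

/-- By Parseval, coefficients bounded by one cannot increase the square sum. The summand `1` is the
zero mode. -/
lemma Mollifier.integral_mol_sq_le (J : Mollifier) {γ : PT2} (hw : wsq γ ≠ ⊤) :
    ∫ x, J.mol γ x ^ 2 ≤ 1 + (wsq γ).toReal := by
  have h : ∀ x, J.mol γ x = (trig J.B (fun k => J.j k * conj (fc γ k)) x).re := by
    intro x; rw [mol_eq, re_trig]
    refine Finset.sum_congr rfl fun k _ => ?_
    simp; ring
  simp only [h]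
  refine (integral_re_trig_sq_le _ _).trans (le_trans ?_ (sum_norm_fc_sq_le hw J.B))
  refine Finset.sum_le_sum fun k _ => ?_
  rw [norm_mul, RCLike.norm_conj, Complex.norm_real, Real.norm_eq_abs, abs_of_nonneg (J.j_nonneg k)]
  exact pow_le_pow_left₀ (mul_nonneg (J.j_nonneg k) (norm_nonneg _))
    (mul_le_of_le_one_left (norm_nonneg (fc γ k)) (J.j_le_one k)) 2

/-- Real continuous functions are uniform limits of trigonometric polynomials. -/
lemma exists_trig_approx {φ : T2 → ℝ} (hφ : Continuous φ) {ε : ℝ} (hε : 0 < ε) :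
    ∃ (B : Finset (Fin 2 → ℤ)) (β : (Fin 2 → ℤ) → ℂ), ∀ x, ‖(φ x : ℂ) - trig B β x‖ ≤ ε := by
  let f : C(T2, ℂ) := ⟨fun x => (φ x : ℂ), Complex.continuous_ofReal.comp hφ⟩
  have hf : f ∈ (Submodule.span ℂ (range (UnitAddTorus.mFourier (d := Fin 2)))).topologicalClosure := by
    rw [UnitAddTorus.span_mFourier_closure_eq_top]; trivial
  have hf' : f ∈ closure (Submodule.span ℂ (range (UnitAddTorus.mFourier (d := Fin 2))) : Set C(T2, ℂ)) := hf
  obtain ⟨q, hq, hd⟩ := Metric.mem_closure_iff.1 hf' ε hε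
  obtain ⟨c, hc⟩ := (Finsupp.mem_span_range_iff_exists_finsupp).1 hq
  refine ⟨c.support, c, fun x => ?_⟩
  have h1 : trig c.support c x = q x := by
    rw [← hc, Finsupp.sum, ContinuousMap.sum_apply]; rfl
  rw [h1, ← dist_eq_norm]
  exact (ContinuousMap.dist_apply_le_dist (f := f) (g := q) x).trans hd.le

/-- Convergence of Fourier coefficients of probability densities implies weak convergence. -/
lemma tendsto_integral_of_fourier {P : ℕ → T2 → ℝ} (hc : ∀ n, Continuous (P n))
    (h0 : ∀ n x, 0 ≤ P n x) (h1 : ∀ n, ∫ x, P n x = 1) (γ : PT2)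
    (h : ∀ k, Tendsto (fun n => ∫ x, (P n x : ℂ) * ch k x) atTop (𝓝 (fc γ k)))
    {φ : T2 → ℝ} (hφ : Continuous φ) :
    Tendsto (fun n => ∫ x, P n x * φ x) atTop (𝓝 (∫ x, φ x ∂(γ : Measure T2))) := by
  rw [Metric.tendsto_atTop]
  intro ε hε
  obtain ⟨B, β, hB⟩ := exists_trig_approx hφ (ε := ε / 4) (by positivity)
  have hφc : Continuous fun x => (φ x : ℂ) := Complex.continuous_ofReal.comp hφ
  have hPc : ∀ n, Continuous fun x => (P n x : ℂ) := fun n => Complex.continuous_ofReal.comp (hc n)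
  have hT : Tendsto (fun n => ∫ x, (P n x : ℂ) * trig B β x) atTop
      (𝓝 (∫ x, trig B β x ∂(γ : Measure T2))) := by
    have e1 : ∀ n, ∫ x, (P n x : ℂ) * trig B β x =
        ∑ k ∈ B, β k * ∫ x, (P n x : ℂ) * ch k x := by
      intro n
      simp only [trig, Finset.mul_sum, mul_left_comm (P n _ : ℂ)]
      rw [integral_finsetSum _ fun k _ => integrable_of_continuous _
        (continuous_const.fun_mul ((hPc n).fun_mul (continuous_ch k)))]
      simp only [integral_const_mul]
    have e2 : ∫ x, trig B β x ∂(γ : Measure T2) = ∑ k ∈ B, β k * fc γ k := by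
      simp only [trig]
      rw [integral_finsetSum _ fun k _ => (integrable_ch _ k).const_mul _]
      simp only [integral_const_mul]; rfl
    simp only [e1, e2]
    exact tendsto_finsetSum _ fun k _ => (h k).const_mul _
  obtain ⟨N, hN⟩ := Metric.tendsto_atTop.1 hT (ε / 4) (by positivity)
  refine ⟨N, fun n hn => ?_⟩
  have a1 : ‖(∫ x, (P n x : ℂ) * φ x) - ∫ x, (P n x : ℂ) * trig B β x‖ ≤ ε / 4 := by
    rw [← integral_sub (integrable_of_continuous _ ((hPc n).fun_mul hφc))
      (integrable_of_continuous _ ((hPc n).fun_mul (continuous_trig B β)))]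
    calc _ ≤ ∫ x, P n x * (ε / 4) := by
          refine norm_integral_le_of_norm_le
            ((integrable_of_continuous _ (hc n)).mul_const _) (Eventually.of_forall fun x => ?_)
          rw [← mul_sub, norm_mul, Complex.norm_real, Real.norm_eq_abs, abs_of_nonneg (h0 n x)]
          exact mul_le_mul_of_nonneg_left (hB x) (h0 n x)
      _ = ε / 4 := by rw [integral_mul_const, h1, one_mul]
  have a2 : ‖(∫ x, (φ x : ℂ) ∂(γ : Measure T2)) - ∫ x, trig B β x ∂(γ : Measure T2)‖ ≤ ε / 4 := by
    rw [← integral_sub (integrable_of_continuous _ hφc)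
      (integrable_of_continuous _ (continuous_trig B β))]
    refine (norm_integral_le_of_norm_le_const (Eventually.of_forall hB)).trans ?_
    simp
  have a3 := hN n hn
  have e3 : ((∫ x, P n x * φ x : ℝ) : ℂ) = ∫ x, (P n x : ℂ) * φ x := by
    rw [← integral_complex_ofReal]; simp
  have e4 : ((∫ x, φ x ∂(γ : Measure T2) : ℝ) : ℂ) = ∫ x, (φ x : ℂ) ∂(γ : Measure T2) :=
    integral_complex_ofReal.symm
  rw [dist_eq_norm, ← Complex.norm_real, Complex.ofReal_sub, e3, e4]
  rw [dist_eq_norm] at a3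
  have : (∫ x, (P n x : ℂ) * φ x) - ∫ x, (φ x : ℂ) ∂(γ : Measure T2) =
      ((∫ x, (P n x : ℂ) * φ x) - ∫ x, (P n x : ℂ) * trig B β x) +
      ((∫ x, (P n x : ℂ) * trig B β x) - ∫ x, trig B β x ∂(γ : Measure T2)) -
      ((∫ x, (φ x : ℂ) ∂(γ : Measure T2)) - ∫ x, trig B β x ∂(γ : Measure T2)) := by ring
  rw [this]
  refine (norm_sub_le _ _).trans_lt ?_
  have := norm_add_le ((∫ x, (P n x : ℂ) * φ x) - ∫ x, (P n x : ℂ) * trig B β x)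
    ((∫ x, (P n x : ℂ) * trig B β x) - ∫ x, trig B β x ∂(γ : Measure T2))
  linarith

lemma integral_heatKernel_mul_cs {t : ℝ} (ht : 0 < t) (k : Fin 2 → ℤ) :
    ∫ x, heatKernel t x * cs k x = Real.exp (-(lam k * t)) := by
  have h := integral_heatKernel_mul (g := fun x => conj (ch k x))
    (Complex.continuous_conj.comp (continuous_ch k)) ht
  simp only [integral_ch_mul_conj] at h
  have h2 : HasSum (fun m => (Real.exp (-(lam m * t)) : ℂ) * if m = k then 1 else 0)
      (Real.exp (-(lam k * t)) : ℂ) := by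
    convert hasSum_ite_eq k (Real.exp (-(lam k * t)) : ℂ) using 2 with m
    split_ifs with hm
    · rw [hm, mul_one]
    · rw [mul_zero]
  have h3 := congrArg Complex.re (h.unique h2)
  have hm : Measurable (heatKernel t) := measurable_heatKernel.comp measurable_prodMk_left
  have hi : Integrable (fun x => (heatKernel t x : ℂ) * conj (ch k x)) (volume : Measure T2) := by
    refine Integrable.of_bound ((Complex.measurable_ofReal.comp hm).mul
      (Complex.continuous_conj.comp (continuous_ch k)).measurable).aestronglyMeasurable
      (∑' k, Real.exp (-(lam k * t))) (Eventually.of_forall fun x => ?_)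
    rw [norm_mul, RCLike.norm_conj, norm_ch, mul_one, Complex.norm_real]
    exact abs_heatKernel_le ht x
  rw [← RCLike.re_eq_complex_re, ← integral_re hi, RCLike.re_eq_complex_re, Complex.ofReal_re] at h3
  rw [← h3]
  refine integral_congr_ae (Eventually.of_forall fun x => ?_)
  simp [cs]

/-- Truncating the heat kernel to finitely many frequencies changes it by at most `η` uniformly.
Adding the constant `2η` then restores strict positivity, and dividing by `1 + 2η` restores total
mass one. The zero frequency is put into the set so that the constant can be absorbed there. -/
lemma exists_mollifier {t η : ℝ} (ht : 0 < t) (hη : 0 < η) :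
    ∃ J : Mollifier, ∀ k, |(1 + 2 * η) * J.mult k - Real.exp (-(lam k * t))| ≤ 3 * η := by
  have hs := summable_exp_lam ht
  obtain ⟨B₀, hB₀⟩ := (summable_iff_vanishing_norm.1 hs) η hη
  set B : Finset (Fin 2 → ℤ) := insert 0 B₀ with hB
  set S : T2 → ℝ := fun z => ∑ m ∈ B, Real.exp (-(lam m * t)) * cs m z with hS
  have hSc : Continuous S := continuous_finsetSum _ fun m _ => continuous_const.mul (continuous_cs m)
  have hdiff : ∀ z, |heatKernel t z - S z| ≤ η := by
    intro z
    have hreal : HasSum (fun k => Real.exp (-(lam k * t)) * cs k z) (heatKernel t z) := by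
      have h := Complex.hasSum_re (hasSum_heatKernel ht z)
      simpa [cs, -Complex.ofReal_exp] using h
    refine le_of_tendsto ((hreal.sub_const (S z)).abs) ?_
    filter_upwards [eventually_ge_atTop B] with A hA
    have e1 : ∑ k ∈ A, Real.exp (-(lam k * t)) * cs k z - S z =
        ∑ k ∈ A \ B, Real.exp (-(lam k * t)) * cs k z := by
      rw [hS, ← Finset.sum_sdiff hA]; ring
    rw [e1]
    have hdis : Disjoint (A \ B) B₀ :=
      Finset.disjoint_of_subset_right (Finset.subset_insert _ _) Finset.sdiff_disjoint
    have h2 := (hB₀ (A \ B) hdis).le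
    refine (Finset.abs_sum_le_sum_abs _ _).trans (le_trans ?_ ((le_abs_self _).trans h2))
    refine Finset.sum_le_sum fun k _ => ?_
    rw [abs_mul, abs_of_pos (Real.exp_pos _)]
    exact mul_le_of_le_one_right (Real.exp_pos _).le (abs_cs_le k z)
  have hintcs : ∀ k, ∫ x, cs k x = if k = 0 then 1 else 0 := by
    intro k
    have h1 := integral_re (integrable_ch (volume : Measure T2) k)
    simp only [integral_ch] at h1
    change ∫ x, cs k x = _ at h1
    rw [h1]; split_ifs <;> simp
  have hSint : ∫ z, S z = 1 := by
    rw [hS, integral_finsetSum _ fun m _ => (integrable_of_continuous _ (continuous_cs m)).const_mul _]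
    simp only [integral_const_mul, hintcs, mul_ite, mul_one, mul_zero, Finset.sum_ite_eq']
    rw [if_pos (Finset.mem_insert_self _ _)]; simp [lam_zero]
  have hkey : ∀ z, ∑ m ∈ B, ((Real.exp (-(lam m * t)) + if m = 0 then 2 * η else 0) / (1 + 2 * η)) *
      cs m z = (S z + 2 * η) / (1 + 2 * η) := by
    intro z
    simp only [div_mul_eq_mul_div, ← Finset.sum_div, add_mul, Finset.sum_add_distrib, ite_mul,
      zero_mul, Finset.sum_ite_eq']
    rw [if_pos (Finset.mem_insert_self _ _)]
    simp [hS, cs, ch_index_zero]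
  have hSp : ∀ z, 0 < S z + 2 * η := fun z => by
    have h1 := abs_le.1 (hdiff z)
    have h2 := heatKernel_nonneg ht z
    linarith [h1.2]
  refine ⟨⟨B, fun m => (Real.exp (-(lam m * t)) + if m = 0 then 2 * η else 0) / (1 + 2 * η),
    fun k => ?_, fun k => ?_, fun z => ?_, ?_⟩, fun k => ?_⟩
  · have : (0:ℝ) ≤ if k = 0 then 2 * η else 0 := by split_ifs <;> positivity
    have := Real.exp_pos (-(lam k * t))
    positivity
  · rw [div_le_one (by positivity)]
    have h1 : Real.exp (-(lam k * t)) ≤ 1 := Real.exp_le_one_iff.2 (by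
      have := mul_nonneg (lam_nonneg k) ht.le; linarith)
    split_ifs <;> linarith
  · rw [hkey]; exact div_pos (hSp z) (by positivity)
  · simp only [hkey]
    rw [integral_div, integral_add (integrable_of_continuous _ hSc) (integrable_const _), hSint]
    simp only [integral_const, probReal_univ, one_smul]
    exact div_self (by positivity)
  · have hm : Measurable (heatKernel t) := measurable_heatKernel.comp measurable_prodMk_left
    have hi : Integrable (fun x => heatKernel t x * cs k x) (volume : Measure T2) :=
      (Integrable.of_bound hm.aestronglyMeasurable _
        (Eventually.of_forall fun x => abs_heatKernel_le ht x)).mul_bdd (c := 1)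
        (continuous_cs k).aestronglyMeasurable (Eventually.of_forall fun x => abs_cs_le k x)
    rw [← integral_heatKernel_mul_cs ht k, Mollifier.mult, ← integral_const_mul,
      ← integral_sub (integrable_of_continuous _ (continuous_const.fun_mul
        ((Mollifier.continuous_ker _).fun_mul (continuous_cs k)))) hi]
    have hle := norm_integral_le_of_norm_le_const (μ := (volume : Measure T2)) (C := 3 * η)
      (f := fun z => (1 + 2 * η) * ((∑ m ∈ B, ((Real.exp (-(lam m * t)) + if m = 0 then 2 * η else 0) /
        (1 + 2 * η)) * cs m z) * cs k z) - heatKernel t z * cs k z)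
    rw [probReal_univ, mul_one] at hle
    refine hle (Eventually.of_forall fun z => ?_)
    change ‖(1 + 2 * η) * ((∑ m ∈ B, ((Real.exp (-(lam m * t)) + if m = 0 then 2 * η else 0) /
      (1 + 2 * η)) * cs m z) * cs k z) - heatKernel t z * cs k z‖ ≤ _
    rw [hkey]
    have e1 : (1 + 2 * η) * ((S z + 2 * η) / (1 + 2 * η) * cs k z) - heatKernel t z * cs k z =
        (S z + 2 * η - heatKernel t z) * cs k z := by field_simp
    rw [e1, Real.norm_eq_abs, abs_mul]
    refine (mul_le_of_le_one_right (abs_nonneg _) (abs_cs_le k z)).trans ?_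
    have h1 := abs_le.1 (hdiff z)
    rw [abs_le]; constructor <;> linarith [h1.1, h1.2]

/-- There are mollifiers whose multipliers tend to one. -/
lemma exists_mollifier_seq : ∃ J : ℕ → Mollifier, ∀ k, Tendsto (fun n => (J n).mult k) atTop (𝓝 1) := by
  have h : ∀ n : ℕ, ∃ J : Mollifier, ∀ k, |(1 + 2 * (1 / ((n:ℝ) + 1))) * J.mult k -
      Real.exp (-(lam k * (1 / ((n:ℝ) + 1))))| ≤ 3 * (1 / ((n:ℝ) + 1)) := fun n =>
    exists_mollifier (by positivity) (by positivity)
  choose J hJ using h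
  refine ⟨J, fun k => ?_⟩
  have t0 := tendsto_one_div_add_atTop_nhds_zero_nat (𝕜 := ℝ)
  have t1 : Tendsto (fun n : ℕ => Real.exp (-(lam k * (1 / ((n:ℝ) + 1))))) atTop (𝓝 1) := by
    have := (Real.continuous_exp.tendsto 0).comp (by simpa using (t0.const_mul (lam k)).neg)
    simpa [Function.comp_def] using this
  have t2 : Tendsto (fun n : ℕ => (1 + 2 * (1 / ((n:ℝ) + 1))) * (J n).mult k -
      Real.exp (-(lam k * (1 / ((n:ℝ) + 1))))) atTop (𝓝 0) :=
    squeeze_zero_norm (fun n => hJ n k) (by simpa using t0.const_mul 3)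
  have t3 := t2.add t1
  simp only [sub_add_cancel, zero_add] at t3
  have t4 : Tendsto (fun n : ℕ => 1 + 2 * (1 / ((n:ℝ) + 1))) atTop (𝓝 1) := by
    simpa using (t0.const_mul 2).const_add 1
  have t5 := t3.div t4 one_ne_zero
  rw [div_one] at t5
  refine t5.congr fun n => ?_
  have : (1 + 2 * (1 / ((n:ℝ) + 1))) ≠ 0 := by positivity
  simp only [Pi.div_apply]
  field_simp

end Mollification

/-! ## Weak limits and densities -/

section WeakLimits

/-- Bounded sequences in `L²` converge weakly along ultrafilters. -/
lemma exists_weak_limit {X : Type*} [MeasurableSpace X] {μ : Measure X} {w : ℕ → X → ℝ}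
    (hw : ∀ n, MemLp (w n) 2 μ) {C : ℝ} (hC : ∀ n, ∫ x, w n x ^ 2 ∂μ ≤ C) (U : Ultrafilter ℕ) :
    ∃ F : X → ℝ, MemLp F 2 μ ∧ ∫ x, F x ^ 2 ∂μ ≤ C ∧
      ∀ g : X → ℝ, MemLp g 2 μ → Tendsto (fun n => ∫ x, w n x * g x ∂μ) U (𝓝 (∫ x, F x * g x ∂μ)) := by
  have hsq : ∀ f : Lp ℝ 2 μ, ‖f‖ ^ 2 = ∫ x, f x ^ 2 ∂μ := by
    intro f
    rw [← real_inner_self_eq_norm_sq, L2.inner_def]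
    simp [sq]
  have hin : ∀ f g : Lp ℝ 2 μ, inner ℝ f g = ∫ x, f x * g x ∂μ := by
    intro f g
    rw [L2.inner_def]
    simp [mul_comm]
  set W : ℕ → Lp ℝ 2 μ := fun n => (hw n).toLp (w n) with hW
  have hC0 : 0 ≤ C := (integral_nonneg fun x => sq_nonneg _).trans (hC 0)
  have hWn : ∀ n, ‖W n‖ ≤ √C := by
    intro n
    refine Real.le_sqrt_of_sq_le ?_
    rw [hsq]
    refine le_trans (le_of_eq (integral_congr_ae ?_)) (hC n)
    filter_upwards [(hw n).coeFn_toLp] with x hx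
    rw [hx]
  -- Banach–Alaoglu in the dual, read back in `L²` through the Riesz isometry. An ultrafilter avoids
  -- both separability and extraction of subsequences.
  have hcomp := WeakDual.isCompact_closedBall (0 : StrongDual ℝ (Lp ℝ 2 μ)) (√C)
  obtain ⟨L, hL, hlim⟩ := isCompact_iff_ultrafilter_le_nhds.1 hcomp
    (U.map fun n => StrongDual.toWeakDual (InnerProductSpace.toDual ℝ _ (W n))) (by
      rw [Ultrafilter.coe_map, le_principal_iff]
      refine Filter.mem_map.2 (Filter.univ_mem' fun n => ?_)
      simpa using hWn n)
  rw [Ultrafilter.coe_map] at hlim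
  set F : Lp ℝ 2 μ := (InnerProductSpace.toDual ℝ _).symm (WeakDual.toStrongDual L) with hF
  have hFn : ‖F‖ ≤ √C := by
    rw [hF, LinearIsometryEquiv.norm_map]; simpa using hL
  refine ⟨F, Lp.memLp F, ?_, fun g hg => ?_⟩
  · rw [← hsq]
    calc ‖F‖ ^ 2 ≤ √C ^ 2 := by gcongr
      _ = C := Real.sq_sqrt hC0
  · have h1 := ((WeakDual.eval_continuous (hg.toLp g)).tendsto L).comp (tendsto_iff_comap.2
      (map_le_iff_le_comap.1 hlim))
    have h2 : L (hg.toLp g) = ∫ x, F x * g x ∂μ := by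
      have : L (hg.toLp g) = inner ℝ F (hg.toLp g) := by
        rw [hF, InnerProductSpace.toDual_symm_apply]; rfl
      rw [this, hin]
      refine integral_congr_ae ?_
      filter_upwards [hg.coeFn_toLp] with x hx
      rw [hx]
    rw [h2] at h1
    refine h1.congr fun n => ?_
    change inner ℝ (W n) (hg.toLp g) = _
    rw [hin]
    refine integral_congr_ae ?_
    filter_upwards [hg.coeFn_toLp, (hw n).coeFn_toLp] with x hx hx'
    rw [hx, hx']

lemma memLp_two_of_continuous {f : T2 → ℝ} (hf : Continuous f) (μ : Measure T2) [IsFiniteMeasure μ] :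
    MemLp f 2 μ :=
  (memLp_two_iff_integrable_sq hf.aestronglyMeasurable).2 (integrable_of_continuous _ (hf.pow 2))

/-- Mollifications converge weakly. -/
lemma tendsto_integral_mol {J : ℕ → Mollifier}
    (hJ : ∀ k, Tendsto (fun n => (J n).mult k) atTop (𝓝 1)) (γ : PT2) {φ : T2 → ℝ}
    (hφ : Continuous φ) :
    Tendsto (fun n => ∫ x, (J n).mol γ x * φ x) atTop (𝓝 (∫ x, φ x ∂(γ : Measure T2))) := by
  refine tendsto_integral_of_fourier (fun n => (Mollifier.isSmooth_mol γ).continuous)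
    (fun n x => (Mollifier.mol_pos γ x).le) (fun n => Mollifier.integral_mol γ) γ (fun k => ?_) hφ
  simp only [Mollifier.integral_mol_mul_ch]
  have h := ((Complex.continuous_ofReal.tendsto _).comp (hJ k)).mul_const (fc γ k)
  simpa using h

/-- A measure with square summable Fourier coefficients has a density in `L²`. -/
lemma density_of_wsq {γ : PT2} (hw : wsq γ ≠ ⊤) :
    (γ : Measure T2) ≪ volume ∧ MemLp (density γ) 2 volume ∧
      ∫ x, density γ x ^ 2 ≤ 1 + (wsq γ).toReal := by
  obtain ⟨J, hJ⟩ := exists_mollifier_seq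
  set U : Ultrafilter ℕ := hyperfilter ℕ
  have hU : (U : Filter ℕ) ≤ atTop := Nat.hyperfilter_le_atTop
  obtain ⟨F, hF, hF2, hlim⟩ := exists_weak_limit
    (fun n => memLp_two_of_continuous (Mollifier.isSmooth_mol (J := J n) γ).continuous volume)
    (fun n => (J n).integral_mol_sq_le hw) U
  have hFi : Integrable F := hF.integrable one_le_two
  -- Indicators are admissible tests for weak `L²` convergence, so the limit inherits a nonnegative
  -- integral over every measurable set.
  have hF0 : 0 ≤ᵐ[volume] F := by
    refine ae_nonneg_of_forall_setIntegral_nonneg hFi fun s hs _ => ?_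
    have hind : MemLp (s.indicator fun _ => (1:ℝ)) 2 (volume : Measure T2) :=
      memLp_indicator_const 2 hs 1 (Or.inr (measure_ne_top _ _))
    have h1 := hlim _ hind
    have h2 : ∫ x, F x * s.indicator (fun _ => (1:ℝ)) x = ∫ x in s, F x := by
      rw [← integral_indicator hs]
      refine integral_congr_ae (Eventually.of_forall fun x => ?_)
      by_cases hx : x ∈ s <;> simp [hx]
    rw [h2] at h1
    refine ge_of_tendsto' h1 fun n => integral_nonneg fun x => ?_
    exact mul_nonneg (Mollifier.mol_pos γ x).le (indicator_nonneg (fun _ _ => zero_le_one) x)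
  -- Tested against continuous functions, the mollifications converge both to `γ` and to `F`, so the
  -- two measures agree.
  have hγ : (γ : Measure T2) = volume.withDensity (fun x => ENNReal.ofReal (F x)) := by
    have : IsFiniteMeasure (volume.withDensity (fun x => ENNReal.ofReal (F x)) : Measure T2) :=
      isFiniteMeasure_withDensity_ofReal hFi.2
    refine ext_of_forall_integral_eq_of_IsFiniteMeasure fun φ => ?_
    have h1 := hlim φ (memLp_two_of_continuous φ.continuous volume)
    have h2 := (tendsto_integral_mol hJ γ φ.continuous).mono_left hU
    rw [tendsto_nhds_unique h2 h1,
      integral_withDensity_eq_integral_toReal_smul₀ hFi.1.aemeasurable.ennreal_ofReal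
        (Eventually.of_forall fun _ => ENNReal.ofReal_lt_top)]
    refine integral_congr_ae ?_
    filter_upwards [hF0] with x hx
    rw [ENNReal.toReal_ofReal hx, smul_eq_mul]
  have hd : density γ =ᵐ[volume] F := by
    have h1 := Measure.rnDeriv_withDensity₀ (volume : Measure T2)
      (f := fun x => ENNReal.ofReal (F x)) hFi.1.aemeasurable.ennreal_ofReal
    rw [← hγ] at h1
    filter_upwards [h1, hF0] with x hx hx0
    rw [density, hx, ENNReal.toReal_ofReal hx0]
  refine ⟨?_, hF.ae_eq hd.symm, ?_⟩
  · rw [hγ]; exact withDensity_absolutelyContinuous _ _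
  · refine le_trans (le_of_eq (integral_congr_ae ?_)) hF2
    filter_upwards [hd] with x hx
    rw [hx]

lemma measurable_density (γ : PT2) : Measurable (density γ) :=
  (Measure.measurable_rnDeriv _ _).ennreal_toReal

lemma density_nonneg (γ : PT2) (x : T2) : 0 ≤ density γ x := ENNReal.toReal_nonneg

lemma withDensity_density {γ : PT2} (h : (γ : Measure T2) ≪ volume) :
    (γ : Measure T2) = volume.withDensity (fun x => ENNReal.ofReal (density γ x)) := by
  conv_lhs => rw [← Measure.withDensity_rnDeriv_eq _ _ h]
  refine withDensity_congr_ae ?_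
  filter_upwards [Measure.rnDeriv_lt_top (γ : Measure T2) volume] with x hx
  rw [density, ENNReal.ofReal_toReal hx.ne]

lemma integral_density {γ : PT2} (h : (γ : Measure T2) ≪ volume) {E : Type*}
    [NormedAddCommGroup E] [NormedSpace ℝ E] (f : T2 → E) :
    ∫ x, f x ∂(γ : Measure T2) = ∫ x, density γ x • f x := by
  rw [← integral_rnDeriv_smul h]; rfl

lemma integrable_density (γ : PT2) : Integrable (density γ) := Measure.integrable_toReal_rnDeriv

/-- Bessel's inequality for `density γ - 1`. Only this direction is needed to transfer the bound
contained in `Q_T` to Fourier coefficients. -/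
lemma wsq_le_l2DistSq (γ : PT2) : wsq γ ≤ l2DistSq γ := by
  unfold l2DistSq
  split_ifs with hac
  swap
  · exact le_top
  rcases eq_or_ne (∫⁻ x, ENNReal.ofReal ((density γ x - 1) ^ 2)) ⊤ with htop | htop
  · rw [htop]; exact le_top
  have hm : Measurable fun x => density γ x - 1 := (measurable_density γ).sub_const 1
  have hint : Integrable (fun x => (density γ x - 1) ^ 2) (volume : Measure T2) := by
    refine ⟨(hm.pow_const 2).aestronglyMeasurable, ?_⟩
    rw [hasFiniteIntegral_iff_ofReal (Eventually.of_forall fun x => sq_nonneg _)]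
    exact htop.lt_top
  rw [← ofReal_integral_eq_lintegral_ofReal hint (Eventually.of_forall fun x => sq_nonneg _), wsq,
    ENNReal.tsum_eq_iSup_sum]
  refine iSup_le fun B => ?_
  rw [← ENNReal.ofReal_sum_of_nonneg fun k _ => fsq_nonneg γ k]
  refine ENNReal.ofReal_le_ofReal (le_trans (le_of_eq ?_) (bessel hm.aestronglyMeasurable hint B))
  refine Finset.sum_congr rfl fun k _ => ?_
  have hi1 : Integrable (fun x => (density γ x : ℂ) * ch k x) (volume : Measure T2) :=
    (integrable_density γ).ofReal.mul_bdd (c := 1) (continuous_ch k).aestronglyMeasurable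
      (Eventually.of_forall fun x => (norm_ch k x).le)
  have e1 : ∫ x, ((density γ x - 1 : ℝ) : ℂ) * ch k x = fc γ k - if k = 0 then 1 else 0 := by
    simp only [Complex.ofReal_sub, sub_mul, Complex.ofReal_one, one_mul]
    rw [integral_sub hi1 (integrable_ch _ k), integral_ch, fc, integral_density hac]
    simp only [Complex.real_smul]
  rw [e1]
  unfold fsq; split_ifs with hk
  · subst hk; simp [fc_zero]
  · simp

end WeakLimits

/-! ## The Biot–Savart kernel as a time integral -/

section BiotSavartKernel

lemma integrableOn_ite_inv_sq {a : ℝ} (ha : 0 < a) (K : ℝ) :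
    IntegrableOn (fun t : ℝ => if t < a then K else K * t⁻¹ ^ 2) (Ioi 0) := by
  rw [← Ioo_union_Ici_eq_Ioi ha]
  refine IntegrableOn.union ?_ ?_
  · refine (integrableOn_const (C := K) (by simp)).congr_fun (fun t ht => ?_) measurableSet_Ioo
    simp [ht.2]
  · rw [integrableOn_Ici_iff_integrableOn_Ioi]
    have h : IntegrableOn (fun t : ℝ => K * t⁻¹ ^ 2) (Ioi a) := (integrableOn_inv_sq_Ioi ha).const_mul K
    refine h.congr_fun (fun t ht => ?_) measurableSet_Ioi
    simp [not_lt.2 (le_of_lt (show a < t from ht))]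

/-- Off the coordinate axes, the heat kernel and its derivatives are integrable in time, uniformly
along lines that stay off the axes. -/
lemma exists_heat_bound {a : UnitAddCircle} (ha : a ≠ 0) : ∃ b : ℝ → ℝ, IntegrableOn b (Ioi 0) ∧
    ∀ t, 0 < t → ∀ y : UnitAddCircle,
      |dcos y (4 * Real.pi * t) * cosKernel a (4 * Real.pi * t)| ≤ b t ∧
      |cosKernel a (4 * Real.pi * t) * cosKernel y (4 * Real.pi * t) - 1| ≤ b t := by
  obtain ⟨s₀, C₁, hs₀, hC₁, h1⟩ := exists_cosKernel_le_sq ha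
  obtain ⟨C₂, hC₂, h2⟩ := exists_abs_dcos_le
  obtain ⟨C₃, hC₃, h3⟩ := exists_abs_cosKernel_sub_one_le
  have hpi := Real.pi_gt_three
  set M := 1 + C₃ * s₀⁻¹ ^ 2 with hM
  have hM0 : 0 < M := by positivity
  -- The four summands are the constants of the four estimates below: two quantities, each at small
  -- and at large times.
  set K := C₁ * C₂ + (C₁ * s₀ ^ 2 + C₁ * C₃ + 1) + M * C₂ + C₃ * (M + 1) with hK
  refine ⟨fun t => if t < s₀ / (4 * Real.pi) then K else K * t⁻¹ ^ 2,
    integrableOn_ite_inv_sq (by positivity) K, fun t ht y => ?_⟩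
  set s := 4 * Real.pi * t with hs
  have hs0 : 0 < s := by positivity
  have hy2 := h2 y s hs0
  have hy3 := h3 y s hs0
  have ha3 := h3 a s hs0
  have hya : |cosKernel y s| ≤ 1 + C₃ * s⁻¹ ^ 2 := by
    have := abs_add_le (cosKernel y s - 1) 1
    simp only [sub_add_cancel, abs_one] at this; linarith
  have ha0 := cosKernel_nonneg a hs0
  have p1 : 0 < C₁ * C₂ := by positivity
  have p2 : 0 < C₁ * s₀ ^ 2 + C₁ * C₃ + 1 := by positivity
  have p3 : 0 < M * C₂ := by positivity
  have p4 : 0 < C₃ * (M + 1) := by positivity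
  -- Below the threshold the factor at `a ≠ 0` is of order `s²` and cancels the `s⁻²` bound for the
  -- other factor. Above it, decay in time is enough.
  by_cases hlt : t < s₀ / (4 * Real.pi)
  · have hss : s < s₀ := by rw [lt_div_iff₀ (by positivity)] at hlt; rw [hs]; linarith
    simp only [if_pos hlt]
    have ha1 := h1 s hs0 hss
    constructor
    · rw [abs_mul, abs_of_nonneg ha0]
      calc _ ≤ (C₂ * s⁻¹ ^ 2) * (C₁ * s ^ 2) := by gcongr
        _ = C₁ * C₂ := by field_simp
        _ ≤ K := by linarith
    · calc _ ≤ |cosKernel a s * cosKernel y s| + 1 := by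
            have := abs_sub (cosKernel a s * cosKernel y s) 1
            rwa [abs_one] at this
        _ ≤ (C₁ * s ^ 2) * (1 + C₃ * s⁻¹ ^ 2) + 1 := by
            rw [abs_mul, abs_of_nonneg ha0]; gcongr
        _ = C₁ * s ^ 2 + C₁ * C₃ + 1 := by field_simp
        _ ≤ C₁ * s₀ ^ 2 + C₁ * C₃ + 1 := by gcongr
        _ ≤ K := by linarith
  · have hss : s₀ ≤ s := by
      rw [not_lt, div_le_iff₀ (by positivity)] at hlt; rw [hs]; linarith
    simp only [if_neg hlt]
    have hst : s⁻¹ ^ 2 ≤ t⁻¹ ^ 2 := by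
      have : t ≤ s := by rw [hs]; nlinarith
      gcongr
    have hs0' : s⁻¹ ^ 2 ≤ s₀⁻¹ ^ 2 := by gcongr
    have hyM : |cosKernel y s| ≤ M := hya.trans (by rw [hM]; gcongr)
    have haM : |cosKernel a s| ≤ M := by
      have := abs_add_le (cosKernel a s - 1) 1
      simp only [sub_add_cancel, abs_one] at this
      have h4 : C₃ * s⁻¹ ^ 2 ≤ C₃ * s₀⁻¹ ^ 2 := by gcongr
      linarith
    have ht2 : 0 ≤ t⁻¹ ^ 2 := by positivity
    constructor
    · rw [abs_mul]
      calc _ ≤ (C₂ * s⁻¹ ^ 2) * M := by gcongr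
        _ ≤ (C₂ * t⁻¹ ^ 2) * M := by gcongr
        _ = (M * C₂) * t⁻¹ ^ 2 := by ring
        _ ≤ K * t⁻¹ ^ 2 := by gcongr; linarith
    · have e : cosKernel a s * cosKernel y s - 1 =
          (cosKernel a s - 1) * cosKernel y s + (cosKernel y s - 1) := by ring
      rw [e]
      calc _ ≤ |cosKernel a s - 1| * |cosKernel y s| + |cosKernel y s - 1| := by
            rw [← abs_mul]; exact abs_add_le _ _
        _ ≤ (C₃ * s⁻¹ ^ 2) * M + C₃ * s⁻¹ ^ 2 := by gcongr
        _ = (C₃ * (M + 1)) * s⁻¹ ^ 2 := by ring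
        _ ≤ (C₃ * (M + 1)) * t⁻¹ ^ 2 := by gcongr
        _ ≤ K * t⁻¹ ^ 2 := by gcongr; linarith

lemma heatKernel_eq (i : Fin 2) (t : ℝ) (x : T2) : heatKernel t x =
    cosKernel (x (1 - i)) (4 * Real.pi * t) * cosKernel (x i) (4 * Real.pi * t) := by
  fin_cases i <;> simp [heatKernel, Fin.prod_univ_two, mul_comm]

lemma measurable_heatKernel_left (x : T2) : Measurable fun t => heatKernel t x :=
  measurable_heatKernel.comp measurable_prodMk_right

lemma measurable_dheat_left (i : Fin 2) (x : T2) : Measurable fun t => dheat i t x :=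
  Measurable.comp (g := fun p : ℝ × T2 => dheat i p.1 p.2) (measurable_dheat i)
    (f := fun t => (t, x)) (measurable_id.prodMk measurable_const)

lemma green_toReal {x : T2} (h : IntegrableOn (fun t => heatKernel t x - 1) (Ioi 0)) :
    (green x).toReal = ∫ t in Ioi (0:ℝ), (heatKernel t x - 1) := by
  have h1 := integral_eq_lintegral_pos_part_sub_lintegral_neg_part h
  simp only [neg_sub] at h1
  have hP : greenPos x ≠ ⊤ := h.lintegral_lt_top.ne
  have hN : greenNeg x ≠ ⊤ := by
    have := h.neg.lintegral_lt_top.ne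
    simpa only [Pi.neg_apply, neg_sub, greenNeg] using this
  rw [h1, green_eq]
  change (_ : EReal).toReal = (greenPos x).toReal - (greenNeg x).toReal
  lift greenPos x to NNReal using hP with p
  lift greenNeg x to NNReal using hN with n
  rfl

/-- Off the axes, the Green function can be differentiated under the time integral. -/
lemma pd_green (i : Fin 2) {x : T2} (hx : x (1 - i) ≠ 0) :
    pd i (fun z => (green z).toReal) x = ∫ t in Ioi (0:ℝ), dheat i t x := by
  obtain ⟨b, hb, hbd⟩ := exists_heat_bound hx
  -- Moving in direction `i` keeps the other coordinate fixed and nonzero, so a single integrable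
  -- bound works along the whole line.
  have hcoord : ∀ h : ℝ, (x + shift i h) (1 - i) = x (1 - i) := by
    intro h; fin_cases i <;> simp [shift, toT2]
  have hint : ∀ h : ℝ, IntegrableOn (fun t => heatKernel t (x + shift i h) - 1) (Ioi 0) := by
    intro h
    refine Integrable.mono' hb ((measurable_heatKernel_left _).sub_const 1).aestronglyMeasurable ?_
    refine (ae_restrict_iff' measurableSet_Ioi).2 (Eventually.of_forall fun t ht => ?_)
    rw [heatKernel_eq i, hcoord]
    exact (hbd t ht _).2
  have key := (hasDerivAt_integral_of_dominated_loc_of_deriv_le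
    (μ := (volume : Measure ℝ).restrict (Ioi 0))
    (F := fun h t => heatKernel t (x + shift i h) - 1)
    (F' := fun h t => dheat i t (x + shift i h)) (x₀ := (0:ℝ))
    (bound := b) (s := univ) univ_mem
    (Eventually.of_forall fun h =>
      ((measurable_heatKernel_left _).sub_const 1).aestronglyMeasurable)
    (hint 0) (measurable_dheat_left i _).aestronglyMeasurable
    ((ae_restrict_iff' measurableSet_Ioi).2 (Eventually.of_forall fun t ht h _ => by
      rw [Real.norm_eq_abs, dheat, hcoord]; exact (hbd t ht _).1))
    hb
    ((ae_restrict_iff' measurableSet_Ioi).2 (Eventually.of_forall fun t ht h _ =>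
      (hasDerivAt_heatKernel ht i x h).sub_const 1))).2
  rw [pd_def]
  simp only [green_toReal (hint _)]
  rw [key.deriv, shift_zero, add_zero]

lemma biotSavart_eq {x : T2} (h0 : x 0 ≠ 0) (h1 : x 1 ≠ 0) : biotSavart x =
    ![-∫ t in Ioi (0:ℝ), dheat 1 t x, ∫ t in Ioi (0:ℝ), dheat 0 t x] := by
  rw [biotSavart, pd_green 1 (by simpa using h0), pd_green 0 (by simpa using h1)]

/-! ### Space-time integrability of the heat kernel gradient. -/

lemma ch_single (i : Fin 2) (n : ℤ) (x : T2) : ch (Pi.single i n) x = fourier n (x i) := by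
  fin_cases i <;> simp [ch_eq_prod, Fin.prod_univ_two, -fourier_apply, fourier_zero]

lemma integral_mul_coord (i : Fin 2) (f g : UnitAddCircle → ℝ) :
    ∫ x : T2, f (x i) * g (x (1 - i)) = (∫ x : T2, f (x i)) * ∫ x : T2, g (x (1 - i)) := by
  have hp : ∀ f g : UnitAddCircle → ℝ, ∫ p : UnitAddCircle × UnitAddCircle, f p.1 * g p.2 =
      (∫ a, f a) * ∫ b, g b := fun f g => integral_prod_mul f g
  have h1 : ∀ f : UnitAddCircle → ℝ, ∫ p : UnitAddCircle × UnitAddCircle, f p.1 = ∫ a, f a := by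
    intro f; simpa using hp f (fun _ => 1)
  have h2 : ∀ f : UnitAddCircle → ℝ, ∫ p : UnitAddCircle × UnitAddCircle, f p.2 = ∫ a, f a := by
    intro f; simpa using hp (fun _ => 1) f
  rw [integral_T2_eq, integral_T2_eq, integral_T2_eq]
  fin_cases i
  · simp [hp, h1, h2]
  · have h3 := hp g f
    simp only [mul_comm (g _)] at h3
    simp [h1, h2, h3, mul_comm]

lemma integral_cosKernel_coord (i : Fin 2) {s : ℝ} (hs : 0 < s) :
    ∫ x : T2, cosKernel (x i) s = 1 := by
  have h := hasSum_integral_of_summable_integral_norm (μ := (volume : Measure T2))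
    (F := fun (n : ℤ) x => (Real.exp (-Real.pi * n ^ 2 * s) : ℂ) * ch (Pi.single i n) x)
    (fun n => (integrable_ch _ _).const_mul _) (by
      simp only [norm_mul, norm_ch, mul_one, integral_const, smul_eq_mul, probReal_univ, one_mul]
      exact summable_norm_exp hs)
  simp only [ch_single, (hasSum_cosKernel _ hs).tsum_eq] at h
  simp only [← ch_single, integral_const_mul, integral_ch, Pi.single_eq_zero_iff] at h
  have h2 := hasSum_ite_eq (0:ℤ) (1:ℂ)
  have h3 : (fun n : ℤ => (Real.exp (-Real.pi * n ^ 2 * s) : ℂ) * if n = 0 then 1 else 0) =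
      fun n : ℤ => if n = 0 then 1 else 0 := by
    ext n; split_ifs with hn
    · simp [hn]
    · simp
  rw [h3] at h
  have h4 := h.unique h2
  rw [integral_complex_ofReal] at h4
  exact_mod_cast h4

lemma measurable_dcos {s : ℝ} (hs : 0 < s) : Measurable fun x : UnitAddCircle => dcos x s :=
  measurable_of_hasSum (fun n => ((fourier n).continuous.measurable.const_mul _))
    fun x => hasSum_dcos x hs

/-- The squared `L²` norm of the derivative of the one-dimensional heat kernel. -/
noncomputable def dcosNormSq (s : ℝ) : ℝ :=
  ∑' n : ℤ, (2 * Real.pi * |(n:ℝ)| * Real.exp (-Real.pi * n ^ 2 * s)) ^ 2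

lemma summable_dcosNormSq {s : ℝ} (hs : 0 < s) :
    Summable fun n : ℤ => (2 * Real.pi * |(n:ℝ)| * Real.exp (-Real.pi * n ^ 2 * s)) ^ 2 := by
  have h := summable_dcos_bound hs
  refine Summable.of_nonneg_of_le (fun n => sq_nonneg _) (fun n => ?_)
    (h.mul_left (∑' n : ℤ, 2 * Real.pi * |(n:ℝ)| * Real.exp (-Real.pi * n ^ 2 * s)))
  rw [sq]
  refine mul_le_mul_of_nonneg_right ?_ (by positivity)
  exact h.le_tsum n fun m _ => by positivity

/-- Parseval holds exactly for the partial sums, which converge pointwise under a constant bound, so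
dominated convergence yields the inequality. -/
lemma integral_dcos_sq_le (i : Fin 2) {s : ℝ} (hs : 0 < s) :
    ∫ x : T2, dcos (x i) s ^ 2 ≤ dcosNormSq s := by
  set a : ℤ → ℂ := fun n => 2 * Real.pi * Complex.I * n * Real.exp (-Real.pi * n ^ 2 * s) with ha
  have ht : Tendsto (fun A : Finset ℤ => ∫ x : T2, ‖∑ n ∈ A, a n * fourier n (x i)‖ ^ 2) atTop
      (𝓝 (∫ x : T2, dcos (x i) s ^ 2)) := by
    have hconv : ∀ x : T2, Tendsto (fun A : Finset ℤ => ‖∑ n ∈ A, a n * fourier n (x i)‖ ^ 2) atTop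
        (𝓝 (dcos (x i) s ^ 2)) := by
      intro x
      have h1 := ((hasSum_dcos (x i) hs).norm.pow 2 :)
      have h2 : ‖(dcos (x i) s : ℂ)‖ ^ 2 = dcos (x i) s ^ 2 := by
        rw [Complex.norm_real, Real.norm_eq_abs, sq_abs]
      rw [← h2]
      exact h1
    refine tendsto_integral_filter_of_dominated_convergence
      (fun _ => (∑' n : ℤ, 2 * Real.pi * |(n:ℝ)| * Real.exp (-Real.pi * n ^ 2 * s)) ^ 2)
      (Eventually.of_forall fun A => ?_) (Eventually.of_forall fun A => Eventually.of_forall fun x => ?_)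
      (integrable_const _) (Eventually.of_forall hconv)
    · refine Continuous.aestronglyMeasurable ((continuous_finsetSum _ fun n _ =>
        continuous_const.mul ((fourier n).continuous.comp (continuous_apply i))).norm.pow 2)
    · rw [Real.norm_eq_abs, abs_of_nonneg (sq_nonneg _)]
      refine pow_le_pow_left₀ (norm_nonneg _) ((norm_sum_le _ _).trans ?_) 2
      simp only [ha, norm_mul, norm_fourier_apply, mul_one]
      simp only [← norm_mul, norm_dcos_coeff]
      exact (summable_dcos_bound hs).sum_le_tsum A fun n _ => by positivity
  refine le_of_tendsto' ht fun A => ?_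
  have e1 : ∀ x : T2, ∑ n ∈ A, a n * fourier n (x i) =
      trig (A.map ⟨fun n => Pi.single i n, Pi.single_injective (M := fun _ : Fin 2 => ℤ) i⟩)
        (fun k => a (k i)) x := by
    intro x
    simp [trig, Finset.sum_map, ch_single, -fourier_apply]
  simp only [e1, integral_norm_trig_sq, Finset.sum_map, Function.Embedding.coeFn_mk,
    Pi.single_eq_same]
  simp only [ha, norm_dcos_coeff]
  exact (summable_dcosNormSq hs).sum_le_tsum A fun n _ => sq_nonneg _

/-- The kernel factorises over the coordinates: the undifferentiated factor has mass one, and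
Cauchy–Schwarz on a probability space handles the other. -/
lemma integral_abs_dheat_le (i : Fin 2) {t : ℝ} (ht : 0 < t) :
    ∫ x, |dheat i t x| ≤ √(dcosNormSq (4 * Real.pi * t)) := by
  have hs : 0 < 4 * Real.pi * t := by have := Real.pi_pos; positivity
  have h1 : ∀ x, |dheat i t x| = |dcos (x i) (4 * Real.pi * t)| *
      cosKernel (x (1 - i)) (4 * Real.pi * t) := fun x => by
    rw [dheat, abs_mul, abs_of_nonneg (cosKernel_nonneg (x (1 - i)) hs)]
  simp only [h1]
  rw [integral_mul_coord i (fun y => |dcos y (4 * Real.pi * t)|)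
    (fun y => cosKernel y (4 * Real.pi * t)), integral_cosKernel_coord _ hs, mul_one]
  have hm : Measurable fun x : T2 => dcos (x i) (4 * Real.pi * t) :=
    (measurable_dcos hs).comp (measurable_pi_apply i)
  have hb : ∀ x : T2, ‖dcos (x i) (4 * Real.pi * t) ^ 2‖ ≤
      (∑' n : ℤ, 2 * Real.pi * |(n:ℝ)| * Real.exp (-Real.pi * n ^ 2 * (4 * Real.pi * t))) ^ 2 := by
    intro x
    rw [norm_pow, Real.norm_eq_abs]
    exact pow_le_pow_left₀ (abs_nonneg _) (abs_dcos_le _ hs) 2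
  have h2 := integral_mul_le_sqrt (volume : Measure T2) hm.aestronglyMeasurable
    (aestronglyMeasurable_const (b := (1:ℝ)))
    (Integrable.of_bound (hm.pow_const 2).aestronglyMeasurable _ (Eventually.of_forall hb)) (by simp)
  simp only [mul_one, one_pow, integral_const, probReal_univ, smul_eq_mul, Real.sqrt_one] at h2
  exact h2.trans (Real.sqrt_le_sqrt (integral_dcos_sq_le i hs))

/-- The exponent `7/4` serves two purposes: `n² · n^(-7/2) = n^(-3/2)` is summable, and the square
root of `s^(-7/4)`, namely `s^(-7/8)`, is integrable at zero. -/
lemma exp_neg_le_rpow {y : ℝ} (hy : 0 < y) : Real.exp (-y) ≤ 2 * y ^ (-(7 / 4) : ℝ) := by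
  have h1 : y ^ (7 / 4 : ℝ) ≤ 1 + y ^ 2 := by
    rcases le_total y 1 with h | h
    · have := Real.rpow_le_one hy.le h (by norm_num : (0:ℝ) ≤ 7 / 4); nlinarith
    · have := Real.rpow_le_rpow_of_exponent_le h (by norm_num : (7 / 4 : ℝ) ≤ 2)
      rw [Real.rpow_two] at this; linarith
  have h2 : 1 + y ^ 2 ≤ 2 * Real.exp y := by nlinarith [Real.quadratic_le_exp_of_nonneg hy.le]
  have h3 : 0 < y ^ (7 / 4 : ℝ) := Real.rpow_pos_of_pos hy _
  rw [Real.rpow_neg hy.le, Real.exp_neg, inv_le_comm₀ (Real.exp_pos _) (by positivity)]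
  rw [mul_inv, inv_inv, ← div_eq_inv_mul, div_le_iff₀ two_pos]
  linarith

/-- The first bound has an integrable square root at small times, the second at large times. -/
lemma exists_dcosNormSq_le : ∃ C : ℝ, 0 < C ∧ ∀ s : ℝ, 0 < s →
    dcosNormSq s ≤ C * s ^ (-(7 / 4) : ℝ) ∧ dcosNormSq s ≤ C * (s⁻¹ ^ 2) ^ 2 := by
  have hpi := Real.pi_gt_three
  have hsum1 : Summable fun n : ℤ => |(n:ℝ)| ^ (-(3 / 2) : ℝ) :=
    Real.summable_abs_int_rpow (by norm_num)
  have hsum2 : Summable fun n : ℤ => 1 / |(n:ℝ)| ^ 6 := summable_one_div_abs_pow (by norm_num)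
  set C₁ := 8 * Real.pi ^ 2 * ∑' n : ℤ, |(n:ℝ)| ^ (-(3 / 2) : ℝ) with hC₁
  set C₂ := (2 * Real.pi) ^ 2 * ∑' n : ℤ, 1 / |(n:ℝ)| ^ 6 with hC₂
  have h1 : 0 ≤ C₁ := mul_nonneg (by positivity) (tsum_nonneg fun n => by positivity)
  have h2 : 0 ≤ C₂ := mul_nonneg (by positivity) (tsum_nonneg fun n => by positivity)
  refine ⟨C₁ + C₂ + 1, by positivity, fun s hs => ⟨?_, ?_⟩⟩
  · have h3 : dcosNormSq s ≤ ∑' n : ℤ, 8 * Real.pi ^ 2 * |(n:ℝ)| ^ (-(3 / 2) : ℝ) *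
        s ^ (-(7 / 4) : ℝ) := by
      refine (summable_dcosNormSq hs).tsum_le_tsum (fun n => ?_) ((hsum1.mul_left _).mul_right _)
      rcases eq_or_ne n 0 with rfl | hn
      · simp
      have hn' : 0 < |(n:ℝ)| := by simpa using hn
      have e1 : (2 * Real.pi * |(n:ℝ)| * Real.exp (-Real.pi * n ^ 2 * s)) ^ 2 =
          4 * Real.pi ^ 2 * |(n:ℝ)| ^ 2 * Real.exp (-(2 * Real.pi * (|(n:ℝ)| ^ 2 * s))) := by
        rw [mul_pow, mul_pow (2 * Real.pi), ← Real.exp_nat_mul]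
        simp only [sq_abs]; push_cast; ring_nf
      have e2 : Real.exp (-(2 * Real.pi * (|(n:ℝ)| ^ 2 * s))) ≤
          2 * (|(n:ℝ)| ^ (-(7 / 2) : ℝ) * s ^ (-(7 / 4) : ℝ)) := by
        have hp : 0 < |(n:ℝ)| ^ 2 * s := by positivity
        refine (Real.exp_le_exp.2 (neg_le_neg ?_)).trans ((exp_neg_le_rpow hp).trans_eq ?_)
        · nlinarith
        · rw [Real.mul_rpow (by positivity) hs.le, ← Real.rpow_natCast, ← Real.rpow_mul hn'.le]
          norm_num
      have e3 : |(n:ℝ)| ^ 2 * |(n:ℝ)| ^ (-(7 / 2) : ℝ) = |(n:ℝ)| ^ (-(3 / 2) : ℝ) := by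
        rw [← Real.rpow_natCast, ← Real.rpow_add hn']; norm_num
      rw [e1]
      calc _ ≤ 4 * Real.pi ^ 2 * |(n:ℝ)| ^ 2 *
            (2 * (|(n:ℝ)| ^ (-(7 / 2) : ℝ) * s ^ (-(7 / 4) : ℝ))) := by gcongr
        _ = 8 * Real.pi ^ 2 * (|(n:ℝ)| ^ 2 * |(n:ℝ)| ^ (-(7 / 2) : ℝ)) * s ^ (-(7 / 4) : ℝ) := by ring
        _ = _ := by rw [e3]
    rw [tsum_mul_right, tsum_mul_left] at h3
    refine h3.trans ?_
    gcongr
    linarith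
  · have h3 : dcosNormSq s ≤ ∑' n : ℤ, (2 * Real.pi) ^ 2 * (1 / |(n:ℝ)| ^ 6) * (s⁻¹ ^ 2) ^ 2 := by
      refine (summable_dcosNormSq hs).tsum_le_tsum (fun n => ?_) ((hsum2.mul_left _).mul_right _)
      have e1 := abs_int_mul_exp_le n hs
      calc _ = (2 * Real.pi) ^ 2 * (|(n:ℝ)| * Real.exp (-Real.pi * n ^ 2 * s)) ^ 2 := by ring
        _ ≤ (2 * Real.pi) ^ 2 * ((1 / |(n:ℝ)| ^ 3) * s⁻¹ ^ 2) ^ 2 := by gcongr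
        _ = _ := by ring
    rw [tsum_mul_right, tsum_mul_left] at h3
    refine h3.trans ?_
    gcongr
    linarith

/-- The derivative of the heat kernel is integrable in space-time. -/
lemma lintegral_dheat_lt_top (i : Fin 2) :
    ∫⁻ x : T2, ∫⁻ t in Ioi (0:ℝ), ENNReal.ofReal |dheat i t x| < ⊤ := by
  obtain ⟨C, hC, hb⟩ := exists_dcosNormSq_le
  have hpi := Real.pi_gt_three
  have hm : Measurable fun p : T2 × ℝ => ENNReal.ofReal |dheat i p.2 p.1| :=
    ((measurable_dheat i).comp measurable_swap).abs.ennreal_ofReal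
  rw [lintegral_lintegral_swap hm.aemeasurable]
  have h1 : ∀ t, 0 < t → ∫⁻ x, ENNReal.ofReal |dheat i t x| ≤
      ENNReal.ofReal (√(dcosNormSq (4 * Real.pi * t))) := by
    intro t ht
    have hs : 0 < 4 * Real.pi * t := by positivity
    have hi : Integrable (fun x => |dheat i t x|) (volume : Measure T2) := by
      refine Integrable.of_bound
        ((measurable_dheat i).comp measurable_prodMk_left).abs.aestronglyMeasurable
        (∑' k : Fin 2 → ℤ, ‖(2 * Real.pi * Complex.I * k i * Real.exp (-(lam k * t)) : ℂ)‖)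
        (Eventually.of_forall fun x => ?_)
      rw [Real.norm_eq_abs, abs_abs, ← Real.norm_eq_abs]
      rw [← Complex.norm_real, ← (hasSum_dheat ht i x).tsum_eq]
      refine tsum_of_norm_bounded (summable_dheat ht i).hasSum fun k => ?_
      rw [norm_mul, norm_ch, mul_one]
    rw [← ofReal_integral_eq_lintegral_ofReal hi (Eventually.of_forall fun x => abs_nonneg _)]
    exact ENNReal.ofReal_le_ofReal (integral_abs_dheat_le i ht)
  have hts : ∀ t : ℝ, 0 < t → t ≤ 4 * Real.pi * t := fun t ht => by nlinarith
  have h2 : ∀ t, 0 < t → √(dcosNormSq (4 * Real.pi * t)) ≤ √C * t ^ (-(7 / 8) : ℝ) := by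
    intro t ht
    have h3 := (hb (4 * Real.pi * t) (by positivity)).1
    have h4 : (4 * Real.pi * t) ^ (-(7 / 4) : ℝ) ≤ t ^ (-(7 / 4) : ℝ) :=
      Real.rpow_le_rpow_of_nonpos ht (hts t ht) (by norm_num)
    have h5 : √(t ^ (-(7 / 4) : ℝ)) = t ^ (-(7 / 8) : ℝ) := by
      rw [Real.sqrt_eq_rpow, ← Real.rpow_mul ht.le]; norm_num
    rw [← h5, ← Real.sqrt_mul hC.le]
    exact Real.sqrt_le_sqrt (h3.trans (by gcongr))
  have h2' : ∀ t, 0 < t → √(dcosNormSq (4 * Real.pi * t)) ≤ √C * t⁻¹ ^ 2 := by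
    intro t ht
    have h3 := (hb (4 * Real.pi * t) (by positivity)).2
    have h4 : (4 * Real.pi * t)⁻¹ ^ 2 ≤ t⁻¹ ^ 2 := by
      have := hts t ht
      gcongr
    have h5 : √((t⁻¹ ^ 2) ^ 2) = t⁻¹ ^ 2 := Real.sqrt_sq (by positivity)
    rw [← h5, ← Real.sqrt_mul hC.le]
    exact Real.sqrt_le_sqrt (h3.trans (by gcongr))
  -- Up to time one the bound `t^(-7/8)` is integrable; after it `t⁻²` is.
  rw [← Ioc_union_Ioi_eq_Ioi zero_le_one, lintegral_union measurableSet_Ioi (Ioc_disjoint_Ioi le_rfl)]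
  refine ENNReal.add_lt_top.2 ⟨?_, ?_⟩
  · have hi : IntegrableOn (fun t : ℝ => √C * t ^ (-(7 / 8) : ℝ)) (Ioc 0 1) := by
      have := (intervalIntegral.intervalIntegrable_rpow' (a := 0) (b := 1)
        (r := -(7 / 8)) (by norm_num)).const_mul (√C)
      rwa [intervalIntegrable_iff_integrableOn_Ioc_of_le zero_le_one] at this
    exact (setLIntegral_mono' measurableSet_Ioc fun t ht =>
      (h1 t ht.1).trans (ENNReal.ofReal_le_ofReal (h2 t ht.1))).trans_lt hi.lintegral_lt_top
  · have hi : IntegrableOn (fun t : ℝ => √C * t⁻¹ ^ 2) (Ioi 1) :=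
      (integrableOn_inv_sq_Ioi one_pos).const_mul _
    exact (setLIntegral_mono' measurableSet_Ioi fun t ht =>
      (h1 t (one_pos.trans ht)).trans (ENNReal.ofReal_le_ofReal (h2' t (one_pos.trans ht)))).trans_lt
      hi.lintegral_lt_top

end BiotSavartKernel

/-! ## The nonlinearity in Fourier variables -/

section Nonlinearity

attribute [local irreducible] dheat heatKernel

/-- With `D` the density, `D(x) D(y) ≤ D(x)² + D(y)²` decouples the two variables. Translation
invariance then integrates `Φ` out separately in each term, so an `L²` density makes every
integrable kernel integrable for the product measure. -/
lemma lintegral_prod_sub_lt_top {γ : PT2} (hw : wsq γ ≠ ⊤) {Φ : T2 → ℝ≥0∞} (hΦ : Measurable Φ)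
    (hfin : ∫⁻ z, Φ z < ⊤) :
    ∫⁻ p, Φ (p.1 - p.2) ∂((γ : Measure T2).prod (γ : Measure T2)) < ⊤ := by
  obtain ⟨hac, hL2, -⟩ := density_of_wsq hw
  obtain ⟨D, hDm, hγ, hD2⟩ : ∃ D : T2 → ℝ≥0∞, Measurable D ∧
      (γ : Measure T2) = volume.withDensity D ∧ ∫⁻ x, D x ^ 2 < ⊤ := by
    refine ⟨fun x => ENNReal.ofReal (density γ x), (measurable_density γ).ennreal_ofReal,
      withDensity_density hac, ?_⟩
    have h := (hL2.integrable_sq).lintegral_lt_top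
    simpa only [ENNReal.ofReal_pow (density_nonneg γ _)] using h
  have hsub : Measurable fun p : T2 × T2 => Φ (p.1 - p.2) :=
    hΦ.comp (measurable_fst.sub measurable_snd)
  have hx : ∀ x, Measurable fun y => Φ (x - y) := fun x => hΦ.comp (measurable_const.sub measurable_id)
  have hy : ∀ y, Measurable fun x => Φ (x - y) := fun y => hΦ.comp (measurable_id.sub measurable_const)
  rw [lintegral_prod _ hsub.aemeasurable, hγ,
    lintegral_withDensity_eq_lintegral_mul _ hDm (by
      rw [← hγ]; exact hsub.lintegral_prod_right')]
  have h1 : ∀ x, ∫⁻ y, Φ (x - y) ∂(volume.withDensity D) = ∫⁻ y, D y * Φ (x - y) := by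
    intro x
    rw [lintegral_withDensity_eq_lintegral_mul _ hDm (hx x)]
    rfl
  simp only [Pi.mul_apply, h1]
  have hle : ∀ a b : ℝ≥0∞, a * b ≤ a ^ 2 + b ^ 2 := by
    intro a b
    rcases le_total a b with h | h
    · calc a * b ≤ b * b := by gcongr
        _ ≤ _ := by rw [← sq]; exact le_add_self
    · calc a * b ≤ a * a := by gcongr
        _ ≤ _ := by rw [← sq]; exact le_self_add
  have hleft : ∀ x, ∫⁻ y, Φ (x - y) = ∫⁻ z, Φ z := fun x => lintegral_sub_left_eq_self Φ x
  have hright : ∀ y, ∫⁻ x, Φ (x - y) = ∫⁻ z, Φ z := fun y => lintegral_sub_right_eq_self Φ y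
  calc ∫⁻ x, D x * ∫⁻ y, D y * Φ (x - y)
      ≤ ∫⁻ x, ((∫⁻ y, D x ^ 2 * Φ (x - y)) + ∫⁻ y, D y ^ 2 * Φ (x - y)) := by
        refine lintegral_mono fun x => ?_
        rw [← lintegral_const_mul _ (hDm.fun_mul (hx x)),
          ← lintegral_add_left ((hx x).const_mul _)]
        refine lintegral_mono fun y => ?_
        dsimp only
        rw [← mul_assoc, ← add_mul]
        gcongr
        exact hle _ _
    _ = (∫⁻ x, D x ^ 2) * (∫⁻ z, Φ z) + (∫⁻ x, D x ^ 2) * (∫⁻ z, Φ z) := by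
        have hm1 : Measurable fun p : T2 × T2 => D p.1 ^ 2 * Φ (p.1 - p.2) :=
          ((hDm.comp measurable_fst).pow_const 2).mul hsub
        have hm2 : Measurable fun p : T2 × T2 => D p.2 ^ 2 * Φ (p.1 - p.2) :=
          ((hDm.comp measurable_snd).pow_const 2).mul hsub
        rw [lintegral_add_left hm1.lintegral_prod_right', lintegral_lintegral_swap
          (f := fun x y => D y ^ 2 * Φ (x - y)) hm2.aemeasurable]
        congr 1
        · rw [← lintegral_mul_const _ (hDm.pow_const 2)]
          refine lintegral_congr fun x => ?_
          dsimp only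
          rw [lintegral_const_mul _ (hx x), hleft]
        · rw [← lintegral_mul_const _ (hDm.pow_const 2)]
          refine lintegral_congr fun y => ?_
          rw [lintegral_const_mul _ (hy y), hright]
    _ < ⊤ := ENNReal.add_lt_top.2 ⟨ENNReal.mul_lt_top hD2 hfin, ENNReal.mul_lt_top hD2 hfin⟩

lemma volume_unitAddCircle_singleton (a : UnitAddCircle) : volume ({a} : Set UnitAddCircle) = 0 := by
  have h : (volume : Measure UnitAddCircle) {a} = ENNReal.ofReal (min 1 (2 * 0)) := by
    rw [← AddCircle.volume_closedBall (T := 1) (x := a) 0, Metric.closedBall_zero]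
  rw [h]; simp

instance nullSingletonClass_unitAddCircle : NullSingletonClass (volume : Measure UnitAddCircle) :=
  ⟨volume_unitAddCircle_singleton⟩

/-- The kernel formula is available only off the coordinate axes. Absolute continuity makes these
axes, and with them the diagonal, negligible. -/
lemma ae_sub_coord_ne {γ : PT2} (hac : (γ : Measure T2) ≪ volume) (i : Fin 2) :
    ∀ᵐ p ∂((γ : Measure T2).prod (γ : Measure T2)), (p.1 - p.2) i ≠ 0 := by
  have h1 : (γ : Measure T2).prod (γ : Measure T2) ≪ (volume : Measure T2).prod volume :=
    hac.prod hac
  refine h1.ae_le ?_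
  have h2 : ∀ᵐ z : T2, z i ≠ 0 := by
    have := Measure.pi_hyperplane (fun _ : Fin 2 => (volume : Measure UnitAddCircle)) i 0
    rw [ae_iff]
    simp only [not_not, ne_eq]
    exact this
  exact (quasiMeasurePreserving_sub (volume : Measure T2) volume).ae h2

/-- The Fourier coefficients of the velocity field generated by `γ`. -/
noncomputable def vel (γ : PT2) (i : Fin 2) (k : Fin 2 → ℤ) : ℂ :=
  2 * Real.pi * Complex.I * ((if i = 0 then -k 1 else k 0 : ℤ) : ℂ) * conj (fc γ k) / lam k

/-- The velocity is a rotated gradient of the inverse Laplacian, so its `L²` norm is the negative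
Sobolev norm of `γ`, mode by mode. -/
lemma norm_vel_sq (γ : PT2) (k : Fin 2 → ℤ) :
    ‖vel γ 0 k‖ ^ 2 + ‖vel γ 1 k‖ ^ 2 = fsq γ k / lam k := by
  rcases eq_or_ne k 0 with rfl | hk
  · simp [vel, fsq]
  have hl := lam_pos hk
  have h1 : ∀ m : ℤ, ‖(2 * Real.pi * Complex.I * (m : ℂ) * conj (fc γ k) / lam k : ℂ)‖ ^ 2 =
      4 * Real.pi ^ 2 * (m:ℝ) ^ 2 * ‖fc γ k‖ ^ 2 / lam k ^ 2 := by
    intro m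
    rw [← Complex.ofReal_intCast]
    simp only [norm_div, norm_mul, RCLike.norm_conj, Complex.norm_real, Complex.norm_I,
      Complex.norm_ofNat, Real.norm_eq_abs, abs_of_pos Real.pi_pos, abs_of_pos hl]
    rw [div_pow, mul_pow, mul_pow, sq_abs]; ring
  have h2 : 4 * Real.pi ^ 2 * (k 1 : ℝ) ^ 2 + 4 * Real.pi ^ 2 * (k 0 : ℝ) ^ 2 = lam k := by
    unfold lam; ring
  simp only [vel, h1, if_true, one_ne_zero, if_false, fsq, if_neg hk]
  push_cast
  rw [← add_div, neg_sq, ← add_mul, h2]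
  field_simp

lemma norm_vel_le (γ : PT2) (i : Fin 2) (k : Fin 2 → ℤ) : ‖vel γ i k‖ ^ 2 ≤ fsq γ k := by
  have h := norm_vel_sq γ k
  have h2 : fsq γ k / lam k ≤ fsq γ k := by
    rcases eq_or_ne k 0 with rfl | hk
    · simp [fsq]
    · exact div_le_self (fsq_nonneg _ _) (one_le_lam hk)
  fin_cases i
  · have := sq_nonneg ‖vel γ 1 k‖; simp only [Fin.zero_eta]; linarith
  · have := sq_nonneg ‖vel γ 0 k‖; simp only [Fin.mk_one]; linarith

/-- The contribution of the frequency `k` to the nonlinearity. -/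
noncomputable def pairTerm (f : T2 → ℝ) (γ : PT2) (k : Fin 2 → ℤ) : ℝ :=
  ∫ x, (pd 0 f x * (vel γ 0 k * ch k x).re + pd 1 f x * (vel γ 1 k * ch k x).re) ∂(γ : Measure T2)

variable {f : T2 → ℝ}

lemma integrable_pd_mul_re (hf : IsSmooth f) (μ : Measure T2) [IsFiniteMeasure μ] (i : Fin 2) (c : ℂ)
    (k : Fin 2 → ℤ) : Integrable (fun x => pd i f x * (c * ch k x).re) μ :=
  integrable_of_continuous _ ((hf.pd i).continuous.mul
    (Complex.continuous_re.comp (continuous_const.mul (continuous_ch k))))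

lemma abs_integral_pd_mul_re_le (γ : PT2) (hf : IsSmooth f) (i : Fin 2) (c : ℂ) (k : Fin 2 → ℤ) :
    |∫ x, pd i f x * (c * ch k x).re ∂(γ : Measure T2)| ≤
      ‖c‖ * ‖∫ x, (pd i f x : ℂ) * ch k x ∂(γ : Measure T2)‖ := by
  have hi : Integrable (fun x => c * ((pd i f x : ℂ) * ch k x)) (γ : Measure T2) :=
    integrable_of_continuous _ (continuous_const.mul ((Complex.continuous_ofReal.comp
      (hf.pd i).continuous).mul (continuous_ch k)))
  have h1 : ∫ x, pd i f x * (c * ch k x).re ∂(γ : Measure T2) =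
      (c * ∫ x, (pd i f x : ℂ) * ch k x ∂(γ : Measure T2)).re := by
    rw [← integral_const_mul]
    have h2 := integral_re hi
    simp only [RCLike.re_to_complex] at h2
    rw [← h2]
    refine integral_congr_ae (Eventually.of_forall fun x => ?_)
    simp; ring
  rw [h1, ← norm_mul]
  exact Complex.abs_re_le_norm _

/-- Products of coefficients are split by `2ab ≤ a² + b²`, so that each half can be summed over
frequencies by Bessel. -/
lemma abs_pairTerm_le (γ : PT2) (hf : IsSmooth f) (k : Fin 2 → ℤ) :
    |pairTerm f γ k| ≤ fsq γ k + ∑ i, ‖∫ x, (pd i f x : ℂ) * ch k x ∂(γ : Measure T2)‖ ^ 2 := by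
  rw [pairTerm, integral_add (integrable_pd_mul_re hf _ 0 _ k) (integrable_pd_mul_re hf _ 1 _ k)]
  have h0 := abs_integral_pd_mul_re_le γ hf 0 (vel γ 0 k) k
  have h1 := abs_integral_pd_mul_re_le γ hf 1 (vel γ 1 k) k
  have v0 := norm_vel_le γ 0 k
  have v1 := norm_vel_le γ 1 k
  rw [Fin.sum_univ_two]
  set a := ‖∫ x, (pd 0 f x : ℂ) * ch k x ∂(γ : Measure T2)‖
  set b := ‖∫ x, (pd 1 f x : ℂ) * ch k x ∂(γ : Measure T2)‖
  refine (abs_add_le _ _).trans ((add_le_add h0 h1).trans ?_)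
  nlinarith [sq_nonneg (‖vel γ 0 k‖ - a), sq_nonneg (‖vel γ 1 k‖ - b), sq_nonneg a, sq_nonneg b]

/-- A bound for the gradient of a smooth function. -/
lemma exists_pd_bound (hf : IsSmooth f) : ∃ M : ℝ, 0 ≤ M ∧ ∀ i x, |pd i f x| ≤ M := by
  obtain ⟨C₀, h0⟩ := isCompact_univ.exists_bound_of_continuousOn (hf.pd 0).continuous.continuousOn
  obtain ⟨C₁, h1⟩ := isCompact_univ.exists_bound_of_continuousOn (hf.pd 1).continuous.continuousOn
  refine ⟨max C₀ C₁, (norm_nonneg _).trans ((h0 0 (mem_univ _)).trans (le_max_left _ _)),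
    fun i x => ?_⟩
  fin_cases i
  · exact (h0 x (mem_univ _)).trans (le_max_left _ _)
  · exact (h1 x (mem_univ _)).trans (le_max_right _ _)

/-- Bessel's inequality for the product of the density with a bounded derivative. -/
lemma sum_norm_pd_coeff_le {γ : PT2} (hw : wsq γ ≠ ⊤) (hf : IsSmooth f) {M : ℝ}
    (hM : ∀ i x, |pd i f x| ≤ M) (i : Fin 2) (B : Finset (Fin 2 → ℤ)) :
    ∑ k ∈ B, ‖∫ x, (pd i f x : ℂ) * ch k x ∂(γ : Measure T2)‖ ^ 2 ≤
      M ^ 2 * (1 + (wsq γ).toReal) := by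
  obtain ⟨hac, hL2, hle⟩ := density_of_wsq hw
  have hd2 := hL2.integrable_sq
  have hm : AEStronglyMeasurable (fun x => density γ x * pd i f x) volume :=
    (measurable_density γ).aestronglyMeasurable.mul (hf.pd i).continuous.aestronglyMeasurable
  have hpt : ∀ x, (density γ x * pd i f x) ^ 2 ≤ M ^ 2 * density γ x ^ 2 := by
    intro x
    rw [mul_pow, mul_comm]
    refine mul_le_mul_of_nonneg_right ?_ (sq_nonneg _)
    rw [← sq_abs]; exact pow_le_pow_left₀ (abs_nonneg _) (hM i x) 2
  have hi : Integrable (fun x => (density γ x * pd i f x) ^ 2) (volume : Measure T2) := by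
    refine Integrable.mono' (hd2.const_mul (M ^ 2)) (hm.pow 2) (Eventually.of_forall fun x => ?_)
    rw [Real.norm_eq_abs, abs_of_nonneg (sq_nonneg _)]
    exact hpt x
  have h := bessel hm hi B
  have e : ∀ k, ∫ x, ((density γ x * pd i f x : ℝ) : ℂ) * ch k x =
      ∫ x, (pd i f x : ℂ) * ch k x ∂(γ : Measure T2) := by
    intro k
    rw [integral_density hac]
    refine integral_congr_ae (Eventually.of_forall fun x => ?_)
    simp only [Complex.real_smul]; push_cast; ring
  simp only [e] at h
  refine h.trans ((integral_mono hi (hd2.const_mul _) hpt).trans ?_)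
  rw [integral_const_mul]
  gcongr

lemma summable_pairTerm {γ : PT2} (hw : wsq γ ≠ ⊤) (hf : IsSmooth f) :
    Summable (fun k => |pairTerm f γ k|) := by
  obtain ⟨M, -, hM⟩ := exists_pd_bound hf
  refine summable_of_sum_le (c := (wsq γ).toReal + 2 * (M ^ 2 * (1 + (wsq γ).toReal)))
    (fun k => abs_nonneg _) fun B => ?_
  refine (Finset.sum_le_sum fun k _ => abs_pairTerm_le γ hf k).trans ?_
  rw [Finset.sum_add_distrib, Finset.sum_comm, Fin.sum_univ_two]
  have h0 := sum_norm_pd_coeff_le hw hf hM 0 B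
  have h1 := sum_norm_pd_coeff_le hw hf hM 1 B
  have h2 := sum_fsq_le hw B
  linarith

lemma tsum_abs_pairTerm_le {γ : PT2} (hw : wsq γ ≠ ⊤) (hf : IsSmooth f) {M : ℝ}
    (hM : ∀ i x, |pd i f x| ≤ M) :
    ∑' k, |pairTerm f γ k| ≤ (1 + 2 * M ^ 2) * (1 + (wsq γ).toReal) := by
  refine (summable_pairTerm hw hf).tsum_le_of_sum_le fun B => ?_
  refine (Finset.sum_le_sum fun k _ => abs_pairTerm_le γ hf k).trans ?_
  rw [Finset.sum_add_distrib, Finset.sum_comm, Fin.sum_univ_two]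
  have h0 := sum_norm_pd_coeff_le hw hf hM 0 B
  have h1 := sum_norm_pd_coeff_le hw hf hM 1 B
  have h2 := sum_fsq_le hw B
  linarith

/-! ### Heat regularisation of the nonlinearity. -/

lemma integral_pd_mul_dheat (γ : PT2) (hf : IsSmooth f) (i j : Fin 2) {t : ℝ} (ht : 0 < t) :
    HasSum (fun k => Real.exp (-(lam k * t)) * ∫ x, pd i f x *
        (2 * Real.pi * Complex.I * k j * conj (fc γ k) * ch k x).re ∂(γ : Measure T2))
      (∫ p, pd i f p.1 * dheat j t (p.1 - p.2) ∂((γ : Measure T2).prod (γ : Measure T2))) := by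
  set μ := (γ : Measure T2).prod (γ : Measure T2) with hμ
  have hc : ∀ k, Continuous fun p : T2 × T2 => ch k (p.1 - p.2) := fun k =>
    (continuous_ch k).comp (continuous_fst.sub continuous_snd)
  have hp : Continuous fun p : T2 × T2 => (pd i f p.1 : ℂ) :=
    Complex.continuous_ofReal.comp ((hf.pd i).continuous.comp continuous_fst)
  obtain ⟨M, hM0, hM⟩ := exists_pd_bound hf
  have h := hasSum_integral_of_summable_integral_norm (μ := μ)
    (F := fun k p => (pd i f p.1 : ℂ) *
      ((2 * Real.pi * Complex.I * k j * Real.exp (-(lam k * t)) : ℂ) * ch k (p.1 - p.2)))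
    (fun k => integrable_of_continuous _ (hp.mul (continuous_const.mul (hc k)))) (by
      refine Summable.of_nonneg_of_le (fun k => integral_nonneg fun x => norm_nonneg _) (fun k => ?_)
        ((summable_dheat ht j).mul_left M)
      have hpt : ∀ p : T2 × T2, ‖(pd i f p.1 : ℂ) * ((2 * Real.pi * Complex.I * k j *
          Real.exp (-(lam k * t)) : ℂ) * ch k (p.1 - p.2))‖ ≤
          M * ‖(2 * Real.pi * Complex.I * k j * Real.exp (-(lam k * t)) : ℂ)‖ := by
        intro p
        rw [norm_mul, norm_mul _ (ch k _), norm_ch, mul_one, Complex.norm_real]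
        exact mul_le_mul_of_nonneg_right (hM i p.1) (norm_nonneg _)
      refine (integral_mono (integrable_of_continuous _
        (hp.mul (continuous_const.mul (hc k))).norm) (integrable_const _) hpt).trans_eq ?_
      rw [integral_const, probReal_univ, one_smul])
  simp only [tsum_mul_left, (hasSum_dheat ht j _).tsum_eq] at h
  have h2 := Complex.hasSum_re h
  have e1 : (∫ p, (pd i f p.1 : ℂ) * (dheat j t (p.1 - p.2) : ℂ) ∂μ).re =
      ∫ p, pd i f p.1 * dheat j t (p.1 - p.2) ∂μ := by
    simp only [← Complex.ofReal_mul]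
    rw [integral_complex_ofReal, Complex.ofReal_re]
  rw [e1] at h2
  refine h2.congr_fun fun k => ?_
  set a : ℂ := 2 * Real.pi * Complex.I * k j with ha
  have e2 : ∫ p, (pd i f p.1 : ℂ) * (a * Real.exp (-(lam k * t)) * ch k (p.1 - p.2)) ∂μ =
      Real.exp (-(lam k * t)) * ∫ x, (pd i f x : ℂ) * (a * conj (fc γ k) * ch k x) ∂(γ : Measure T2) := by
    have e3 : ∀ p : T2 × T2, (pd i f p.1 : ℂ) * (a * Real.exp (-(lam k * t)) * ch k (p.1 - p.2)) =
        (Real.exp (-(lam k * t)) * a) * (((pd i f p.1 : ℂ) * ch k p.1) * conj (ch k p.2)) := by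
      intro p; rw [ch_sub]; ring
    simp only [e3]
    rw [integral_const_mul, hμ]
    have h4 := integral_prod_mul (μ := (γ : Measure T2)) (ν := (γ : Measure T2))
      (fun x => (pd i f x : ℂ) * ch k x) (fun y => conj (ch k y))
    rw [h4, integral_conj]
    have e5 : ∀ x, (pd i f x : ℂ) * (a * conj (fc γ k) * ch k x) =
      (a * conj (fc γ k)) * ((pd i f x : ℂ) * ch k x) := fun x => by ring
    simp only [e5]
    rw [integral_const_mul]
    change _ * (_ * conj (fc γ k)) = _
    ring
  rw [e2, Complex.re_ofReal_mul]
  congr 1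
  have hi : Integrable (fun x => (pd i f x : ℂ) * (a * conj (fc γ k) * ch k x)) (γ : Measure T2) :=
    integrable_of_continuous _ ((Complex.continuous_ofReal.comp
      (hf.pd i).continuous).mul (continuous_const.mul (continuous_ch k)))
  have h6 := integral_re hi
  simp only [RCLike.re_to_complex, Complex.re_ofReal_mul] at h6
  exact h6

lemma integral_exp_lam {l : ℝ} (hl : 0 < l) : ∫ t in Ioi (0:ℝ), Real.exp (-(l * t)) = 1 / l := by
  have h1 := integral_exp_mul_Ioi (a := -l) (by linarith) 0
  simp only [neg_mul] at h1
  rw [h1]; simp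

lemma vel_mul_lam (γ : PT2) (i : Fin 2) (k : Fin 2 → ℤ) : (lam k : ℂ) * vel γ i k =
    2 * Real.pi * Complex.I * ((if i = 0 then -k 1 else k 0 : ℤ) : ℂ) * conj (fc γ k) := by
  rcases eq_or_ne k 0 with rfl | hk
  · simp [vel, lam]
  · have : (lam k : ℂ) ≠ 0 := by exact_mod_cast (lam_pos hk).ne'
    rw [vel]; field_simp

/-- The heat regularised nonlinearity. -/
noncomputable def pairHeat (f : T2 → ℝ) (γ : PT2) (t : ℝ) : ℝ :=
  ∫ p, (-(pd 0 f p.1 * dheat 1 t (p.1 - p.2)) + pd 1 f p.1 * dheat 0 t (p.1 - p.2))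
    ∂((γ : Measure T2).prod (γ : Measure T2))

lemma integrable_pd_mul_dheat (γ : PT2) (hf : IsSmooth f) (i j : Fin 2) {t : ℝ} (ht : 0 < t) :
    Integrable (fun p : T2 × T2 => pd i f p.1 * dheat j t (p.1 - p.2))
      ((γ : Measure T2).prod (γ : Measure T2)) := by
  obtain ⟨M, hM0, hM⟩ := exists_pd_bound hf
  have hm : Measurable fun p : T2 × T2 => dheat j t (p.1 - p.2) :=
    (measurable_dheat j).comp (measurable_const.prodMk (measurable_fst.sub measurable_snd))
  have hp : Measurable fun p : T2 × T2 => pd i f p.1 :=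
    (hf.pd i).continuous.measurable.comp measurable_fst
  refine Integrable.of_bound (hp.fun_mul hm).aestronglyMeasurable
    (M * ∑' k : Fin 2 → ℤ, ‖(2 * Real.pi * Complex.I * k j * Real.exp (-(lam k * t)) : ℂ)‖)
    (Eventually.of_forall fun p => ?_)
  rw [norm_mul]
  refine mul_le_mul (hM i _) ?_ (norm_nonneg _) hM0
  rw [← Complex.norm_real, ← (hasSum_dheat ht j _).tsum_eq]
  refine tsum_of_norm_bounded (summable_dheat ht j).hasSum fun k => ?_
  rw [norm_mul, norm_ch, mul_one]

/-- The factor `lam k` cancels the denominator of the velocity, which appears only after integration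
over the heat time. -/
lemma hasSum_pairHeat (γ : PT2) (hf : IsSmooth f) {t : ℝ} (ht : 0 < t) :
    HasSum (fun k => Real.exp (-(lam k * t)) * (lam k * pairTerm f γ k)) (pairHeat f γ t) := by
  have h1 := integral_pd_mul_dheat γ hf 0 1 ht
  have h2 := integral_pd_mul_dheat γ hf 1 0 ht
  have h3 : Integrable (fun p : T2 × T2 => -(pd 0 f p.1 * dheat 1 t (p.1 - p.2)))
      ((γ : Measure T2).prod (γ : Measure T2)) := (integrable_pd_mul_dheat γ hf 0 1 ht).neg
  rw [pairHeat, integral_add h3 (integrable_pd_mul_dheat γ hf 1 0 ht), integral_neg]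
  refine (h1.neg.add h2).congr_fun fun k => ?_
  have e : ∀ (i : Fin 2) x, lam k * (vel γ i k * ch k x).re =
      (2 * Real.pi * Complex.I * ((if i = 0 then -k 1 else k 0 : ℤ) : ℂ) * conj (fc γ k) *
        ch k x).re := by
    intro i x; rw [← vel_mul_lam, mul_assoc, Complex.re_ofReal_mul]
  rw [pairTerm, integral_add (integrable_pd_mul_re hf _ 0 _ k) (integrable_pd_mul_re hf _ 1 _ k),
    mul_add, ← integral_const_mul (lam k), ← integral_const_mul (lam k)]
  simp only [mul_left_comm (lam k), e]
  simp only [if_true, one_ne_zero, if_false]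
  rw [← (mul_neg (Real.exp (-(lam k * t))) (∫ x, _ ∂_)), ← mul_add, ← integral_neg]
  congr 2
  refine integral_congr_ae (Eventually.of_forall fun x => ?_)
  dsimp only
  push_cast
  rw [← mul_neg, ← Complex.neg_re]
  congr 2; ring

/-- Each nonzero mode integrates to `∫ λ exp(-λt) dt = 1`. Absolute summability of the frequency
terms justifies exchanging the sum and the time integral. -/
lemma hasSum_integral_pairHeat {γ : PT2} (hw : wsq γ ≠ ⊤) (hf : IsSmooth f) :
    HasSum (pairTerm f γ) (∫ t in Ioi (0:ℝ), pairHeat f γ t) := by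
  have hz : pairTerm f γ 0 = 0 := by simp [pairTerm, vel]
  have hint : ∀ k, IntegrableOn (fun t => Real.exp (-(lam k * t)) * (lam k * pairTerm f γ k)) (Ioi 0) := by
    intro k
    rcases eq_or_ne k 0 with rfl | hk
    · simp [hz]
    · have := integrableOn_exp_mul_Ioi (a := -lam k) (by linarith [lam_pos hk]) 0
      simp only [neg_mul] at this
      exact Integrable.mul_const this _
  have hval : ∀ (k : Fin 2 → ℤ) (c : ℝ), (k = 0 → c = 0) →
      ∫ t in Ioi (0:ℝ), Real.exp (-(lam k * t)) * (lam k * c) = c := by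
    intro k c hc
    rcases eq_or_ne k 0 with rfl | hk
    · simp [hc rfl]
    · rw [integral_mul_const, integral_exp_lam (lam_pos hk)]
      have := (lam_pos hk).ne'
      field_simp
  have h := hasSum_integral_of_summable_integral_norm
    (μ := (volume : Measure ℝ).restrict (Ioi 0))
    (F := fun k t => Real.exp (-(lam k * t)) * (lam k * pairTerm f γ k)) hint (by
      refine (summable_pairTerm hw hf).congr fun k => ?_
      simp only [norm_mul, Real.norm_eq_abs, abs_of_pos (Real.exp_pos _), abs_of_nonneg (lam_nonneg k)]
      exact (hval k _ fun hk => by rw [hk, hz, abs_zero]).symm)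
  have e1 : ∫ t in Ioi (0:ℝ), ∑' k, Real.exp (-(lam k * t)) * (lam k * pairTerm f γ k) =
      ∫ t in Ioi (0:ℝ), pairHeat f γ t :=
    setIntegral_congr_fun measurableSet_Ioi fun t ht => (hasSum_pairHeat γ hf ht).tsum_eq
  rw [e1] at h
  refine h.congr_fun fun k => (hval k _ fun hk => ?_).symm
  rw [hk, hz]

/-- The nonlinearity of a measure with `L²` density, as a series over frequencies. -/
theorem hasSum_pairR {γ : PT2} (hw : wsq γ ≠ ⊤) (hf : IsSmooth f) :
    HasSum (pairTerm f γ) (pairR f γ) := by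
  obtain ⟨hac, hL2, hle⟩ := density_of_wsq hw
  obtain ⟨M, hM0, hM⟩ := exists_pd_bound hf
  set μ := (γ : Measure T2).prod (γ : Measure T2) with hμ
  set Ψ : T2 × T2 → ℝ → ℝ := fun p t =>
    -((pd 0 f p.1 - pd 0 f p.2) * dheat 1 t (p.1 - p.2)) +
      (pd 1 f p.1 - pd 1 f p.2) * dheat 0 t (p.1 - p.2) with hΨ
  -- Off the axes, and where the heat gradient is integrable in time, the Biot–Savart kernel is a
  -- time integral. The remaining pairs form a null set.
  have hae : ∀ᵐ p ∂μ, (∑ i, (pd i f p.1 - pd i f p.2) * biotSavart (p.1 - p.2) i) =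
      ∫ t in Ioi (0:ℝ), Ψ p t := by
    have hfin : ∀ i, ∀ᵐ p ∂μ, ∫⁻ t in Ioi (0:ℝ), ENNReal.ofReal |dheat i t (p.1 - p.2)| < ⊤ := by
      intro i
      have hm : Measurable fun x : T2 => ∫⁻ t in Ioi (0:ℝ), ENNReal.ofReal |dheat i t x| :=
        Measurable.lintegral_prod_right' (f := fun p : T2 × ℝ => ENNReal.ofReal |dheat i p.2 p.1|)
          ((measurable_dheat i).comp measurable_swap).abs.ennreal_ofReal
      exact ae_lt_top (hm.comp (measurable_fst.sub measurable_snd))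
        (lintegral_prod_sub_lt_top hw hm (lintegral_dheat_lt_top i)).ne
    filter_upwards [ae_sub_coord_ne hac 0, ae_sub_coord_ne hac 1, hfin 0, hfin 1] with p h0 h1 f0 f1
    have hi : ∀ i, ∫⁻ t in Ioi (0:ℝ), ENNReal.ofReal |dheat i t (p.1 - p.2)| < ⊤ →
        IntegrableOn (fun t => dheat i t (p.1 - p.2)) (Ioi 0) := fun i h =>
      ⟨(measurable_dheat_left i _).aestronglyMeasurable, by
        rw [hasFiniteIntegral_iff_norm]; exact h⟩
    have h3 : IntegrableOn (fun t => -((pd 0 f p.1 - pd 0 f p.2) * dheat 1 t (p.1 - p.2)))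
      (Ioi 0) := ((hi 1 f1).const_mul _).neg
    simp only [hΨ]
    rw [Fin.sum_univ_two, biotSavart_eq h0 h1, integral_add h3 ((hi 0 f0).const_mul _), integral_neg, integral_const_mul, integral_const_mul]
    simp
  have hΨm : Measurable (Function.uncurry Ψ) := by
    have hd : ∀ i, Measurable fun q : (T2 × T2) × ℝ => dheat i q.2 (q.1.1 - q.1.2) := fun i =>
      (measurable_dheat i).comp (measurable_snd.prodMk
        ((measurable_fst.comp measurable_fst).sub (measurable_snd.comp measurable_fst)))
    have hp : ∀ i, Measurable fun q : (T2 × T2) × ℝ => pd i f q.1.1 - pd i f q.1.2 := fun i =>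
      ((hf.pd i).continuous.measurable.comp (measurable_fst.comp measurable_fst)).sub
        ((hf.pd i).continuous.measurable.comp (measurable_snd.comp measurable_fst))
    exact ((hp 0).fun_mul (hd 1)).fun_neg.fun_add ((hp 1).fun_mul (hd 0))
  -- Space-time integrability of the heat gradient and the `L²` density justify Fubini. Smoothness
  -- of `f` enters only through a bound on its gradient.
  have hΨi : Integrable (Function.uncurry Ψ) (μ.prod ((volume : Measure ℝ).restrict (Ioi 0))) := by
    refine ⟨hΨm.aestronglyMeasurable, ?_⟩
    rw [hasFiniteIntegral_iff_norm, lintegral_prod _ hΨm.norm.ennreal_ofReal.aemeasurable]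
    have hb : ∀ p t, ENNReal.ofReal ‖Ψ p t‖ ≤ ENNReal.ofReal (2 * M) *
        (ENNReal.ofReal |dheat 1 t (p.1 - p.2)| + ENNReal.ofReal |dheat 0 t (p.1 - p.2)|) := by
      intro p t
      rw [← ENNReal.ofReal_add (abs_nonneg _) (abs_nonneg _), ← ENNReal.ofReal_mul (by positivity)]
      refine ENNReal.ofReal_le_ofReal ?_
      have h2 : ∀ i, |pd i f p.1 - pd i f p.2| ≤ 2 * M := fun i => by
        have := abs_sub (pd i f p.1) (pd i f p.2)
        linarith [hM i p.1, hM i p.2]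
      rw [hΨ, Real.norm_eq_abs]
      refine (abs_add_le _ _).trans ?_
      rw [abs_neg, abs_mul, abs_mul, mul_add]
      gcongr
      · exact h2 0
      · exact h2 1
    have hmeas : ∀ i, Measurable fun x : T2 => ∫⁻ t in Ioi (0:ℝ), ENNReal.ofReal |dheat i t x| :=
      fun i => Measurable.lintegral_prod_right'
        (f := fun p : T2 × ℝ => ENNReal.ofReal |dheat i p.2 p.1|)
        ((measurable_dheat i).comp measurable_swap).abs.ennreal_ofReal
    have hl : ∀ i, ∀ x : T2, Measurable fun t : ℝ => ENNReal.ofReal |dheat i t x| := fun i x =>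
      (measurable_dheat_left i x).abs.ennreal_ofReal
    have hmeas1 : Measurable fun p : T2 × T2 => ∫⁻ t in Ioi (0:ℝ), ENNReal.ofReal |dheat 1 t (p.1 - p.2)| :=
      (hmeas 1).comp (measurable_fst.sub measurable_snd)
    have hle2 : ∫⁻ p, (∫⁻ t in Ioi (0:ℝ), ENNReal.ofReal ‖Ψ p t‖) ∂μ ≤
        ∫⁻ p, ENNReal.ofReal (2 * M) * ((∫⁻ t in Ioi (0:ℝ), ENNReal.ofReal |dheat 1 t (p.1 - p.2)|) +
          ∫⁻ t in Ioi (0:ℝ), ENNReal.ofReal |dheat 0 t (p.1 - p.2)|) ∂μ := by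
      refine lintegral_mono fun p => ?_
      rw [← lintegral_add_left (hl 1 _),
        ← lintegral_const_mul _ ((hl 1 _).fun_add (hl 0 _))]
      exact lintegral_mono fun t => hb p t
    refine hle2.trans_lt ?_
    rw [lintegral_const_mul' _ _ ENNReal.ofReal_ne_top,
      lintegral_add_left hmeas1]
    exact ENNReal.mul_lt_top ENNReal.ofReal_lt_top (ENNReal.add_lt_top.2
      ⟨lintegral_prod_sub_lt_top hw (hmeas 1) (lintegral_dheat_lt_top 1),
      lintegral_prod_sub_lt_top hw (hmeas 0) (lintegral_dheat_lt_top 0)⟩)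
  -- Since the heat gradient is odd, exchanging `x` and `y` makes the two halves of the symmetrised
  -- integrand equal. The resulting `2` cancels the `½` in the nonlinearity.
  have hsymm : ∀ t, 0 < t → ∫ p, Ψ p t ∂μ = 2 * pairHeat f γ t := by
    intro t ht
    set G : T2 × T2 → ℝ := fun p =>
      -(pd 0 f p.1 * dheat 1 t (p.1 - p.2)) + pd 1 f p.1 * dheat 0 t (p.1 - p.2) with hG
    have hGi : Integrable G μ := (integrable_pd_mul_dheat γ hf 0 1 ht).neg.add
      (integrable_pd_mul_dheat γ hf 1 0 ht)
    have e1 : ∀ p, Ψ p t = G p + G p.swap := by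
      intro p
      have h3 : ∀ i, dheat i t (p.2 - p.1) = -dheat i t (p.1 - p.2) := fun i => by
        rw [← dheat_neg ht, neg_sub]
      simp only [hΨ, hG, Prod.fst_swap, Prod.snd_swap, h3]; ring
    simp only [e1]
    have hGs : Integrable (fun p : T2 × T2 => G p.swap) μ := hGi.swap
    rw [integral_add hGi hGs, hμ, integral_prod_swap, pairHeat, two_mul]
  have hpair : pairR f γ = ∫ t in Ioi (0:ℝ), pairHeat f γ t := by
    have hne : ∀ᵐ p ∂μ, p ∈ {p : T2 × T2 | p.1 ≠ p.2} := by
      filter_upwards [ae_sub_coord_ne hac 0] with p hp h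
      exact hp (by rw [h]; simp)
    rw [pairR, ← hμ, Measure.restrict_eq_self_of_ae_mem hne, integral_congr_ae hae,
      integral_integral_swap hΨi, setIntegral_congr_fun measurableSet_Ioi fun t ht => hsymm t ht,
      integral_const_mul]
    ring
  rw [hpair]
  exact hasSum_integral_pairHeat hw hf

end Nonlinearity

/-! ## Mollified functions and entropy production -/

section MollifiedEntropy

namespace Mollifier

variable (J : Mollifier) {g u : T2 → ℝ}

lemma conv_eq (hg : Continuous g) (x : T2) : J.conv g x =
    ∑ m ∈ J.B, J.j m * ((∫ y, cs m y * g y) * cs m x + (∫ y, sn m y * g y) * sn m x) := by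
  have hc : ∀ m, Continuous fun y => cs m y * g y := fun m => (continuous_cs m).mul hg
  have hs : ∀ m, Continuous fun y => sn m y * g y := fun m => (continuous_sn m).mul hg
  have h1 : ∀ y, J.ker (x - y) * g y =
      ∑ m ∈ J.B, J.j m * (cs m x * (cs m y * g y) + sn m x * (sn m y * g y)) := by
    intro y; rw [ker_sub, Finset.sum_mul]
    exact Finset.sum_congr rfl fun m _ => by ring
  simp only [conv, h1]
  rw [integral_finsetSum _ fun m _ => integrable_of_continuous _
    (((continuous_const.fun_mul (hc m)).fun_add (continuous_const.fun_mul (hs m))).const_mul (J.j m))]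
  refine Finset.sum_congr rfl fun m _ => ?_
  rw [integral_const_mul, integral_add ((integrable_of_continuous _ (hc m)).const_mul _)
    ((integrable_of_continuous _ (hs m)).const_mul _), integral_const_mul, integral_const_mul]
  ring

lemma isSmooth_conv (hg : Continuous g) : IsSmooth (J.conv g) := by
  rw [funext (J.conv_eq hg)]
  exact IsSmooth.sum _ fun m _ => (((isSmooth_cs m).const_mul _).add
    ((isSmooth_sn m).const_mul _)).const_mul _

/-- Differentiation falls on the characters and returns to `g` by integrating the Fourier
coefficients by parts. -/
lemma pd_conv (hg : IsSmooth g) (i : Fin 2) (x : T2) :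
    pd i (J.conv g) x = J.conv (pd i g) x := by
  rw [funext (J.conv_eq hg.continuous), J.conv_eq (hg.pd i).continuous]
  have h1 : ∀ m, IsSmooth fun x => (∫ y, cs m y * g y) * cs m x + (∫ y, sn m y * g y) * sn m x :=
    fun m => ((isSmooth_cs m).const_mul _).add ((isSmooth_sn m).const_mul _)
  rw [IsSmooth.pd_sum _ fun m _ => (h1 m).const_mul _]
  refine Finset.sum_congr rfl fun m _ => ?_
  rw [(h1 m).pd_const_mul, ((isSmooth_cs m).const_mul _).pd_add ((isSmooth_sn m).const_mul _),
    (isSmooth_cs m).pd_const_mul, (isSmooth_sn m).pd_const_mul, pd_cs, pd_sn,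
    integral_mul_pd (isSmooth_cs m) hg, integral_mul_pd (isSmooth_sn m) hg]
  simp only [pd_cs, pd_sn, neg_mul, mul_assoc, integral_const_mul, integral_neg]
  ring

/-- Jensen's inequality, obtained from nonnegativity of the variance under the probability density
`J.ker (x - ·)`. -/
lemma conv_sq_le (hg : Continuous g) (x : T2) : J.conv g x ^ 2 ≤ J.conv (fun y => g y ^ 2) x := by
  have hk : Continuous fun y => J.ker (x - y) := J.continuous_ker.comp (continuous_const.sub continuous_id)
  set c := J.conv g x with hc
  have h0 : 0 ≤ ∫ y, J.ker (x - y) * (g y - c) ^ 2 :=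
    integral_nonneg fun y => mul_nonneg (J.ker_pos _).le (sq_nonneg _)
  have h1 : ∫ y, J.ker (x - y) * (g y - c) ^ 2 =
      J.conv (fun y => g y ^ 2) x - 2 * c * J.conv g x + c ^ 2 * ∫ y, J.ker (x - y) := by
    have i1 : Integrable fun y => J.ker (x - y) * g y ^ 2 :=
      integrable_of_continuous _ (hk.mul (hg.pow 2))
    have i2 : Integrable fun y => 2 * c * (J.ker (x - y) * g y) :=
      (integrable_of_continuous _ (hk.mul hg)).const_mul _
    have i3 : Integrable fun y => c ^ 2 * J.ker (x - y) :=
      (integrable_of_continuous _ hk).const_mul _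
    have i4 : Integrable fun y => J.ker (x - y) * g y ^ 2 - 2 * c * (J.ker (x - y) * g y) := i1.sub i2
    have : ∀ y, J.ker (x - y) * (g y - c) ^ 2 =
        J.ker (x - y) * g y ^ 2 - 2 * c * (J.ker (x - y) * g y) + c ^ 2 * J.ker (x - y) := by
      intro y; ring
    simp only [this]
    rw [integral_add i4 i3, integral_sub i1 i2, integral_const_mul, integral_const_mul]
    rfl
  rw [integral_ker_sub_right, ← hc] at h1
  linarith [sq_nonneg c]

lemma continuous_conv (hg : Continuous g) : Continuous (J.conv g) := (J.isSmooth_conv hg).continuous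

/-- A product with a mollified function is the mollified product up to a commutator. -/
lemma integral_conv_mul_le (γ : PT2) (hg : Continuous g) (hu : Continuous u) {ν : ℝ} (hν : 0 < ν) :
    ∫ x, J.conv g x * u x ∂(γ : Measure T2) ≤ (∫ x, J.mol γ x * (g x * u x)) +
      (ν / 4 * ∫ x, J.mol γ x * g x ^ 2) +
      1 / ν * ∫ x, (∫ y, J.ker (x - y) * (u x - u y) ^ 2) ∂(γ : Measure T2) := by
  have hk : ∀ x, Continuous fun y => J.ker (x - y) := fun x =>
    J.continuous_ker.comp (continuous_const.sub continuous_id)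
  have hpt : ∀ x, J.conv g x * u x ≤ J.conv (fun y => g y * u y) x +
      (ν / 4) * J.conv (fun y => g y ^ 2) x + 1 / ν * ∫ y, J.ker (x - y) * (u x - u y) ^ 2 := by
    intro x
    have i1 : Integrable fun y => J.ker (x - y) * (g y * u y) :=
      integrable_of_continuous _ ((hk x).mul (hg.mul hu))
    have i2 : Integrable fun y => ν / 4 * (J.ker (x - y) * g y ^ 2) :=
      (integrable_of_continuous _ ((hk x).mul (hg.pow 2))).const_mul _
    have i3 : Integrable fun y => 1 / ν * (J.ker (x - y) * (u x - u y) ^ 2) :=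
      (integrable_of_continuous _ ((hk x).mul ((continuous_const.sub hu).pow 2))).const_mul _
    have i4 : Integrable fun y => J.ker (x - y) * (g y * u y) + ν / 4 * (J.ker (x - y) * g y ^ 2) :=
      i1.add i2
    simp only [conv]
    rw [← integral_mul_const, ← integral_const_mul, ← integral_const_mul, ← integral_add i1 i2,
      ← integral_add i4 i3]
    refine integral_mono (integrable_of_continuous _ (((hk x).mul hg).mul continuous_const))
      (i4.add i3) fun y => ?_
    -- Young's inequality as a completed square. The weight `ν/4` is small enough for the Fisher
    -- information it creates to be absorbed later.
    have h2 : g y * (u x - u y) ≤ ν / 4 * g y ^ 2 + 1 / ν * (u x - u y) ^ 2 := by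
      have h3 : ν / 4 * g y ^ 2 + 1 / ν * (u x - u y) ^ 2 - g y * (u x - u y) =
          1 / ν * (ν / 2 * g y - (u x - u y)) ^ 2 := by field_simp; ring
      have : 0 ≤ 1 / ν * (ν / 2 * g y - (u x - u y)) ^ 2 := by positivity
      linarith
    have h4 := mul_le_mul_of_nonneg_left h2 (J.ker_pos (x - y)).le
    dsimp only [Pi.add_apply]
    linarith
  have hD : Continuous fun x => ∫ y, J.ker (x - y) * (u x - u y) ^ 2 := by
    have hcc : Continuous (Function.uncurry fun x y : T2 => J.ker (x - y) * (u x - u y) ^ 2) :=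
      J.continuous_ker_sub.mul (((hu.comp continuous_fst).sub (hu.comp continuous_snd)).pow 2)
    simpa using continuous_parametric_integral_of_continuous (μ := (volume : Measure T2)) hcc
      isCompact_univ
  have i1 : Integrable (J.conv fun y => g y * u y) (γ : Measure T2) :=
    integrable_of_continuous _ (J.continuous_conv (hg.mul hu))
  have i2 : Integrable (fun x => ν / 4 * J.conv (fun y => g y ^ 2) x) (γ : Measure T2) :=
    (integrable_of_continuous _ (J.continuous_conv (hg.pow 2))).const_mul _
  have i3 : Integrable (fun x => 1 / ν * ∫ y, J.ker (x - y) * (u x - u y) ^ 2) (γ : Measure T2) :=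
    (integrable_of_continuous _ hD).const_mul _
  have i4 : Integrable (fun x => J.conv (fun y => g y * u y) x + ν / 4 * J.conv (fun y => g y ^ 2) x)
    (γ : Measure T2) := i1.add i2
  rw [integral_mol_mul γ (hg.fun_mul hu), integral_mol_mul γ (hg.fun_pow 2), ← integral_const_mul,
    ← integral_const_mul, ← integral_add i1 i2, ← integral_add i4 i3]
  exact integral_mono (integrable_of_continuous _ ((J.continuous_conv hg).mul hu)) (i4.add i3) hpt

/-- The Fisher information of a mollified measure. -/
noncomputable def info (γ : PT2) : ℝ := ∫ x, ∑ i, pd i (J.mol γ) x ^ 2 / J.mol γ x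

/-- The logarithm of a mollified measure. -/
noncomputable def logMol (γ : PT2) (x : T2) : ℝ := Real.log (J.mol γ x)

variable {J} (γ : PT2)

lemma isSmooth_logMol : IsSmooth (J.logMol γ) :=
  (isSmooth_mol γ).log fun x => (mol_pos γ x).ne'

lemma pd_logMol (i : Fin 2) (x : T2) : pd i (J.logMol γ) x = pd i (J.mol γ) x / J.mol γ x :=
  (isSmooth_mol γ).pd_log (fun x => (mol_pos γ x).ne') i x

lemma mol_mul_pd_logMol (i : Fin 2) (x : T2) :
    J.mol γ x * pd i (J.logMol γ) x = pd i (J.mol γ) x := by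
  rw [pd_logMol, mul_div_cancel₀ _ (mol_pos γ x).ne']

lemma info_eq : J.info γ = ∑ i, ∫ x, J.mol γ x * pd i (J.logMol γ) x ^ 2 := by
  have h : ∀ x, ∑ i, pd i (J.mol γ) x ^ 2 / J.mol γ x =
      ∑ i, J.mol γ x * pd i (J.logMol γ) x ^ 2 := by
    intro x
    refine Finset.sum_congr rfl fun i _ => ?_
    rw [pd_logMol]
    have := (mol_pos (J := J) γ x).ne'
    field_simp
  simp only [info, h]
  exact integral_finsetSum _ fun i _ => integrable_of_continuous _
    ((isSmooth_mol γ).continuous.mul (((isSmooth_logMol γ).pd i).continuous.pow 2))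

lemma info_nonneg : 0 ≤ J.info γ :=
  integral_nonneg fun x => Finset.sum_nonneg fun _ _ => div_nonneg (sq_nonneg _) (mol_pos γ x).le

/-- Moving the mollifier onto `γ` and integrating by parts leaves `∂ mol · ∂ log mol`, and `mol · ∂
log mol = ∂ mol`. -/
lemma integral_lap_conv_logMol :
    ∫ x, lap (J.conv (J.logMol γ)) x ∂(γ : Measure T2) = -J.info γ := by
  have hs := isSmooth_logMol (J := J) γ
  have h1 : ∀ i, pd i (J.conv (J.logMol γ)) = J.conv (pd i (J.logMol γ)) := fun i =>
    funext (J.pd_conv hs i)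
  simp only [lap, h1, J.pd_conv (hs.pd _)]
  rw [integral_finsetSum _ fun i _ => integrable_of_continuous _
    (J.continuous_conv ((hs.pd i).pd i).continuous), info_eq, ← Finset.sum_neg_distrib]
  refine Finset.sum_congr rfl fun i _ => ?_
  rw [← integral_mol_mul γ ((hs.pd i).pd i).continuous, integral_mul_pd (isSmooth_mol γ) (hs.pd i)]
  congr 1
  refine integral_congr_ae (Eventually.of_forall fun x => ?_)
  dsimp only
  rw [← mol_mul_pd_logMol]; ring

/-- Jensen's inequality moves the square inside the mollifier, which is then transferred to `γ`. -/
lemma integral_sum_pd_conv_logMol_sq_le :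
    ∫ x, ∑ i, pd i (J.conv (J.logMol γ)) x ^ 2 ∂(γ : Measure T2) ≤ J.info γ := by
  have hs := isSmooth_logMol (J := J) γ
  simp only [J.pd_conv hs]
  rw [integral_finsetSum _ fun i _ => integrable_of_continuous _
    ((J.continuous_conv (hs.pd i).continuous).fun_pow 2), info_eq]
  refine Finset.sum_le_sum fun i _ => ?_
  rw [integral_mol_mul γ ((hs.pd i).continuous.fun_pow 2)]
  exact integral_mono (integrable_of_continuous _ ((J.continuous_conv (hs.pd i).continuous).pow 2))
    (integrable_of_continuous _ (J.continuous_conv ((hs.pd i).continuous.pow 2)))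
    fun x => J.conv_sq_le (hs.pd i).continuous x

end Mollifier

/-! Real trigonometric polynomials. -/

lemma isSmooth_re_trig (B : Finset (Fin 2 → ℤ)) (β : (Fin 2 → ℤ) → ℂ) :
    IsSmooth fun x => (trig B β x).re := by
  simp only [re_trig]
  exact IsSmooth.sum _ fun k _ => ((isSmooth_cs k).const_mul _).sub ((isSmooth_sn k).const_mul _)

lemma pd_re_trig (B : Finset (Fin 2 → ℤ)) (β : (Fin 2 → ℤ) → ℂ) (i : Fin 2) (x : T2) :
    pd i (fun x => (trig B β x).re) x =
      (trig B (fun k => 2 * Real.pi * Complex.I * k i * β k) x).re := by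
  simp only [re_trig]
  rw [IsSmooth.pd_sum _ fun k _ => ((isSmooth_cs k).const_mul _).sub ((isSmooth_sn k).const_mul _)]
  refine Finset.sum_congr rfl fun k _ => ?_
  rw [((isSmooth_cs k).const_mul _).pd_sub ((isSmooth_sn k).const_mul _),
    (isSmooth_cs k).pd_const_mul, (isSmooth_sn k).pd_const_mul, pd_cs, pd_sn]
  simp
  ring

lemma trig_translate (B : Finset (Fin 2 → ℤ)) (β : (Fin 2 → ℤ) → ℂ) (x h : T2) :
    (trig B β x).re - (trig B β (x - h)).re = (trig B (fun k => β k * (1 - conj (ch k h))) x).re := by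
  rw [← Complex.sub_re]
  simp only [trig, ← Finset.sum_sub_distrib, ch_sub]
  congr 1
  exact Finset.sum_congr rfl fun k _ => by ring

end MollifiedEntropy

/-! ## The commutator estimate -/

section Commutator

/-- Cauchy–Schwarz separates the density from `v²`, and Ladyzhenskaya's inequality controls the
fourth power of `v`. The condition `a ≤ b` allows `a² + 2ab ≤ 3ab` in both factors. -/
lemma integral_sq_le_of_wsq {γ : PT2} (hw : wsq γ ≠ ⊤) {v : T2 → ℝ} (hv : IsSmooth v) {a b : ℝ}
    (ha : 0 ≤ a) (hab : a ≤ b) (h0 : ∫ x, v x ^ 2 ≤ a ^ 2) (h1 : ∀ i, ∫ x, pd i v x ^ 2 ≤ b ^ 2) :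
    ∫ x, v x ^ 2 ∂(γ : Measure T2) ≤ √(1 + (wsq γ).toReal) * (3 * a * b) := by
  obtain ⟨hac, hL2, hD⟩ := density_of_wsq hw
  have hb : 0 ≤ b := ha.trans hab
  have hvc := hv.continuous
  have hfac : ∀ i, ∫ x, (v x ^ 2 + 2 * |v x| * |pd i v x|) ≤ 3 * a * b := by
    intro i
    have hpc := (hv.pd i).continuous
    have e : ∀ x, v x ^ 2 + 2 * |v x| * |pd i v x| = v x ^ 2 + 2 * |v x * pd i v x| := by
      intro x; rw [abs_mul]; ring
    simp only [e]
    have i2 : Integrable fun x => 2 * |v x * pd i v x| :=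
      (integrable_of_continuous _ (hvc.mul hpc).abs).const_mul _
    rw [integral_add (integrable_of_continuous _ (hvc.fun_pow 2)) i2, integral_const_mul]
    have h2 := integral_mul_le_sqrt volume hvc.aestronglyMeasurable hpc.aestronglyMeasurable
      (integrable_of_continuous _ (hvc.pow 2)) (integrable_of_continuous _ (hpc.pow 2))
    have h3 : √(∫ x, v x ^ 2) ≤ a := (Real.sqrt_le_sqrt h0).trans_eq (Real.sqrt_sq ha)
    have h4 : √(∫ x, pd i v x ^ 2) ≤ b := (Real.sqrt_le_sqrt (h1 i)).trans_eq (Real.sqrt_sq hb)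
    have h5 := mul_le_mul h3 h4 (Real.sqrt_nonneg _) ha
    nlinarith [mul_le_mul_of_nonneg_left hab ha]
  have h4 : ∫ x, v x ^ 4 ≤ (3 * a * b) ^ 2 := by
    refine (integral_pow_four_le hv).trans ?_
    rw [sq]
    exact mul_le_mul (hfac 0) (hfac 1) (integral_nonneg fun x => by positivity) (by positivity)
  rw [integral_density hac]
  have i4 : Integrable fun x => (v x ^ 2) ^ 2 := integrable_of_continuous _ ((hvc.pow 2).pow 2)
  have h5 := integral_mul_le_sqrt volume hL2.1 (hvc.fun_pow 2).aestronglyMeasurable hL2.integrable_sq i4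
  have h6 : ∫ x, density γ x • v x ^ 2 = ∫ x, |density γ x * v x ^ 2| := by
    refine integral_congr_ae (Eventually.of_forall fun x => ?_)
    exact (abs_of_nonneg (mul_nonneg (density_nonneg γ x) (sq_nonneg _))).symm
  rw [h6]
  refine h5.trans (mul_le_mul (Real.sqrt_le_sqrt hD) ?_ (Real.sqrt_nonneg _) (Real.sqrt_nonneg _))
  rw [Real.sqrt_le_left (by positivity)]
  simpa only [← pow_mul] using h4

/-- The negative Sobolev norm of the part of `γ` that is removed by translation by `h`. -/
noncomputable def transl (γ : PT2) (B : Finset (Fin 2 → ℤ)) (h : T2) : ℝ :=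
  ∑ k ∈ B, fsq γ k / lam k * (2 * (1 - cs k h))

lemma norm_one_sub_conj_ch_sq (k : Fin 2 → ℤ) (h : T2) :
    ‖(1 - conj (ch k h) : ℂ)‖ ^ 2 = 2 * (1 - cs k h) := by
  have := cs_sq_add_sn_sq k h
  rw [← Complex.normSq_eq_norm_sq, Complex.normSq_apply]
  simp only [Complex.sub_re, Complex.one_re, Complex.conj_re, Complex.sub_im, Complex.one_im,
    Complex.conj_im]
  rw [cs, sn] at this
  simp only [cs]
  nlinarith

lemma two_mul_one_sub_cs_mem (k : Fin 2 → ℤ) (h : T2) :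
    0 ≤ 2 * (1 - cs k h) ∧ 2 * (1 - cs k h) ≤ 4 := by
  have := abs_le.1 (abs_cs_le k h)
  constructor <;> linarith [this.1, this.2]

lemma fsq_div_lam_nonneg (γ : PT2) (k : Fin 2 → ℤ) : 0 ≤ fsq γ k / lam k :=
  div_nonneg (fsq_nonneg _ _) (lam_nonneg _)

lemma fsq_div_lam_le (γ : PT2) (k : Fin 2 → ℤ) : fsq γ k / lam k ≤ fsq γ k := by
  rcases eq_or_ne k 0 with rfl | hk
  · simp [fsq]
  · exact div_le_self (fsq_nonneg _ _) (one_le_lam hk)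

lemma transl_nonneg (γ : PT2) (B : Finset (Fin 2 → ℤ)) (h : T2) : 0 ≤ transl γ B h :=
  Finset.sum_nonneg fun k _ => mul_nonneg (fsq_div_lam_nonneg γ k) (two_mul_one_sub_cs_mem k h).1

lemma norm_vel_sq_le (γ : PT2) (i : Fin 2) (k : Fin 2 → ℤ) : ‖vel γ i k‖ ^ 2 ≤ fsq γ k / lam k := by
  have h := norm_vel_sq γ k
  fin_cases i
  · have := sq_nonneg ‖vel γ 1 k‖; simp only [Fin.zero_eta]; linarith
  · have := sq_nonneg ‖vel γ 0 k‖; simp only [Fin.mk_one]; linarith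

/-- The truncated velocity field generated by `γ`. -/
noncomputable def velTrunc (γ : PT2) (B : Finset (Fin 2 → ℤ)) (i : Fin 2) (x : T2) : ℝ :=
  (trig B (vel γ i) x).re

lemma isSmooth_velTrunc (γ : PT2) (B : Finset (Fin 2 → ℤ)) (i : Fin 2) :
    IsSmooth (velTrunc γ B i) := isSmooth_re_trig B _

/-- The velocity of each mode is orthogonal to its frequency, so sharp truncation in Fourier space
preserves the divergence-free condition. -/
lemma sum_pd_velTrunc (γ : PT2) (B : Finset (Fin 2 → ℤ)) (x : T2) :
    pd 0 (velTrunc γ B 0) x + pd 1 (velTrunc γ B 1) x = 0 := by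
  have h : ∀ i, pd i (velTrunc γ B i) x = _ := fun i => pd_re_trig B (vel γ i) i x
  rw [h, h, ← Complex.add_re, trig, trig, ← Finset.sum_add_distrib,
    Finset.sum_eq_zero, Complex.zero_re]
  intro k _
  simp [vel]
  ring

/-- Translation estimate for the truncated velocity in the space `L²(γ)`. -/
lemma integral_velTrunc_sub_sq_le {γ : PT2} (hw : wsq γ ≠ ⊤) (B : Finset (Fin 2 → ℤ)) (i : Fin 2)
    (h : T2) : ∫ x, (velTrunc γ B i x - velTrunc γ B i (x - h)) ^ 2 ∂(γ : Measure T2) ≤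
      6 * (1 + (wsq γ).toReal) * √(transl γ B h) := by
  set W := 1 + (wsq γ).toReal with hW
  have hW0 : 0 ≤ W := by positivity
  simp only [velTrunc, trig_translate]
  set β : (Fin 2 → ℤ) → ℂ := fun k => vel γ i k * (1 - conj (ch k h)) with hβ
  have hβn : ∀ k, ‖β k‖ ^ 2 = ‖vel γ i k‖ ^ 2 * (2 * (1 - cs k h)) := fun k => by
    rw [hβ, norm_mul, mul_pow, norm_one_sub_conj_ch_sq]
  have hsum : ∑ k ∈ B, fsq γ k ≤ W := (sum_fsq_le hw B).trans (by rw [hW]; linarith)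
  have hZ : transl γ B h ≤ 4 * W := by
    calc transl γ B h ≤ ∑ k ∈ B, fsq γ k * 4 := Finset.sum_le_sum fun k _ =>
          mul_le_mul (fsq_div_lam_le γ k) (two_mul_one_sub_cs_mem k h).2
            (two_mul_one_sub_cs_mem k h).1 (fsq_nonneg _ _)
      _ ≤ 4 * W := by rw [← Finset.sum_mul]; linarith
  -- The increment is measured in `L²` by `transl`, and its gradient by four times the square sum of
  -- the Fourier coefficients of `γ`. The spectral gap gives the ordering `a ≤ b`.
  have key := integral_sq_le_of_wsq hw (isSmooth_re_trig B β) (a := √(transl γ B h)) (b := 2 * √W)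
    (Real.sqrt_nonneg _) (by
      refine Real.sqrt_le_iff.2 ⟨by positivity, ?_⟩
      rw [mul_pow, Real.sq_sqrt hW0]; linarith) (by
      rw [Real.sq_sqrt (transl_nonneg γ B h)]
      refine (integral_re_trig_sq_le B β).trans (Finset.sum_le_sum fun k _ => ?_)
      rw [hβn]
      exact mul_le_mul_of_nonneg_right (norm_vel_sq_le γ i k) (two_mul_one_sub_cs_mem k h).1) (by
      intro j
      simp only [pd_re_trig]
      refine (integral_re_trig_sq_le B _).trans ?_
      rw [mul_pow, Real.sq_sqrt hW0]
      have : ∀ k ∈ B, ‖2 * Real.pi * Complex.I * k j * β k‖ ^ 2 ≤ fsq γ k * 4 := by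
        intro k _
        rw [norm_mul, mul_pow, hβn, ← mul_assoc]
        refine mul_le_mul ?_ (two_mul_one_sub_cs_mem k h).2 (two_mul_one_sub_cs_mem k h).1
          (fsq_nonneg _ _)
        have e1 : ‖(2 * Real.pi * Complex.I * k j : ℂ)‖ ^ 2 ≤ lam k := by
          rw [← Complex.ofReal_intCast]
          simp only [norm_mul, Complex.norm_real, Complex.norm_I, Complex.norm_ofNat,
            Real.norm_eq_abs, abs_of_pos Real.pi_pos]
          rw [mul_pow, sq_abs, lam]
          have h0 := sq_nonneg (k 0 : ℝ)
          have h1 := sq_nonneg (k 1 : ℝ)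
          have hp : 0 < Real.pi ^ 2 := by positivity
          fin_cases j <;> simp <;> nlinarith [mul_nonneg hp.le h0, mul_nonneg hp.le h1]
        refine (mul_le_mul e1 (norm_vel_sq_le γ i k) (sq_nonneg _) (lam_nonneg k)).trans ?_
        rcases eq_or_ne k 0 with rfl | hk
        · simp [fsq]
        · rw [mul_div_cancel₀ _ (lam_pos hk).ne']
      refine (Finset.sum_le_sum this).trans ?_
      rw [← Finset.sum_mul]; linarith)
  refine key.trans (le_of_eq ?_)
  rw [← hW]
  have : √W * √W = W := Real.mul_self_sqrt hW0
  linear_combination (6 * √(transl γ B h)) * this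

/-- The negative Sobolev norm of the part of `γ` that is removed by the mollifier. -/
noncomputable def Mollifier.defect (J : Mollifier) (γ : PT2) : ℝ :=
  ∑' k, fsq γ k / lam k * (2 * (1 - J.mult k))

lemma Mollifier.two_mul_one_sub_mult_mem (J : Mollifier) (k : Fin 2 → ℤ) :
    0 ≤ 2 * (1 - J.mult k) ∧ 2 * (1 - J.mult k) ≤ 4 := by
  have := abs_le.1 (J.abs_mult_le k)
  constructor <;> linarith [this.1, this.2]

lemma summable_fsq {γ : PT2} (hw : wsq γ ≠ ⊤) : Summable (fsq γ) :=
  summable_of_sum_le (fsq_nonneg γ) fun B => sum_fsq_le hw B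

lemma summable_fsq_div_lam {γ : PT2} (hw : wsq γ ≠ ⊤) : Summable fun k => fsq γ k / lam k :=
  (summable_fsq hw).of_nonneg_of_le (fsq_div_lam_nonneg γ) (fsq_div_lam_le γ)

lemma Mollifier.summable_defect (J : Mollifier) {γ : PT2} (hw : wsq γ ≠ ⊤) :
    Summable fun k => fsq γ k / lam k * (2 * (1 - J.mult k)) :=
  ((summable_fsq_div_lam hw).mul_right 4).of_nonneg_of_le
    (fun k => mul_nonneg (fsq_div_lam_nonneg γ k) (J.two_mul_one_sub_mult_mem k).1)
    fun k => mul_le_mul_of_nonneg_left (J.two_mul_one_sub_mult_mem k).2 (fsq_div_lam_nonneg γ k)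

lemma continuous_transl (γ : PT2) (B : Finset (Fin 2 → ℤ)) : Continuous (transl γ B) :=
  continuous_finsetSum _ fun k _ => continuous_const.mul
    (continuous_const.mul (continuous_const.sub (continuous_cs k)))

/-- Averaging the cosine of each mode over the kernel produces its multiplier. Enlarging `B` to all
frequencies adds only nonnegative terms, so the bound is uniform in the truncation. -/
lemma Mollifier.integral_ker_mul_transl_le (J : Mollifier) {γ : PT2} (hw : wsq γ ≠ ⊤)
    (B : Finset (Fin 2 → ℤ)) : ∫ h, J.ker h * transl γ B h ≤ J.defect γ := by
  have h1 : ∫ h, J.ker h * transl γ B h = ∑ k ∈ B, fsq γ k / lam k * (2 * (1 - J.mult k)) := by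
    have hi : ∀ k, Integrable fun h => J.ker h * cs k h := fun k =>
      integrable_of_continuous _ (J.continuous_ker.mul (continuous_cs k))
    have e : ∀ h, J.ker h * transl γ B h =
        ∑ k ∈ B, (fsq γ k / lam k * 2) * (J.ker h - J.ker h * cs k h) := by
      intro h; rw [transl, Finset.mul_sum]
      exact Finset.sum_congr rfl fun k _ => by ring
    have hj : ∀ k, Integrable fun h => J.ker h - J.ker h * cs k h := fun k =>
      (integrable_of_continuous _ J.continuous_ker).sub (hi k)
    simp only [e]
    rw [integral_finsetSum _ fun k _ => (hj k).const_mul _]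
    refine Finset.sum_congr rfl fun k _ => ?_
    rw [integral_const_mul, integral_sub (integrable_of_continuous _ J.continuous_ker) (hi k),
      J.integral_ker, Mollifier.mult]
    ring
  rw [h1]
  exact (J.summable_defect hw).sum_le_tsum _ fun k _ =>
    mul_nonneg (fsq_div_lam_nonneg γ k) (J.two_mul_one_sub_mult_mem k).1

/-- Jensen's inequality for the square root under the kernel, that is, `conv_sq_le` at the origin.
-/
lemma Mollifier.integral_ker_mul_sqrt_transl_le (J : Mollifier) {γ : PT2} (hw : wsq γ ≠ ⊤)
    (B : Finset (Fin 2 → ℤ)) : ∫ h, J.ker h * √(transl γ B h) ≤ √(J.defect γ) := by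
  have hc : Continuous fun h => √(transl γ B h) := (continuous_transl γ B).sqrt
  have h := J.conv_sq_le hc 0
  simp only [Mollifier.conv, zero_sub, J.ker_neg, Real.sq_sqrt (transl_nonneg γ B _)] at h
  exact Real.le_sqrt_of_sq_le (h.trans (J.integral_ker_mul_transl_le hw B))

/-- The substitution `h = x - y` and Fubini reduce the mean square increment to an average, over the
kernel, of translation estimates at fixed `h`. -/
lemma Mollifier.integral_ker_mul_velTrunc_le (J : Mollifier) {γ : PT2} (hw : wsq γ ≠ ⊤)
    (B : Finset (Fin 2 → ℤ)) (i : Fin 2) :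
    ∫ x, (∫ y, J.ker (x - y) * (velTrunc γ B i x - velTrunc γ B i y) ^ 2) ∂(γ : Measure T2) ≤
      6 * (1 + (wsq γ).toReal) * √(J.defect γ) := by
  have hu := (isSmooth_velTrunc γ B i).continuous
  have h1 : ∀ x, ∫ y, J.ker (x - y) * (velTrunc γ B i x - velTrunc γ B i y) ^ 2 =
      ∫ h, J.ker h * (velTrunc γ B i x - velTrunc γ B i (x - h)) ^ 2 := by
    intro x
    have := integral_sub_left_eq_self
      (fun h => J.ker h * (velTrunc γ B i x - velTrunc γ B i (x - h)) ^ 2) (volume : Measure T2) x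
    simpa only [sub_sub_cancel] using this
  simp only [h1]
  have hcc : Continuous (Function.uncurry fun x h : T2 =>
      J.ker h * (velTrunc γ B i x - velTrunc γ B i (x - h)) ^ 2) :=
    (J.continuous_ker.comp continuous_snd).mul (((hu.comp continuous_fst).sub
      (hu.comp (continuous_fst.sub continuous_snd))).pow 2)
  rw [integral_integral_swap (integrable_of_continuous _ hcc)]
  simp only [integral_const_mul]
  calc ∫ h, J.ker h * ∫ x, (velTrunc γ B i x - velTrunc γ B i (x - h)) ^ 2 ∂(γ : Measure T2)
      ≤ ∫ h, 6 * (1 + (wsq γ).toReal) * (J.ker h * √(transl γ B h)) := by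
        refine integral_mono_of_nonneg (Eventually.of_forall fun h =>
          mul_nonneg (J.ker_pos h).le (integral_nonneg fun x => sq_nonneg _))
          ((integrable_of_continuous _ (J.continuous_ker.mul
            (continuous_transl γ B).sqrt)).const_mul _) (Eventually.of_forall fun h => ?_)
        dsimp only
        rw [mul_left_comm]
        exact mul_le_mul_of_nonneg_left (integral_velTrunc_sub_sq_le hw B i h) (J.ker_pos h).le
    _ ≤ _ := by
        rw [integral_const_mul]
        exact mul_le_mul_of_nonneg_left (J.integral_ker_mul_sqrt_transl_le hw B) (by positivity)

/-- The size of the commutator between the mollifier and the nonlinearity. -/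
noncomputable def Mollifier.comm (J : Mollifier) (γ : PT2) : ℝ :=
  12 * (1 + (wsq γ).toReal) * √(J.defect γ)

lemma sum_pairTerm (γ : PT2) {f : T2 → ℝ} (hf : IsSmooth f) (B : Finset (Fin 2 → ℤ)) :
    ∑ k ∈ B, pairTerm f γ k = (∫ x, pd 0 f x * velTrunc γ B 0 x ∂(γ : Measure T2)) +
      ∫ x, pd 1 f x * velTrunc γ B 1 x ∂(γ : Measure T2) := by
  have h : ∀ i, ∫ x, pd i f x * velTrunc γ B i x ∂(γ : Measure T2) =
      ∑ k ∈ B, ∫ x, pd i f x * (vel γ i k * ch k x).re ∂(γ : Measure T2) := by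
    intro i
    rw [← integral_finsetSum _ fun k _ => integrable_pd_mul_re hf _ i _ k]
    refine integral_congr_ae (Eventually.of_forall fun x => ?_)
    simp only [velTrunc, trig, Complex.re_sum, Finset.mul_sum]
  rw [h, h, ← Finset.sum_add_distrib]
  refine Finset.sum_congr rfl fun k _ => ?_
  exact integral_add (integrable_pd_mul_re hf _ 0 _ k) (integrable_pd_mul_re hf _ 1 _ k)

namespace Mollifier

variable {J : Mollifier} {γ : PT2}

/-- After the commutator estimate, the main term is the integral of `∇ mol · u`. It vanishes because
the truncated velocity is divergence-free. What remains does not depend on the set of frequencies.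
-/
lemma sum_pairTerm_conv_le (hw : wsq γ ≠ ⊤) {ν : ℝ} (hν : 0 < ν) (B : Finset (Fin 2 → ℤ)) :
    ∑ k ∈ B, pairTerm (J.conv (J.logMol γ)) γ k ≤ ν / 4 * J.info γ + 1 / ν * J.comm γ := by
  have hs := isSmooth_logMol (J := J) γ
  have hu := fun i => (isSmooth_velTrunc γ B i)
  rw [sum_pairTerm γ (J.isSmooth_conv hs.continuous)]
  simp only [J.pd_conv hs]
  have h := fun i => J.integral_conv_mul_le γ (hs.pd i).continuous (hu i).continuous hν
  have h0 : (∫ x, J.mol γ x * (pd 0 (J.logMol γ) x * velTrunc γ B 0 x)) +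
      ∫ x, J.mol γ x * (pd 1 (J.logMol γ) x * velTrunc γ B 1 x) = 0 := by
    have e : ∀ i, ∫ x, J.mol γ x * (pd i (J.logMol γ) x * velTrunc γ B i x) =
        -∫ x, J.mol γ x * pd i (velTrunc γ B i) x := by
      intro i
      rw [integral_mul_pd (isSmooth_mol γ) (hu i), neg_neg]
      simp only [← mul_assoc, mol_mul_pd_logMol]
    have ic : ∀ i, Integrable fun x => J.mol γ x * pd i (velTrunc γ B i) x := fun i =>
      integrable_of_continuous _ ((isSmooth_mol γ).continuous.mul ((hu i).pd i).continuous)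
    rw [e, e, ← neg_add, ← integral_add (ic 0) (ic 1)]
    simp only [← mul_add, sum_pd_velTrunc, mul_zero, integral_zero, neg_zero]
  have hi : J.info γ = _ := info_eq γ
  rw [Fin.sum_univ_two] at hi
  have hk := fun i => mul_le_mul_of_nonneg_left (J.integral_ker_mul_velTrunc_le hw B i)
    (one_div_pos.2 hν).le
  rw [comm, hi]
  nlinarith [h 0, h 1, h0, hk 0, hk 1]

/-- The test function that gives the entropy production. -/
noncomputable def test (J : Mollifier) (γ : PT2) (x : T2) : ℝ := 1 / 2 * J.conv (J.logMol γ) x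

lemma isSmooth_test : IsSmooth (J.test γ) :=
  (J.isSmooth_conv (isSmooth_logMol γ).continuous).const_mul _

/-- Entropy production dominates the nonlinearity up to a commutator. -/
theorem production_le (hw : wsq γ ≠ ⊤) {ν : ℝ} (hν : 0 < ν) :
    ν * (∫ x, lap (J.test γ) x ∂(γ : Measure T2)) + pairR (J.test γ) γ +
      ν * (∫ x, ∑ i, pd i (J.test γ) x ^ 2 ∂(γ : Measure T2)) ≤
      -(ν / 8 * J.info γ) + 1 / (2 * ν) * J.comm γ := by
  have hc : IsSmooth (J.conv (J.logMol γ)) := J.isSmooth_conv (isSmooth_logMol γ).continuous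
  have hpd : ∀ i, pd i (J.test γ) = fun x => 1 / 2 * pd i (J.conv (J.logMol γ)) x := fun i =>
    funext fun x => hc.pd_const_mul _ i x
  have h1 : ∫ x, lap (J.test γ) x ∂(γ : Measure T2) = 1 / 2 * -J.info γ := by
    rw [← integral_lap_conv_logMol, ← integral_const_mul]
    simp only [lap, hpd, (hc.pd _).pd_const_mul, Finset.mul_sum]
  have h2 : ∫ x, ∑ i, pd i (J.test γ) x ^ 2 ∂(γ : Measure T2) ≤ 1 / 4 * J.info γ := by
    refine le_trans (le_of_eq ?_) (mul_le_mul_of_nonneg_left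
      (integral_sum_pd_conv_logMol_sq_le (J := J) γ) (by norm_num : (0:ℝ) ≤ 1 / 4))
    rw [← integral_const_mul]
    simp only [hpd, mul_pow, Finset.mul_sum]
    norm_num
  have h3 : pairR (J.test γ) γ ≤ 1 / 2 * (ν / 4 * J.info γ + 1 / ν * J.comm γ) := by
    -- Every finite truncation obeys the same bound, so the full series does too; convergence of the
    -- velocity truncations is never needed.
    refine hasSum_le_of_sum_le (hasSum_pairR hw isSmooth_test) fun B => ?_
    have e : ∀ k, pairTerm (J.test γ) γ k = 1 / 2 * pairTerm (J.conv (J.logMol γ)) γ k := by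
      intro k
      simp only [pairTerm, hpd, ← integral_const_mul]
      congr 1; funext x; ring
    simp only [e, ← Finset.mul_sum]
    exact mul_le_mul_of_nonneg_left (sum_pairTerm_conv_le hw hν B) (by norm_num)
  have h4 := mul_le_mul_of_nonneg_left h2 hν.le
  rw [h1]
  have e : 1 / 2 * (1 / ν * J.comm γ) = 1 / (2 * ν) * J.comm γ := by field_simp
  -- The coefficients of `info` add up to `-ν/2 + ν/4 + ν/8 = -ν/8`, from the Laplacian, the
  -- quadratic term and the commutator.
  linarith

end Mollifier

end Commutator

/-! ## Step functions in time and the chain rule inequality -/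

section VariationalInequality

lemma deriv_smoothTransition_of_nonpos {u : ℝ} (hu : u ≤ 0) : deriv Real.smoothTransition u = 0 :=
  IsLocalMin.deriv_eq_zero (Eventually.of_forall fun x => by
    rw [Real.smoothTransition.zero_of_nonpos hu]; exact Real.smoothTransition.nonneg x)

lemma deriv_smoothTransition_of_one_le {u : ℝ} (hu : 1 ≤ u) : deriv Real.smoothTransition u = 0 :=
  IsLocalMax.deriv_eq_zero (Eventually.of_forall fun x => by
    rw [Real.smoothTransition.one_of_one_le hu]; exact Real.smoothTransition.le_one x)

lemma continuous_deriv_smoothTransition : Continuous (deriv Real.smoothTransition) :=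
  (Real.smoothTransition.contDiff (n := 1)).continuous_deriv le_rfl

lemma integral_deriv_smoothTransition : ∫ u in (0:ℝ)..1, deriv Real.smoothTransition u = 1 := by
  rw [intervalIntegral.integral_deriv_eq_sub
    (fun x _ => (Real.smoothTransition.contDiff (n := 1)).differentiable one_ne_zero x)
    (continuous_deriv_smoothTransition.intervalIntegrable _ _)]
  simp

/-- Pairing with a steep transition at `p`. -/
lemma tendsto_transition {F : ℝ → ℝ} (hF : Continuous F) {p T : ℝ} (h0 : 0 ≤ p) (hT : p ≤ T) :
    Tendsto (fun n : ℕ => Real.smoothTransition ((n + 1) * (T - p)) * F T -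
      ∫ r in (0:ℝ)..T, ((n + 1) * deriv Real.smoothTransition ((n + 1) * (r - p))) * F r)
      atTop (𝓝 (F T - F p)) := by
  rcases hT.eq_or_lt with rfl | hT
  · have h1 : ∀ n : ℕ, ∫ r in (0:ℝ)..p,
        (((n:ℝ) + 1) * deriv Real.smoothTransition (((n:ℝ) + 1) * (r - p))) * F r = 0 := by
      intro n
      refine intervalIntegral.integral_zero_ae (Eventually.of_forall fun r hr => ?_)
      rw [uIoc_of_le h0] at hr
      rw [deriv_smoothTransition_of_nonpos (mul_nonpos_of_nonneg_of_nonpos (by positivity)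
        (by linarith [hr.2]))]
      ring
    simp [h1]
  -- Once `1/(n+1) ≤ T - p` the transition is complete before `T`. The substitution `u = (n+1)(r-p)`
  -- turns the integral into an average of `F` just to the right of `p`.
  have key : ∀ᶠ n : ℕ in atTop, Real.smoothTransition ((n + 1) * (T - p)) * F T -
      (∫ r in (0:ℝ)..T, (((n:ℝ) + 1) * deriv Real.smoothTransition (((n:ℝ) + 1) * (r - p))) * F r) =
      F T - ∫ u in (0:ℝ)..1, deriv Real.smoothTransition u * F (p + 1 / ((n:ℝ) + 1) * u) := by
    have hl : ∀ᶠ n : ℕ in atTop, 1 / ((n:ℝ) + 1) ≤ T - p :=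
      (tendsto_one_div_add_atTop_nhds_zero_nat (𝕜 := ℝ)).eventually_le_const (sub_pos.2 hT)
    filter_upwards [hl] with n hn
    have hM : (0:ℝ) < (n:ℝ) + 1 := by positivity
    have h1 : 1 ≤ ((n:ℝ) + 1) * (T - p) := by
      rw [div_le_iff₀ hM] at hn; linarith
    rw [Real.smoothTransition.one_of_one_le h1, one_mul]
    congr 1
    set f : ℝ → ℝ := fun u => deriv Real.smoothTransition u * F (p + 1 / ((n:ℝ) + 1) * u) with hf
    have h2 := intervalIntegral.mul_integral_comp_mul_sub (a := 0) (b := T) (f := f)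
      (c := (n:ℝ) + 1) (((n:ℝ) + 1) * p)
    have hsupp : Function.support f ⊆ Ioc 0 1 := by
      intro u hu
      by_contra hc
      apply hu
      rw [mem_Ioc, not_and_or, not_lt, not_le] at hc
      rcases hc with hc | hc
      · simp [hf, deriv_smoothTransition_of_nonpos hc]
      · simp [hf, deriv_smoothTransition_of_one_le hc.le]
    have hsupp2 : Function.support f ⊆ Ioc (((n:ℝ) + 1) * 0 - ((n:ℝ) + 1) * p)
        (((n:ℝ) + 1) * T - ((n:ℝ) + 1) * p) := by
      refine hsupp.trans (Ioc_subset_Ioc ?_ ?_)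
      · have := mul_nonneg hM.le h0; linarith
      · linarith
    rw [intervalIntegral.integral_eq_integral_of_support_subset hsupp2,
      ← intervalIntegral.integral_eq_integral_of_support_subset hsupp] at h2
    rw [← h2, ← intervalIntegral.integral_const_mul]
    refine intervalIntegral.integral_congr fun r _ => ?_
    simp only [hf]
    rw [show p + 1 / ((n:ℝ) + 1) * (((n:ℝ) + 1) * r - ((n:ℝ) + 1) * p) = r by field_simp; ring,
      ← mul_sub]
    ring
  have hcont : Continuous fun s : ℝ => ∫ u in (0:ℝ)..1, deriv Real.smoothTransition u * F (p + s * u) := by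
    refine intervalIntegral.continuous_parametric_intervalIntegral_of_continuous' ?_ _ _
    exact (continuous_deriv_smoothTransition.comp continuous_snd).mul
      (hF.comp (continuous_const.add (continuous_fst.mul continuous_snd)))
  have h3 := (hcont.tendsto 0).comp (tendsto_one_div_add_atTop_nhds_zero_nat (𝕜 := ℝ))
  simp only [zero_mul, add_zero, intervalIntegral.integral_mul_const,
    integral_deriv_smoothTransition, one_mul] at h3
  exact (tendsto_const_nhds.sub h3).congr' (key.mono fun n hn => hn.symm)

/-- A quadratic form in `a`, with coefficients depending on time. -/
noncomputable def quad {ι : Type*} [Fintype ι] (V : ι → ℝ → ℝ) (K : ι → ι → ℝ → ℝ) (a : ι → ℝ)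
    (r : ℝ) : ℝ := ∑ i, a i * V i r + ∑ i, ∑ j, a i * a j * K i j r

/-! ### Variational inequalities for finitely many time-dependent coefficients. -/

section Abstract

variable {ι : Type*} [Fintype ι] {X V : ι → ℝ → ℝ} {K : ι → ι → ℝ → ℝ} {T A : ℝ}

lemma integrableOn_quad (hV : ∀ i, IntegrableOn (V i) (Ioc 0 T))
    (hK : ∀ i j, IntegrableOn (K i j) (Ioc 0 T)) {a : ι → ℝ → ℝ} {C : ℝ}
    (ha : ∀ i, AEStronglyMeasurable (a i) (volume.restrict (Ioc 0 T))) (hb : ∀ i r, |a i r| ≤ C) :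
    IntegrableOn (fun r => quad V K (fun i => a i r) r) (Ioc 0 T) := by
  refine Integrable.add (integrable_finsetSum _ fun i _ => ?_)
    (integrable_finsetSum _ fun i _ => integrable_finsetSum _ fun j _ => ?_)
  · exact (hV i).bdd_mul (ha i) (Eventually.of_forall fun r => hb i r)
  · refine (hK i j).bdd_mul (c := C * C) ((ha i).mul (ha j)) (Eventually.of_forall fun r => ?_)
    rw [norm_mul]
    exact mul_le_mul (hb i r) (hb j r) (norm_nonneg _) ((abs_nonneg _).trans (hb i r))

lemma tendsto_integral_quad (hV : ∀ i, IntegrableOn (V i) (Ioc 0 T))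
    (hK : ∀ i j, IntegrableOn (K i j) (Ioc 0 T)) {a : ℕ → ι → ℝ → ℝ} {b : ι → ℝ → ℝ} {C : ℝ}
    (ha : ∀ n i, AEStronglyMeasurable (a n i) (volume.restrict (Ioc 0 T)))
    (hb : ∀ n i r, |a n i r| ≤ C) (hlim : ∀ i, ∀ r ∈ Ioc 0 T, Tendsto (fun n => a n i r) atTop (𝓝 (b i r))) :
    Tendsto (fun n => ∫ r in Ioc 0 T, quad V K (fun i => a n i r) r) atTop
      (𝓝 (∫ r in Ioc 0 T, quad V K (fun i => b i r) r)) := by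
  refine tendsto_integral_of_dominated_convergence
    (fun r => ∑ i, C * |V i r| + ∑ i, ∑ j, C * C * |K i j r|)
    (fun n => (integrableOn_quad hV hK (ha n) (hb n)).aestronglyMeasurable)
    ((integrable_finsetSum _ fun i _ => (hV i).abs.const_mul _).add
      (integrable_finsetSum _ fun i _ => integrable_finsetSum _ fun j _ => (hK i j).abs.const_mul _))
    (fun n => Eventually.of_forall fun r => ?_) ?_
  · refine (norm_add_le _ _).trans (add_le_add ?_ ?_)
    · refine (norm_sum_le _ _).trans (Finset.sum_le_sum fun i _ => ?_)
      rw [norm_mul]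
      exact mul_le_mul_of_nonneg_right (hb n i r) (norm_nonneg _)
    · refine (norm_sum_le _ _).trans (Finset.sum_le_sum fun i _ => (norm_sum_le _ _).trans
        (Finset.sum_le_sum fun j _ => ?_))
      rw [norm_mul, norm_mul]
      exact mul_le_mul_of_nonneg_right (mul_le_mul (hb n i r) (hb n j r) (norm_nonneg _)
        ((abs_nonneg _).trans (hb n i r))) (norm_nonneg _)
  · refine (ae_restrict_iff' measurableSet_Ioc).2 (Eventually.of_forall fun r hr => ?_)
    refine Tendsto.add (tendsto_finsetSum _ fun i _ => (hlim i r hr).mul_const _)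
      (tendsto_finsetSum _ fun i _ => tendsto_finsetSum _ fun j _ =>
        ((hlim i r hr).mul (hlim j r hr)).mul_const _)

lemma tendsto_smoothTransition_mul (x : ℝ) :
    Tendsto (fun n : ℕ => Real.smoothTransition ((n + 1) * x)) atTop (𝓝 (if 0 < x then 1 else 0)) := by
  split_ifs with hx
  · refine tendsto_const_nhds.congr' ?_
    have hl : ∀ᶠ n : ℕ in atTop, 1 / ((n:ℝ) + 1) ≤ x :=
      (tendsto_one_div_add_atTop_nhds_zero_nat (𝕜 := ℝ)).eventually_le_const hx
    filter_upwards [hl] with n hn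
    rw [div_le_iff₀ (by positivity)] at hn
    rw [Real.smoothTransition.one_of_one_le (by linarith)]
  · refine tendsto_const_nhds.congr fun n => ?_
    rw [Real.smoothTransition.zero_of_nonpos (mul_nonpos_of_nonneg_of_nonpos (by positivity)
      (not_lt.1 hx))]

lemma abs_smoothTransition_sub_le (x y : ℝ) :
    |Real.smoothTransition x - Real.smoothTransition y| ≤ 1 := by
  rw [abs_le]
  constructor <;> linarith [Real.smoothTransition.nonneg x, Real.smoothTransition.nonneg y,
    Real.smoothTransition.le_one x, Real.smoothTransition.le_one y]

/-- The variational inequality for step functions of time. -/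
theorem step_le (hX : ∀ i, Continuous (X i))
    (hV : ∀ i, IntegrableOn (V i) (Ioc 0 T)) (hK : ∀ i j, IntegrableOn (K i j) (Ioc 0 T))
    (h : ∀ a : ι → ℝ → ℝ, (∀ i, ContDiff ℝ ∞ (a i)) →
      ∑ i, (a i T * X i T - a i 0 * X i 0 - ∫ r in (0:ℝ)..T, deriv (a i) r * X i r) -
        ∫ r in Ioc 0 T, quad V K (fun i => a i r) r ≤ A)
    (N : ℕ) {p : ℕ → ℝ} (hp : ∀ k, p k ∈ Icc 0 T) (α : ℕ → ι → ℝ) :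
    ∑ i, ∑ k ∈ Finset.range N, α k i * (X i (p (k + 1)) - X i (p k)) -
      ∫ r in Ioc 0 T, quad V K (fun i => ∑ k ∈ Finset.range N, α k i *
        ((if p k < r then 1 else 0) - (if p (k + 1) < r then 1 else 0))) r ≤ A := by
  set H := Real.smoothTransition with hH
  -- Step functions are approximated by smooth, increasingly steep transitions, which are admissible
  -- coefficients.
  set a : ℕ → ι → ℝ → ℝ := fun n i r => ∑ k ∈ Finset.range N, α k i *
    (H ((n + 1) * (r - p k)) - H ((n + 1) * (r - p (k + 1)))) with ha
  have hHs : ContDiff ℝ ∞ H := Real.smoothTransition.contDiff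
  have hterm : ∀ (n : ℕ) (q : ℝ), ContDiff ℝ ∞ fun r : ℝ => H (((n:ℝ) + 1) * (r - q)) := fun n q =>
    hHs.comp (contDiff_const.mul (contDiff_id.sub contDiff_const))
  have hsm : ∀ n i, ContDiff ℝ ∞ (a n i) := fun n i =>
    ContDiff.sum fun k _ => contDiff_const.mul ((hterm n _).sub (hterm n _))
  have hd : ∀ (n : ℕ) (q r : ℝ), HasDerivAt (fun r : ℝ => H (((n:ℝ) + 1) * (r - q)))
      (((n:ℝ) + 1) * deriv H (((n:ℝ) + 1) * (r - q))) r := by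
    intro n q r
    have h1 : HasDerivAt H (deriv H (((n:ℝ) + 1) * (r - q))) (((n:ℝ) + 1) * (r - q)) :=
      (hHs.differentiable (by simp) _).hasDerivAt
    have h2 : HasDerivAt (fun r : ℝ => ((n:ℝ) + 1) * (r - q)) ((n:ℝ) + 1) r := by
      simpa using ((hasDerivAt_id r).sub_const q).const_mul ((n:ℝ) + 1)
    rw [mul_comm]
    exact h1.comp r h2
  have hdc : ∀ (n : ℕ) (q : ℝ), Continuous fun r : ℝ => ((n:ℝ) + 1) * deriv H (((n:ℝ) + 1) * (r - q)) :=
    fun n q => continuous_const.mul (continuous_deriv_smoothTransition.comp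
      (continuous_const.mul (continuous_id.sub continuous_const)))
  have hbd : ∀ n i, a n i T * X i T - a n i 0 * X i 0 - ∫ r in (0:ℝ)..T, deriv (a n i) r * X i r =
      ∑ k ∈ Finset.range N, α k i *
        ((H ((n + 1) * (T - p k)) * X i T - ∫ r in (0:ℝ)..T,
            (((n:ℝ) + 1) * deriv H ((n + 1) * (r - p k))) * X i r) -
          (H ((n + 1) * (T - p (k + 1))) * X i T - ∫ r in (0:ℝ)..T,
            (((n:ℝ) + 1) * deriv H ((n + 1) * (r - p (k + 1)))) * X i r)) := by
    intro n i
    -- All transitions start at points `p k ≥ 0` and vanish to the left of them, so no boundary term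
    -- appears at time zero.
    have h0 : a n i 0 = 0 := by
      refine Finset.sum_eq_zero fun k _ => ?_
      have : ∀ k, H (((n:ℝ) + 1) * (0 - p k)) = 0 := fun k =>
        Real.smoothTransition.zero_of_nonpos (mul_nonpos_of_nonneg_of_nonpos (by positivity)
          (by linarith [(hp k).1]))
      rw [this, this, sub_zero, mul_zero]
    have h1 : ∀ r, deriv (a n i) r * X i r = ∑ k ∈ Finset.range N, α k i *
        ((((n:ℝ) + 1) * deriv H ((n + 1) * (r - p k))) * X i r -
          (((n:ℝ) + 1) * deriv H ((n + 1) * (r - p (k + 1)))) * X i r) := by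
      intro r
      have := HasDerivAt.fun_sum (u := Finset.range N) (A := fun k r => α k i *
        (H (((n:ℝ) + 1) * (r - p k)) - H (((n:ℝ) + 1) * (r - p (k + 1)))))
        fun k _ => ((hd n (p k) r).sub (hd n (p (k + 1)) r)).const_mul (α k i)
      rw [show deriv (a n i) r = _ from this.deriv, Finset.sum_mul]
      exact Finset.sum_congr rfl fun k _ => by ring
    have hi : ∀ q, IntervalIntegrable (fun r => (((n:ℝ) + 1) * deriv H ((n + 1) * (r - q))) * X i r)
        volume 0 T := fun q => ((hdc n q).mul (hX i)).intervalIntegrable _ _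
    simp only [h1]
    rw [intervalIntegral.integral_finsetSum fun k _ => ((hi _).sub (hi _)).const_mul _, h0,
      zero_mul, sub_zero]
    simp only [ha]
    rw [Finset.sum_mul, ← Finset.sum_sub_distrib]
    refine Finset.sum_congr rfl fun k _ => ?_
    rw [intervalIntegral.integral_const_mul, intervalIntegral.integral_sub (hi _) (hi _)]
    ring
  have hlim1 : Tendsto (fun n => ∑ i, (a n i T * X i T - a n i 0 * X i 0 -
      ∫ r in (0:ℝ)..T, deriv (a n i) r * X i r)) atTop
      (𝓝 (∑ i, ∑ k ∈ Finset.range N, α k i * (X i (p (k + 1)) - X i (p k)))) := by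
    simp only [hbd]
    refine tendsto_finsetSum _ fun i _ => tendsto_finsetSum _ fun k _ => Tendsto.const_mul _ ?_
    have := (tendsto_transition (hX i) (hp k).1 (hp k).2).sub
      (tendsto_transition (hX i) (hp (k + 1)).1 (hp (k + 1)).2)
    rwa [sub_sub_sub_cancel_left] at this
  have hlim2 := tendsto_integral_quad hV hK (a := a)
    (b := fun i r => ∑ k ∈ Finset.range N, α k i *
        ((if p k < r then 1 else 0) - (if p (k + 1) < r then 1 else 0)))
    (C := ∑ i, ∑ k ∈ Finset.range N, |α k i|)
    (fun n i => (hsm n i).continuous.aestronglyMeasurable)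
    (fun n i r => by
      refine le_trans ?_ (Finset.single_le_sum (f := fun i => ∑ k ∈ Finset.range N, |α k i|)
        (fun i _ => Finset.sum_nonneg fun k _ => abs_nonneg _) (Finset.mem_univ i))
      refine (Finset.abs_sum_le_sum_abs _ _).trans (Finset.sum_le_sum fun k _ => ?_)
      rw [abs_mul]
      exact mul_le_of_le_one_right (abs_nonneg _) (abs_smoothTransition_sub_le _ _))
    (fun i r _ => by
      refine tendsto_finsetSum _ fun k _ => Tendsto.const_mul _ ?_
      have := (tendsto_smoothTransition_mul (r - p k)).sub (tendsto_smoothTransition_mul (r - p (k + 1)))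
      simpa only [sub_pos] using this)
  exact le_of_tendsto (hlim1.sub hlim2) (Eventually.of_forall fun n => h (a n) (hsm n))

/-- Chain rule inequality for a convex functional along a curve of finite action. -/
theorem chain_le (hX : ∀ i, Continuous (X i))
    (hV : ∀ i, IntegrableOn (V i) (Ioc 0 T)) (hK : ∀ i j, IntegrableOn (K i j) (Ioc 0 T))
    (h : ∀ a : ι → ℝ → ℝ, (∀ i, ContDiff ℝ ∞ (a i)) →
      ∑ i, (a i T * X i T - a i 0 * X i 0 - ∫ r in (0:ℝ)..T, deriv (a i) r * X i r) -
        ∫ r in Ioc 0 T, quad V K (fun i => a i r) r ≤ A)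
    {α : ι → ℝ → ℝ} (hα : ∀ i, Continuous (α i)) {Φ : ℝ → ℝ}
    (hΦ : ∀ r r', Φ r' - Φ r ≤ ∑ i, α i r' * (X i r' - X i r)) {s t : ℝ} (hs : 0 ≤ s) (hst : s ≤ t)
    (ht : t ≤ T) : Φ t - Φ s ≤ A + ∫ r in Ioc s t, quad V K (fun i => α i r) r := by
  -- A uniform partition of `[s, t]` into `n + 1` pieces; the minimum keeps all later indices at
  -- `t`.
  set p : ℕ → ℕ → ℝ := fun n k => s + min ((k:ℝ) / (n + 1)) 1 * (t - s) with hp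
  have hp0 : ∀ n, p n 0 = s := fun n => by simp [hp]
  have hpn : ∀ n : ℕ, p n (n + 1) = t := fun n => by
    have : ((n:ℝ) + 1) / (n + 1) = 1 := div_self (by positivity)
    simp [hp, this]
  have hpm : ∀ n, Monotone (p n) := by
    intro n k l hkl
    simp only [hp]
    have : (k:ℝ) ≤ l := by exact_mod_cast hkl
    have h2 : 0 ≤ t - s := sub_nonneg.2 hst
    gcongr
  have hps : ∀ n k, p n k ∈ Icc s t := by
    intro n k
    have h2 : 0 ≤ t - s := sub_nonneg.2 hst
    have h3 : 0 ≤ min ((k:ℝ) / (n + 1)) 1 := le_min (by positivity) zero_le_one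
    have h4 : min ((k:ℝ) / (n + 1)) 1 ≤ 1 := min_le_right _ _
    constructor <;> simp only [hp] <;> nlinarith
  have hmesh : ∀ n k, p n (k + 1) - p n k ≤ (t - s) / (n + 1) := by
    intro n k
    have h2 : 0 ≤ t - s := sub_nonneg.2 hst
    have h3 : min (((k + 1 : ℕ):ℝ) / (n + 1)) 1 ≤ min ((k:ℝ) / (n + 1)) 1 + 1 / (n + 1) := by
      rw [← min_add_add_right]
      refine min_le_min ?_ (le_add_of_nonneg_right (by positivity))
      push_cast; rw [add_div]
    have h4 := mul_le_mul_of_nonneg_right h3 h2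
    simp only [hp]
    have h5 : (t - s) / ((n:ℝ) + 1) = 1 / (n + 1) * (t - s) := by ring
    rw [h5]; linarith
  set χ : ℕ → ℕ → ℝ → ℝ := fun n k r =>
    (if p n k < r then 1 else 0) - (if p n (k + 1) < r then 1 else 0) with hχ
  have hχ0 : ∀ n k r, 0 ≤ χ n k r := by
    intro n k r
    have := hpm n (Nat.le_succ k)
    simp only [hχ]
    split_ifs with h1 h2 h2 <;> norm_num
    exact absurd (this.trans_lt h2) h1
  have hχ1 : ∀ n k r, χ n k r ≠ 0 → p n k < r ∧ r ≤ p n (k + 1) := by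
    intro n k r hne
    have := hpm n (Nat.le_succ k)
    simp only [hχ] at hne
    split_ifs at hne with h1 h2 h2
    · simp at hne
    · exact ⟨h1, not_lt.1 h2⟩
    · exact absurd (this.trans_lt h2) h1
    · simp at hne
  have hχs : ∀ n r, ∑ k ∈ Finset.range (n + 1), χ n k r = (Ioc s t).indicator 1 r := by
    intro n r
    have := Finset.sum_range_sub' (fun k => if p n k < r then (1:ℝ) else 0) (n + 1)
    simp only [hχ]
    rw [this, hp0, hpn]
    by_cases h1 : s < r <;> by_cases h2 : t < r
    · simp [h1, h2]
    · simp [h1, h2, not_lt.1 h2]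
    · exact absurd (hst.trans_lt h2) h1
    · simp [h1, h2]
  obtain ⟨C, hC⟩ : ∃ C : ℝ, ∀ i, ∀ r ∈ Icc s t, |α i r| ≤ C := by
    have : ∀ i, ∃ C : ℝ, ∀ r ∈ Icc s t, ‖α i r‖ ≤ C := fun i =>
      isCompact_Icc.exists_bound_of_continuousOn (hα i).continuousOn
    choose c hc using this
    refine ⟨∑ i, |c i|, fun i r hr => (hc i r hr).trans ((le_abs_self _).trans ?_)⟩
    exact Finset.single_le_sum (f := fun i => |c i|) (fun i _ => abs_nonneg _) (Finset.mem_univ i)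
  -- The coefficients are frozen at right endpoints because the convexity hypothesis evaluates `α`
  -- at the later time.
  set a : ℕ → ι → ℝ → ℝ := fun n i r =>
    ∑ k ∈ Finset.range (n + 1), α i (p n (k + 1)) * χ n k r with ha
  have hχm : ∀ n k, Measurable (χ n k) := fun n k =>
    (Measurable.ite measurableSet_Ioi measurable_const measurable_const).sub
      (Measurable.ite measurableSet_Ioi measurable_const measurable_const)
  have hind : ∀ r, (Ioc s t).indicator (1 : ℝ → ℝ) r ≤ 1 := fun r =>
    indicator_le_self' (fun _ _ => zero_le_one) r
  have hind0 : ∀ r, 0 ≤ (Ioc s t).indicator (1 : ℝ → ℝ) r := fun r =>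
    indicator_nonneg (fun _ _ => zero_le_one) r
  have hab : ∀ n i r, |a n i r| ≤ |C| := by
    intro n i r
    calc |a n i r| ≤ ∑ k ∈ Finset.range (n + 1), |C| * χ n k r := by
          refine (Finset.abs_sum_le_sum_abs _ _).trans (Finset.sum_le_sum fun k _ => ?_)
          rw [abs_mul, abs_of_nonneg (hχ0 n k r)]
          exact mul_le_mul_of_nonneg_right ((hC i _ (hps n _)).trans (le_abs_self _)) (hχ0 n k r)
      _ ≤ |C| := by
          rw [← Finset.mul_sum, hχs]
          exact mul_le_of_le_one_right (abs_nonneg _) (hind r)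
  have hlim : ∀ i, ∀ r ∈ Ioc 0 T,
      Tendsto (fun n => a n i r) atTop (𝓝 ((Ioc s t).indicator (α i) r)) := by
    intro i r _
    rw [Metric.tendsto_atTop]
    intro ε hε
    obtain ⟨δ, hδ, hu⟩ := Metric.continuous_iff.1 (hα i) r (ε / 2) (half_pos hε)
    have hz : Tendsto (fun n : ℕ => (t - s) / ((n:ℝ) + 1)) atTop (𝓝 0) := by
      have := (tendsto_one_div_add_atTop_nhds_zero_nat (𝕜 := ℝ)).const_mul (t - s)
      simpa [div_eq_mul_inv] using this
    obtain ⟨n₀, hn₀⟩ := eventually_atTop.1 (hz.eventually_lt_const hδ)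
    refine ⟨n₀, fun n hn => ?_⟩
    have e1 : (Ioc s t).indicator (α i) r = ∑ k ∈ Finset.range (n + 1), α i r * χ n k r := by
      rw [← Finset.mul_sum, hχs]
      by_cases hr : r ∈ Ioc s t <;> simp [hr]
    rw [e1, Real.dist_eq]
    simp only [ha]
    rw [← Finset.sum_sub_distrib]
    refine lt_of_le_of_lt (b := ε / 2) ?_ (half_lt_self hε)
    calc |∑ k ∈ Finset.range (n + 1), (α i (p n (k + 1)) * χ n k r - α i r * χ n k r)|
        ≤ ∑ k ∈ Finset.range (n + 1), ε / 2 * χ n k r := by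
          refine (Finset.abs_sum_le_sum_abs _ _).trans (Finset.sum_le_sum fun k _ => ?_)
          rw [← sub_mul, abs_mul, abs_of_nonneg (hχ0 n k r)]
          rcases eq_or_ne (χ n k r) 0 with h0 | h0
          · rw [h0]; simp
          refine mul_le_mul_of_nonneg_right ?_ (hχ0 n k r)
          obtain ⟨h1, h2⟩ := hχ1 n k r h0
          refine (hu _ ?_).le
          rw [Real.dist_eq, abs_of_nonneg (sub_nonneg.2 h2)]
          have := hmesh n k
          have := hn₀ n hn
          linarith
      _ ≤ ε / 2 := by
          rw [← Finset.mul_sum, hχs]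
          exact mul_le_of_le_one_right (half_pos hε).le (hind r)
  have hl2 := tendsto_integral_quad hV hK (a := a) (b := fun i => (Ioc s t).indicator (α i))
    (fun n i => (Finset.measurable_sum _ fun k _ =>
      (hχm n k).const_mul _).aestronglyMeasurable) hab hlim
  have e2 : ∫ r in Ioc 0 T, quad V K (fun i => (Ioc s t).indicator (α i) r) r =
      ∫ r in Ioc s t, quad V K (fun i => α i r) r := by
    have e3 : ∀ r, quad V K (fun i => (Ioc s t).indicator (α i) r) r =
        (Ioc s t).indicator (fun r => quad V K (fun i => α i r) r) r := by
      intro r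
      by_cases hr : r ∈ Ioc s t <;> simp [hr, quad]
    simp only [e3]
    rw [setIntegral_indicator measurableSet_Ioc, inter_eq_right.2 (Ioc_subset_Ioc hs ht)]
  rw [e2] at hl2
  refine ge_of_tendsto' (hl2.const_add A) fun n => ?_
  have h1 := step_le hX hV hK h (n + 1) (p := p n) (fun k => Icc_subset_Icc hs ht (hps n k))
    (fun k i => α i (p n (k + 1)))
  -- The increments of `Φ` telescope, and each of them is bounded by the hypothesis on consecutive
  -- partition points.
  have h2 : Φ t - Φ s ≤
      ∑ i, ∑ k ∈ Finset.range (n + 1), α i (p n (k + 1)) * (X i (p n (k + 1)) - X i (p n k)) := by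
    rw [Finset.sum_comm]
    have := Finset.sum_range_sub (fun k => Φ (p n k)) (n + 1)
    rw [hp0, hpn] at this
    rw [← this]
    exact Finset.sum_le_sum fun k _ => hΦ _ _
  simp only [ha, hχ]
  linarith

end Abstract

end VariationalInequality

/-! ## Continuous curves of measures -/

section Curves

section Curve

variable {ρ : ℝ → PT2} (hρ : Continuous ρ)
include hρ

lemma continuous_integral_curve {f : T2 → ℝ} (hf : Continuous f) :
    Continuous fun r => ∫ x, f x ∂(ρ r : Measure T2) :=
  ProbabilityMeasure.continuous_iff_forall_continuousMap_continuous_integral.1 hρ ⟨f, hf⟩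

lemma continuous_fc_curve (k : Fin 2 → ℤ) : Continuous fun r => fc (ρ r) k := by
  have h : ∀ γ : PT2, fc γ k = ((∫ x, cs k x ∂(γ : Measure T2) : ℝ) : ℂ) +
      ((∫ x, sn k x ∂(γ : Measure T2) : ℝ) : ℂ) * Complex.I := fun γ =>
    (integral_re_add_im (𝕜 := ℂ) (integrable_ch (γ : Measure T2) k)).symm
  simp only [h]
  exact (Complex.continuous_ofReal.comp (continuous_integral_curve hρ (continuous_cs k))).add
    ((Complex.continuous_ofReal.comp (continuous_integral_curve hρ (continuous_sn k))).mul
      continuous_const)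

lemma continuous_fsq_curve (k : Fin 2 → ℤ) : Continuous fun r => fsq (ρ r) k := by
  unfold fsq
  split_ifs
  · exact continuous_const
  · exact (continuous_fc_curve hρ k).norm.pow 2

lemma measurable_wsq_curve : Measurable fun r => wsq (ρ r) :=
  Measurable.tsum fun k => (continuous_fsq_curve hρ k).measurable.ennreal_ofReal

lemma continuous_vel_curve (i : Fin 2) (k : Fin 2 → ℤ) : Continuous fun r => vel (ρ r) i k :=
  (continuous_const.mul (Complex.continuous_conj.comp (continuous_fc_curve hρ k))).div_const _

lemma continuous_pairTerm_curve {f : T2 → ℝ} (hf : IsSmooth f) (k : Fin 2 → ℤ) :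
    Continuous fun r => pairTerm f (ρ r) k := by
  have hc : ∀ i, Continuous fun x => pd i f x * cs k x := fun i =>
    (hf.pd i).continuous.mul (continuous_cs k)
  have hs : ∀ i, Continuous fun x => pd i f x * sn k x := fun i =>
    (hf.pd i).continuous.mul (continuous_sn k)
  have h : ∀ (γ : PT2) i, ∫ x, pd i f x * (vel γ i k * ch k x).re ∂(γ : Measure T2) =
      (vel γ i k).re * (∫ x, pd i f x * cs k x ∂(γ : Measure T2)) -
        (vel γ i k).im * ∫ x, pd i f x * sn k x ∂(γ : Measure T2) := by
    intro γ i
    rw [← integral_const_mul, ← integral_const_mul, ← integral_sub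
      ((integrable_of_continuous _ (hc i)).const_mul _)
      ((integrable_of_continuous _ (hs i)).const_mul _)]
    refine integral_congr_ae (Eventually.of_forall fun x => ?_)
    simp only [Complex.mul_re, cs, sn]; ring
  have h2 : ∀ γ : PT2, pairTerm f γ k = (∫ x, pd 0 f x * (vel γ 0 k * ch k x).re ∂(γ : Measure T2)) +
      ∫ x, pd 1 f x * (vel γ 1 k * ch k x).re ∂(γ : Measure T2) := fun γ =>
    integral_add (integrable_pd_mul_re hf _ 0 _ k) (integrable_pd_mul_re hf _ 1 _ k)
  simp only [h2, h]
  have h3 : ∀ i, Continuous fun r => (vel (ρ r) i k).re * (∫ x, pd i f x * cs k x ∂(ρ r : Measure T2)) -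
        (vel (ρ r) i k).im * ∫ x, pd i f x * sn k x ∂(ρ r : Measure T2) := fun i =>
    ((Complex.continuous_re.comp (continuous_vel_curve hρ i k)).mul
      (continuous_integral_curve hρ (hc i))).sub
    ((Complex.continuous_im.comp (continuous_vel_curve hρ i k)).mul
      (continuous_integral_curve hρ (hs i)))
  exact (h3 0).add (h3 1)

variable {T : ℝ} (hw : ∫⁻ r in Ioc 0 T, wsq (ρ r) ≠ ⊤)
include hw

lemma ae_wsq_ne_top : ∀ᵐ r ∂(volume.restrict (Ioc 0 T)), wsq (ρ r) ≠ ⊤ :=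
  (ae_lt_top (measurable_wsq_curve hρ) hw).mono fun _ h => h.ne

lemma integrableOn_wsq : IntegrableOn (fun r => (wsq (ρ r)).toReal) (Ioc 0 T) :=
  integrable_toReal_of_lintegral_ne_top (measurable_wsq_curve hρ).aemeasurable hw

/-- Measurability in time comes from the Fourier series, whose terms are continuous along the curve.
The bound is affine in `wsq`, which is integrable in time. -/
lemma integrableOn_pairR {f : T2 → ℝ} (hf : IsSmooth f) :
    IntegrableOn (fun r => pairR f (ρ r)) (Ioc 0 T) := by
  obtain ⟨M, -, hM⟩ := exists_pd_bound hf
  have hae := ae_wsq_ne_top hρ hw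
  have hm : AEMeasurable (fun r => pairR f (ρ r)) (volume.restrict (Ioc 0 T)) :=
    aemeasurable_of_tendsto_metrizable_ae (atTop : Filter (Finset (Fin 2 → ℤ)))
      (f := fun B r => ∑ k ∈ B, pairTerm f (ρ r) k)
      (fun B => (continuous_finsetSum _ fun k _ => continuous_pairTerm_curve hρ hf k).measurable.aemeasurable)
      (hae.mono fun r hr => hasSum_pairR hr hf)
  have hi : IntegrableOn (fun r => (1 + 2 * M ^ 2) * (1 + (wsq (ρ r)).toReal)) (Ioc 0 T) :=
    ((integrable_const _).add (integrableOn_wsq hρ hw)).const_mul _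
  refine Integrable.mono' hi hm.aestronglyMeasurable (hae.mono fun r hr => ?_)
  rw [← (hasSum_pairR hr hf).tsum_eq]
  have hs : Summable fun k => ‖pairTerm f (ρ r) k‖ := by
    simpa only [Real.norm_eq_abs] using summable_pairTerm hr hf
  refine (norm_tsum_le_tsum_norm hs).trans ?_
  simpa only [Real.norm_eq_abs] using tsum_abs_pairTerm_le hr hf hM

end Curve

/-- Linearity is read from the frequency expansion, by uniqueness of sums. -/
lemma pairR_linear {ι : Type*} [Fintype ι] {γ : PT2} (hw : wsq γ ≠ ⊤) {e : ι → T2 → ℝ}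
    (he : ∀ i, IsSmooth (e i)) (c : ι → ℝ) :
    pairR (fun x => ∑ i, c i * e i x) γ = ∑ i, c i * pairR (e i) γ := by
  have hs : IsSmooth fun x => ∑ i, c i * e i x := IsSmooth.sum _ fun i _ => (he i).const_mul _
  refine (hasSum_pairR hw hs).unique ?_
  have h := hasSum_sum (s := Finset.univ) fun i _ => (hasSum_pairR hw (he i)).mul_left (c i)
  refine h.congr_fun fun k => ?_
  have hpd : ∀ l x, pd l (fun x => ∑ i, c i * e i x) x = ∑ i, c i * pd l (e i) x := by
    intro l x
    rw [IsSmooth.pd_sum _ fun i _ => (he i).const_mul _]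
    exact Finset.sum_congr rfl fun i _ => (he i).pd_const_mul _ _ _
  simp only [pairTerm, hpd, ← integral_const_mul]
  have hi : ∀ i, Integrable (fun x => c i * (pd 0 (e i) x * (vel γ 0 k * ch k x).re +
      pd 1 (e i) x * (vel γ 1 k * ch k x).re)) (γ : Measure T2) := fun i =>
    ((integrable_pd_mul_re (he i) _ 0 _ k).add (integrable_pd_mul_re (he i) _ 1 _ k)).const_mul _
  rw [← integral_finsetSum _ fun i _ => hi i]
  refine integral_congr_ae (Eventually.of_forall fun x => ?_)
  simp only [Finset.sum_mul, ← Finset.sum_add_distrib]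
  exact Finset.sum_congr rfl fun i _ => by ring

/-! ### Test functions in a finite-dimensional span. -/

section Family

variable {ι : Type*} [Fintype ι] (ν : ℝ) (ρ : ℝ → PT2) (e : ι → T2 → ℝ)

/-- The linear part of the Hamiltonian along a curve. -/
noncomputable def linPart (i : ι) (r : ℝ) : ℝ :=
  ν * (∫ x, lap (e i) x ∂(ρ r : Measure T2)) + pairR (e i) (ρ r)

/-- The quadratic part of the Hamiltonian along a curve. -/
noncomputable def quadPart (i j : ι) (r : ℝ) : ℝ :=
  ν * ∫ x, ∑ l, pd l (e i) x * pd l (e j) x ∂(ρ r : Measure T2)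

variable {ν ρ e} (he : ∀ i, IsSmooth (e i))
include he

lemma pd_comb (c : ι → ℝ) (l : Fin 2) (x : T2) :
    pd l (fun x => ∑ i, c i * e i x) x = ∑ i, c i * pd l (e i) x := by
  rw [IsSmooth.pd_sum _ fun i _ => (he i).const_mul _]
  exact Finset.sum_congr rfl fun i _ => (he i).pd_const_mul _ _ _

lemma lap_comb (c : ι → ℝ) (x : T2) :
    lap (fun x => ∑ i, c i * e i x) x = ∑ i, c i * lap (e i) x := by
  simp only [lap, funext (pd_comb he c _), pd_comb (fun i => (he i).pd _), Finset.mul_sum]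
  rw [Finset.sum_comm]

omit [Fintype ι] he in
lemma continuous_lap {f : T2 → ℝ} (hf : IsSmooth f) : Continuous (lap f) :=
  continuous_finsetSum _ fun i _ => ((hf.pd i).pd i).continuous

lemma integral_lap_comb (γ : PT2) (c : ι → ℝ) :
    ∫ x, lap (fun x => ∑ i, c i * e i x) x ∂(γ : Measure T2) =
      ∑ i, c i * ∫ x, lap (e i) x ∂(γ : Measure T2) := by
  simp only [lap_comb he, ← integral_const_mul]
  exact integral_finsetSum _ fun i _ => (integrable_of_continuous _ (continuous_finsetSum _ fun l _ =>
    (((he i).pd l).pd l).continuous)).const_mul _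

lemma integral_sq_comb (γ : PT2) (c : ι → ℝ) :
    ∫ x, ∑ l, pd l (fun x => ∑ i, c i * e i x) x ^ 2 ∂(γ : Measure T2) =
      ∑ i, ∑ j, c i * c j * ∫ x, ∑ l, pd l (e i) x * pd l (e j) x ∂(γ : Measure T2) := by
  have hc : ∀ i j, Continuous fun x => ∑ l, pd l (e i) x * pd l (e j) x := fun i j =>
    continuous_finsetSum _ fun l _ => ((he i).pd l).continuous.mul ((he j).pd l).continuous
  have h : ∀ x, ∑ l, pd l (fun x => ∑ i, c i * e i x) x ^ 2 =
      ∑ i, ∑ j, c i * c j * ∑ l, pd l (e i) x * pd l (e j) x := by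
    intro x
    have h2 : ∀ l, pd l (fun x => ∑ i, c i * e i x) x ^ 2 =
        ∑ i, ∑ j, c i * c j * (pd l (e i) x * pd l (e j) x) := by
      intro l
      rw [pd_comb he, sq, Finset.sum_mul_sum]
      exact Finset.sum_congr rfl fun i _ => Finset.sum_congr rfl fun j _ => by ring
    simp only [h2, Finset.mul_sum]
    rw [Finset.sum_comm]
    exact Finset.sum_congr rfl fun i _ => Finset.sum_comm
  simp only [h, ← integral_const_mul]
  rw [integral_finsetSum _ fun i _ => integrable_finsetSum _ fun j _ =>
    (integrable_of_continuous _ (hc i j)).const_mul _]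
  exact Finset.sum_congr rfl fun i _ => integral_finsetSum _ fun j _ =>
    (integrable_of_continuous _ (hc i j)).const_mul _

lemma quad_eq {r : ℝ} (hw : wsq (ρ r) ≠ ⊤) (c : ι → ℝ) :
    quad (linPart ν ρ e) (quadPart ν ρ e) c r =
      ν * (∫ x, lap (fun x => ∑ i, c i * e i x) x ∂(ρ r : Measure T2)) +
        pairR (fun x => ∑ i, c i * e i x) (ρ r) +
        ν * ∫ x, ∑ l, pd l (fun x => ∑ i, c i * e i x) x ^ 2 ∂(ρ r : Measure T2) := by
  rw [integral_lap_comb he, pairR_linear hw he, integral_sq_comb he, quad]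
  simp only [linPart, quadPart, Finset.mul_sum]
  congr 1
  · rw [← Finset.sum_add_distrib]
    exact Finset.sum_congr rfl fun i _ => by ring
  · exact Finset.sum_congr rfl fun i _ => Finset.sum_congr rfl fun j _ => by ring

variable {T : ℝ} (hρ : Continuous ρ) (hw : ∫⁻ r in Ioc 0 T, wsq (ρ r) ≠ ⊤)
include hρ

omit [Fintype ι] in
lemma continuous_quadPart (i j : ι) : Continuous (quadPart ν ρ e i j) :=
  continuous_const.mul (continuous_integral_curve hρ (continuous_finsetSum _ fun l _ =>
    ((he i).pd l).continuous.mul ((he j).pd l).continuous))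

include hw

omit [Fintype ι] in
lemma integrableOn_linPart (i : ι) : IntegrableOn (linPart ν ρ e i) (Ioc 0 T) := by
  refine Integrable.add ?_ (integrableOn_pairR hρ hw (he i))
  exact (continuous_const.mul (continuous_integral_curve hρ
    (continuous_lap (he i)))).integrableOn_Ioc

omit [Fintype ι] hw in
lemma integrableOn_quadPart (i j : ι) : IntegrableOn (quadPart ν ρ e i j) (Ioc 0 T) :=
  (continuous_quadPart he hρ i j).integrableOn_Ioc

/-- The action functional on test functions with finitely many spatial modes. -/
lemma actionTest_comb (hT : 0 ≤ T) {a : ι → ℝ → ℝ} (ha : ∀ i, ContDiff ℝ ∞ (a i)) :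
    actionTest ν T ρ (fun r x => ∑ i, a i r * e i x) =
      ∑ i, (a i T * (∫ x, e i x ∂(ρ T : Measure T2)) - a i 0 * (∫ x, e i x ∂(ρ 0 : Measure T2)) -
        ∫ r in (0:ℝ)..T, deriv (a i) r * ∫ x, e i x ∂(ρ r : Measure T2)) -
        ∫ r in Ioc 0 T, quad (linPart ν ρ e) (quadPart ν ρ e) (fun i => a i r) r := by
  have hlin : ∀ (γ : PT2) (c : ι → ℝ), ∫ x, ∑ i, c i * e i x ∂(γ : Measure T2) =
      ∑ i, c i * ∫ x, e i x ∂(γ : Measure T2) := by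
    intro γ c
    simp only [← integral_const_mul]
    exact integral_finsetSum _ fun i _ => (integrable_of_continuous _ (he i).continuous).const_mul _
  have hder : ∀ r x, deriv (fun r => ∑ i, a i r * e i x) r = ∑ i, deriv (a i) r * e i x := by
    intro r x
    exact (HasDerivAt.fun_sum fun i _ =>
      (((ha i).differentiable (by simp) r).hasDerivAt.mul_const (e i x))).deriv
  have h1 : ∫ r in (0:ℝ)..T, ∫ x, deriv (fun r => ∑ i, a i r * e i x) r ∂(ρ r : Measure T2) =
      ∑ i, ∫ r in (0:ℝ)..T, deriv (a i) r * ∫ x, e i x ∂(ρ r : Measure T2) := by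
    simp only [hder, hlin]
    exact intervalIntegral.integral_finsetSum fun i _ =>
      (((ha i).continuous_deriv (by simp)).mul
        (continuous_integral_curve hρ (he i).continuous)).intervalIntegrable _ _
  have hL : Continuous fun r => ∫ x, lap (fun x => ∑ i, a i r * e i x) x ∂(ρ r : Measure T2) := by
    simp only [integral_lap_comb he]
    exact continuous_finsetSum _ fun i _ => (ha i).continuous.mul
      (continuous_integral_curve hρ (continuous_lap (he i)))
  have hK : Continuous fun r =>
      ∫ x, ∑ l, pd l (fun x => ∑ i, a i r * e i x) x ^ 2 ∂(ρ r : Measure T2) := by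
    simp only [integral_sq_comb he]
    exact continuous_finsetSum _ fun i _ => continuous_finsetSum _ fun j _ =>
      ((ha i).continuous.mul (ha j).continuous).mul
      (continuous_integral_curve hρ (continuous_finsetSum _ fun l _ =>
        ((he i).pd l).continuous.mul ((he j).pd l).continuous))
  have hae := ae_wsq_ne_top hρ hw
  have hR : IntegrableOn (fun r => pairR (fun x => ∑ i, a i r * e i x) (ρ r)) (Ioc 0 T) := by
    have h2 : IntegrableOn (fun r => ∑ i, a i r * pairR (e i) (ρ r)) (Ioc 0 T) := by
      refine integrable_finsetSum _ fun i _ => ?_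
      obtain ⟨C, hC⟩ := isCompact_Icc.exists_bound_of_continuousOn (s := Icc 0 T)
        (ha i).continuous.continuousOn
      exact (integrableOn_pairR hρ hw (he i)).bdd_mul (c := C)
        (ha i).continuous.aestronglyMeasurable ((ae_restrict_iff' measurableSet_Ioc).2
          (Eventually.of_forall fun r hr => hC r (Ioc_subset_Icc_self hr)))
    exact h2.congr (hae.mono fun r hr => (pairR_linear hr he _).symm)
  have h2 : ∫ r in Ioc 0 T, quad (linPart ν ρ e) (quadPart ν ρ e) (fun i => a i r) r =
      ν * (∫ r in (0:ℝ)..T, ∫ x, lap (fun x => ∑ i, a i r * e i x) x ∂(ρ r : Measure T2)) +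
      (∫ r in (0:ℝ)..T, pairR (fun x => ∑ i, a i r * e i x) (ρ r)) +
      ν * (∫ r in (0:ℝ)..T, ∫ x, ∑ l, pd l (fun x => ∑ i, a i r * e i x) x ^ 2 ∂(ρ r : Measure T2)) := by
    rw [integral_congr_ae (hae.mono fun r hr => quad_eq he hr _)]
    simp only [intervalIntegral.integral_of_le hT]
    have i1 : IntegrableOn (fun r => ν * ∫ x, lap (fun x => ∑ i, a i r * e i x) x ∂(ρ r : Measure T2))
      (Ioc 0 T) := (continuous_const.mul hL).integrableOn_Ioc
    have i2 : IntegrableOn (fun r => ν * (∫ x, lap (fun x => ∑ i, a i r * e i x) x ∂(ρ r : Measure T2)) +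
      pairR (fun x => ∑ i, a i r * e i x) (ρ r)) (Ioc 0 T) := i1.add hR
    rw [integral_add i2 (continuous_const.fun_mul hK).integrableOn_Ioc, integral_add i1 hR,
      integral_const_mul, integral_const_mul]
  rw [actionTest, h2, hlin, hlin, h1]
  simp only [Finset.sum_sub_distrib]
  ring

omit hρ hw in
lemma isSmoothInTime_comb {a : ι → ℝ → ℝ} (ha : ∀ i, ContDiff ℝ ∞ (a i)) :
    IsSmoothInTime fun r x => ∑ i, a i r * e i x := by
  refine ContDiff.sum fun i _ => ContDiff.mul ((ha i).comp contDiff_fst) ?_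
  exact ContDiff.comp (g := fun y : Fin 2 → ℝ => e i (toT2 y)) (he i) contDiff_snd

end Family

end Curves

/-! ## The entropy dissipation inequality -/

section Dissipation

namespace Mollifier

variable (J : Mollifier)

/-- The trigonometric functions that occur in a mollifier. -/
noncomputable def mode (i : J.B × Bool) : T2 → ℝ := if i.2 then sn i.1 else cs i.1

/-- The coefficients of the test function `J.test γ`. -/
noncomputable def coef (γ : PT2) (i : J.B × Bool) : ℝ :=
  1 / 2 * (J.j i.1 * ∫ y, J.mode i y * J.logMol γ y)

/-- The entropy of a mollified measure. -/
noncomputable def ent (γ : PT2) : ℝ := ∫ x, J.mol γ x * J.logMol γ x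

variable {J}

lemma isSmooth_mode (i : J.B × Bool) : IsSmooth (J.mode i) := by
  unfold mode; split_ifs
  · exact isSmooth_sn _
  · exact isSmooth_cs _

/-- Whatever the measure, the test function lies in the same finite-dimensional span; only its
coefficients vary in time. This is the setting of the abstract chain rule. -/
lemma test_eq (γ : PT2) : J.test γ = fun x => ∑ i, J.coef γ i * J.mode i x := by
  funext x
  rw [test, J.conv_eq (isSmooth_logMol γ).continuous, Fintype.sum_prod_type, Finset.mul_sum,
    ← Finset.sum_coe_sort J.B]
  refine Finset.sum_congr rfl fun m _ => ?_
  rw [Fintype.sum_bool]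
  simp only [coef, mode, if_true, Bool.false_eq_true, if_false]
  ring

lemma integral_test (γ γ' : PT2) : ∫ x, J.test γ' x ∂(γ : Measure T2) =
    1 / 2 * ∫ x, J.mol γ x * J.logMol γ' x := by
  rw [integral_mol_mul γ (isSmooth_logMol γ').continuous, ← integral_const_mul]
  rfl

/-- The relative entropy of the mollification of `γ` with respect to that of `γ'` is nonnegative.
Pointwise this is `log x ≤ x - 1`, and the linear terms cancel because both have mass one. -/
lemma ent_sub_le (γ γ' : PT2) : J.ent γ' - J.ent γ ≤
    (∫ x, J.mol γ' x * J.logMol γ' x) - ∫ x, J.mol γ x * J.logMol γ' x := by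
  have hm : ∀ γ, Continuous (J.mol γ) := fun γ => (isSmooth_mol γ).continuous
  have hl : ∀ γ, Continuous (J.logMol γ) := fun γ => (isSmooth_logMol γ).continuous
  have hpt : ∀ x, J.mol γ x * J.logMol γ' x + J.mol γ x ≤
      J.mol γ x * J.logMol γ x + J.mol γ' x := by
    intro x
    have h0 := mol_pos (J := J) γ x
    have h1 := mol_pos (J := J) γ' x
    have h2 := Real.log_le_sub_one_of_pos (div_pos h1 h0)
    rw [Real.log_div h1.ne' h0.ne', le_sub_iff_add_le, le_div_iff₀ h0] at h2
    simp only [logMol]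
    nlinarith
  have i1 : ∀ γ γ', Integrable fun x => J.mol γ x * J.logMol γ' x := fun γ γ' =>
    integrable_of_continuous _ ((hm γ).mul (hl γ'))
  have i2 : ∀ γ, Integrable (J.mol γ) := fun γ => integrable_of_continuous _ (hm γ)
  have h := integral_mono ((i1 γ γ').add (i2 γ)) ((i1 γ γ).add (i2 γ')) hpt
  rw [integral_add' (i1 γ γ') (i2 γ), integral_add' (i1 γ γ) (i2 γ'), integral_mol, integral_mol] at h
  simp only [ent]
  linarith

lemma half_ent_sub_le (γ γ' : PT2) : 1 / 2 * J.ent γ' - 1 / 2 * J.ent γ ≤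
    ∑ i, J.coef γ' i * ((∫ x, J.mode i x ∂(γ' : Measure T2)) - ∫ x, J.mode i x ∂(γ : Measure T2)) := by
  have h : ∀ γ : PT2, ∫ x, J.test γ' x ∂(γ : Measure T2) =
      ∑ i, J.coef γ' i * ∫ x, J.mode i x ∂(γ : Measure T2) := by
    intro γ
    simp only [test_eq, ← integral_const_mul]
    exact integral_finsetSum _ fun i _ =>
      (integrable_of_continuous _ (isSmooth_mode i).continuous).const_mul _
  simp only [mul_sub, Finset.sum_sub_distrib]
  rw [← h, ← h, integral_test, integral_test]
  linarith [ent_sub_le (J := J) γ γ']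

section Curve

variable {ρ : ℝ → PT2} (hρ : Continuous ρ)
include hρ

/-- The curve enters only through finitely many Fourier coefficients, each continuous in time. -/
lemma continuous_mol_curve : Continuous fun p : ℝ × T2 => J.mol (ρ p.1) p.2 := by
  simp only [mol_eq]
  exact continuous_finsetSum _ fun m _ => continuous_const.mul
    (((Complex.continuous_re.comp ((continuous_fc_curve hρ m).comp continuous_fst)).mul
      ((continuous_cs m).comp continuous_snd)).add
    ((Complex.continuous_im.comp ((continuous_fc_curve hρ m).comp continuous_fst)).mul
      ((continuous_sn m).comp continuous_snd)))

lemma continuous_logMol_curve : Continuous fun p : ℝ × T2 => J.logMol (ρ p.1) p.2 :=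
  (continuous_mol_curve hρ).log fun _ => (mol_pos _ _).ne'

lemma continuous_pd_mol_curve (i : Fin 2) :
    Continuous fun p : ℝ × T2 => pd i (J.mol (ρ p.1)) p.2 := by
  have h : ∀ γ x, pd i (J.mol γ) x = ∑ m ∈ J.B, J.j m * ((fc γ m).re * pd i (cs m) x +
      (fc γ m).im * pd i (sn m) x) := by
    intro γ x
    have h1 : ∀ m, IsSmooth fun x => (fc γ m).re * cs m x + (fc γ m).im * sn m x := fun m =>
      ((isSmooth_cs m).const_mul _).add ((isSmooth_sn m).const_mul _)
    rw [funext (mol_eq (J := J) γ), IsSmooth.pd_sum _ fun m _ => (h1 m).const_mul _]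
    refine Finset.sum_congr rfl fun m _ => ?_
    rw [(h1 m).pd_const_mul, ((isSmooth_cs m).const_mul _).pd_add ((isSmooth_sn m).const_mul _),
      (isSmooth_cs m).pd_const_mul, (isSmooth_sn m).pd_const_mul]
  simp only [h]
  exact continuous_finsetSum _ fun m _ => continuous_const.mul
    (((Complex.continuous_re.comp ((continuous_fc_curve hρ m).comp continuous_fst)).mul
      (((isSmooth_cs m).pd i).continuous.comp continuous_snd)).add
    ((Complex.continuous_im.comp ((continuous_fc_curve hρ m).comp continuous_fst)).mul
      (((isSmooth_sn m).pd i).continuous.comp continuous_snd)))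

lemma continuous_coef_curve (i : J.B × Bool) : Continuous fun r => J.coef (ρ r) i := by
  have h : Continuous fun r => ∫ y in univ, J.mode i y * J.logMol (ρ r) y :=
    continuous_parametric_integral_of_continuous (((isSmooth_mode i).continuous.comp
      continuous_snd).mul (continuous_logMol_curve hρ)) isCompact_univ
  simp only [Measure.restrict_univ] at h
  exact continuous_const.mul (continuous_const.mul h)

lemma continuous_info_curve : Continuous fun r => J.info (ρ r) := by
  have h : Continuous fun r => ∫ x in univ, ∑ i, pd i (J.mol (ρ r)) x ^ 2 / J.mol (ρ r) x :=
    continuous_parametric_integral_of_continuous (continuous_finsetSum _ fun i _ =>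
      ((continuous_pd_mol_curve hρ i).pow 2).div (continuous_mol_curve hρ)
        fun _ => (mol_pos _ _).ne') isCompact_univ
  simp only [Measure.restrict_univ] at h
  exact h

end Curve

/-- The bound does not depend on the mollifier, which makes it the dominating constant when the
mollifier is removed. -/
lemma defect_le (J : Mollifier) {γ : PT2} (hw : wsq γ ≠ ⊤) {S : ℝ} (hS0 : 0 ≤ S)
    (hS : sobolevSq γ ≤ ENNReal.ofReal S) : J.defect γ ≤ 4 * S := by
  have h1 : ∑' k, fsq γ k / lam k ≤ S := by
    rw [sobolevSq, ← ENNReal.ofReal_tsum_of_nonneg (fsq_div_lam_nonneg γ) (summable_fsq_div_lam hw),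
      ENNReal.ofReal_le_ofReal_iff hS0] at hS
    exact hS
  calc J.defect γ ≤ ∑' k, fsq γ k / lam k * 4 :=
        (J.summable_defect hw).tsum_le_tsum (fun k => mul_le_mul_of_nonneg_left
          (J.two_mul_one_sub_mult_mem k).2 (fsq_div_lam_nonneg γ k))
          ((summable_fsq_div_lam hw).mul_right 4)
    _ ≤ 4 * S := by rw [tsum_mul_right]; linarith

/-- Each summand tends to zero with its multiplier, and four times the negative Sobolev terms
dominate. -/
lemma tendsto_defect {J : ℕ → Mollifier} (hJ : ∀ k, Tendsto (fun n => (J n).mult k) atTop (𝓝 1))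
    {γ : PT2} (hw : wsq γ ≠ ⊤) : Tendsto (fun n => (J n).defect γ) atTop (𝓝 0) := by
  have h := tendsto_tsum_of_dominated_convergence (β := Fin 2 → ℤ) (𝓕 := atTop)
    (f := fun n k => fsq γ k / lam k * (2 * (1 - (J n).mult k)))
    (g := fun _ => 0) (bound := fun k => fsq γ k / lam k * 4) ((summable_fsq_div_lam hw).mul_right 4)
    (fun k => by
      have := ((hJ k).const_sub 1).const_mul 2 |>.const_mul (fsq γ k / lam k)
      simpa using this)
    (Eventually.of_forall fun n k => by
      rw [Real.norm_eq_abs, abs_of_nonneg (mul_nonneg (fsq_div_lam_nonneg γ k)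
        ((J n).two_mul_one_sub_mult_mem k).1)]
      exact mul_le_mul_of_nonneg_left ((J n).two_mul_one_sub_mult_mem k).2 (fsq_div_lam_nonneg γ k))
  rw [tsum_zero] at h
  exact h

section Action

variable {ρ : ℝ → PT2} (hρ : Continuous ρ) {T S : ℝ} (hw : ∫⁻ r in Ioc 0 T, wsq (ρ r) ≠ ⊤)
  (hS0 : 0 ≤ S) (hS : ∀ r ∈ Ioc 0 T, sobolevSq (ρ r) ≤ ENNReal.ofReal S)
include hρ hw hS0 hS

omit hS0 hS in
lemma aemeasurable_comm (J : Mollifier) :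
    AEMeasurable (fun r => J.comm (ρ r)) (volume.restrict (Ioc 0 T)) := by
  have hd : AEMeasurable (fun r => J.defect (ρ r)) (volume.restrict (Ioc 0 T)) :=
    aemeasurable_of_tendsto_metrizable_ae (atTop : Filter (Finset (Fin 2 → ℤ)))
      (f := fun B r => ∑ k ∈ B, fsq (ρ r) k / lam k * (2 * (1 - J.mult k)))
      (fun B => (continuous_finsetSum _ fun k _ =>
        ((continuous_fsq_curve hρ k).div_const _).mul continuous_const).measurable.aemeasurable)
      ((ae_wsq_ne_top hρ hw).mono fun r hr => (J.summable_defect hr).hasSum)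
  exact ((((measurable_wsq_curve hρ).ennreal_toReal.aemeasurable).const_add 1).const_mul 12).mul
    hd.sqrt

lemma ae_comm_le : ∀ᵐ r ∂(volume.restrict (Ioc 0 T)), ∀ J : Mollifier,
    ‖J.comm (ρ r)‖ ≤ 12 * (1 + (wsq (ρ r)).toReal) * √(4 * S) := by
  filter_upwards [ae_wsq_ne_top hρ hw, ae_restrict_mem measurableSet_Ioc] with r hr hr' J
  rw [comm, Real.norm_eq_abs, abs_of_nonneg (by positivity)]
  exact mul_le_mul_of_nonneg_left (Real.sqrt_le_sqrt (J.defect_le hr hS0 (hS r hr'))) (by positivity)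

lemma integrableOn_comm (J : Mollifier) : IntegrableOn (fun r => J.comm (ρ r)) (Ioc 0 T) :=
  Integrable.mono' ((((integrable_const (1:ℝ)).add (integrableOn_wsq hρ hw)).const_mul 12).mul_const _)
    (aemeasurable_comm hρ hw J).aestronglyMeasurable
    ((ae_comm_le hρ hw hS0 hS).mono fun _ h => h J)

/-- The uniform energy bound controls the defect, and `wsq` is integrable in time, so dominated
convergence applies. -/
lemma tendsto_integral_comm {J : ℕ → Mollifier}
    (hJ : ∀ k, Tendsto (fun n => (J n).mult k) atTop (𝓝 1)) :
    Tendsto (fun n => ∫ r in Ioc 0 T, (J n).comm (ρ r)) atTop (𝓝 0) := by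
  have h := tendsto_integral_of_dominated_convergence (μ := volume.restrict (Ioc 0 T))
    (F := fun n r => (J n).comm (ρ r)) (f := fun _ => 0)
    (fun r => 12 * (1 + (wsq (ρ r)).toReal) * √(4 * S))
    (fun n => (aemeasurable_comm hρ hw (J n)).aestronglyMeasurable)
    ((((integrable_const (1:ℝ)).add (integrableOn_wsq hρ hw)).const_mul 12).mul_const _)
    (fun n => (ae_comm_le hρ hw hS0 hS).mono fun _ h => h (J n))
    ((ae_wsq_ne_top hρ hw).mono fun r hr => by
      have := ((tendsto_defect hJ hr).sqrt).const_mul (12 * (1 + (wsq (ρ r)).toReal))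
      simpa [comm] using this)
  simpa using h

/-- The entropy dissipation inequality for mollifications of a curve of finite action. -/
theorem ent_add_info_le {ν A : ℝ} (hν : 0 < ν)
    (hA : ∀ φ, IsSmoothInTime φ → actionTest ν T ρ φ ≤ A) (J : Mollifier) {s t : ℝ} (hs : 0 ≤ s)
    (hst : s ≤ t) (ht : t ≤ T) :
    J.ent (ρ t) + ν / 4 * (∫ r in Ioc s t, J.info (ρ r)) ≤
      J.ent (ρ s) + 2 * A + 1 / ν * ∫ r in Ioc 0 T, J.comm (ρ r) := by
  have hT : 0 ≤ T := hs.trans (hst.trans ht)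
  have he : ∀ i, IsSmooth (J.mode i) := isSmooth_mode
  have hsub : Ioc s t ⊆ Ioc 0 T := Ioc_subset_Ioc hs ht
  have key := chain_le (X := fun i r => ∫ x, J.mode i x ∂(ρ r : Measure T2))
    (V := linPart ν ρ J.mode) (K := quadPart ν ρ J.mode) (T := T) (A := A)
    (fun i => continuous_integral_curve hρ (he i).continuous)
    (fun i => integrableOn_linPart he hρ hw i) (fun i j => integrableOn_quadPart he hρ i j)
    (fun a ha => by
      rw [← actionTest_comb he hρ hw hT ha]
      exact hA _ (isSmoothInTime_comb he ha))
    (α := fun i r => J.coef (ρ r) i) (fun i => continuous_coef_curve hρ i)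
    (Φ := fun r => 1 / 2 * J.ent (ρ r)) (fun r r' => half_ent_sub_le _ _) hs hst ht
  -- The quadratic form at the actual coefficients is the Hamiltonian of the test function, to which
  -- the entropy production estimate applies at almost every time.
  have hq : ∀ᵐ r ∂(volume.restrict (Ioc s t)),
      quad (linPart ν ρ J.mode) (quadPart ν ρ J.mode) (fun i => J.coef (ρ r) i) r ≤
        -(ν / 8 * J.info (ρ r)) + 1 / (2 * ν) * J.comm (ρ r) := by
    have hae := ae_restrict_of_ae_restrict_of_subset hsub (ae_wsq_ne_top hρ hw)
    filter_upwards [hae] with r hr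
    rw [quad_eq he hr, ← test_eq]
    exact production_le hr hν
  have i1 : IntegrableOn (fun r => -(ν / 8 * J.info (ρ r))) (Ioc s t) :=
    (continuous_const.mul (continuous_info_curve hρ)).neg.integrableOn_Ioc
  have i2 : IntegrableOn (fun r => 1 / (2 * ν) * J.comm (ρ r)) (Ioc s t) :=
    ((integrableOn_comm hρ hw hS0 hS J).mono_set hsub).const_mul _
  have iq : IntegrableOn (fun r => quad (linPart ν ρ J.mode) (quadPart ν ρ J.mode)
      (fun i => J.coef (ρ r) i) r) (Ioc s t) := by
    refine Integrable.add (integrable_finsetSum _ fun i _ => ?_)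
      (integrable_finsetSum _ fun i _ => integrable_finsetSum _ fun j _ => ?_)
    · obtain ⟨C, hC⟩ := isCompact_Icc.exists_bound_of_continuousOn (s := Icc s t)
        (continuous_coef_curve hρ i).continuousOn
      exact ((integrableOn_linPart he hρ hw i).mono_set hsub).bdd_mul (c := C)
        (continuous_coef_curve hρ i).aestronglyMeasurable ((ae_restrict_iff' measurableSet_Ioc).2
          (Eventually.of_forall fun r hr => hC r (Ioc_subset_Icc_self hr)))
    · exact (((continuous_coef_curve hρ i).mul (continuous_coef_curve hρ j)).mul
        (continuous_quadPart he hρ i j)).integrableOn_Ioc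
  have h1 := integral_mono_ae iq (i1.add i2) hq
  rw [integral_add' i1 i2, integral_neg, integral_const_mul, integral_const_mul] at h1
  -- Enlarging the interval is harmless because the commutator bound is nonnegative, and it makes
  -- the error independent of `s` and `t`.
  have h2 : ∫ r in Ioc s t, J.comm (ρ r) ≤ ∫ r in Ioc 0 T, J.comm (ρ r) :=
    setIntegral_mono_set (integrableOn_comm hρ hw hS0 hS J)
      (Eventually.of_forall fun r => by
        show 0 ≤ J.comm (ρ r)
        unfold comm; positivity) (Eventually.of_forall hsub)
  have h3 := mul_le_mul_of_nonneg_left h2 (one_div_pos.2 hν).le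
  have e : 1 / (2 * ν) * ∫ r in Ioc s t, J.comm (ρ r) =
      1 / 2 * (1 / ν * ∫ r in Ioc s t, J.comm (ρ r)) := by field_simp
  rw [e] at h1
  linarith

end Action

end Mollifier

end Dissipation

/-! ## Lower semicontinuity of the entropy -/

section EntropyLimit

/-- The Fenchel–Young inequality for `P log P - P` and its conjugate `exp`. -/
lemma mul_le_mul_log_add_exp {P : ℝ} (hP : 0 < P) (f : ℝ) :
    P * f ≤ P * Real.log P - P + Real.exp f := by
  have h := Real.log_le_sub_one_of_pos (div_pos (Real.exp_pos f) hP)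
  rw [Real.log_div (Real.exp_ne_zero f) hP.ne', Real.log_exp, le_sub_iff_add_le, le_div_iff₀ hP] at h
  nlinarith

namespace Mollifier

variable {J : Mollifier} (γ : PT2)

lemma integrable_mol : Integrable (J.mol γ) := integrable_of_continuous _ (isSmooth_mol γ).continuous

lemma integrable_mol_mul_logMol : Integrable fun x => J.mol γ x * J.logMol γ x :=
  integrable_of_continuous _ ((isSmooth_mol γ).continuous.mul (isSmooth_logMol γ).continuous)

lemma integral_mol_mul_le {f : T2 → ℝ} (hf : Continuous f) :
    ∫ x, J.mol γ x * f x ≤ J.ent γ - 1 + ∫ x, Real.exp (f x) := by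
  have i1 : Integrable fun x => J.mol γ x * J.logMol γ x - J.mol γ x :=
    (integrable_mol_mul_logMol γ).sub (integrable_mol γ)
  have i2 : Integrable fun x => Real.exp (f x) := integrable_of_continuous _ hf.rexp
  have h := integral_mono (integrable_of_continuous _ ((isSmooth_mol γ).continuous.mul hf))
    (i1.add i2) fun x => mul_le_mul_log_add_exp (mol_pos (J := J) γ x) (f x)
  rw [integral_add' i1 i2, integral_sub (integrable_mol_mul_logMol γ) (integrable_mol γ),
    integral_mol] at h
  exact h

lemma ent_nonneg : 0 ≤ J.ent γ := by
  have h := integral_mol_mul_le (J := J) γ (f := fun _ => 0) continuous_const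
  simpa using h

/-- The tangent to the logarithm at `c = 1 + wsq` gives `P log P ≤ P (log c - 1) + P²/c`. The last
term integrates to at most one by the `L²` bound. -/
lemma ent_le_log {γ : PT2} (hw : wsq γ ≠ ⊤) : J.ent γ ≤ Real.log (1 + (wsq γ).toReal) := by
  set c := 1 + (wsq γ).toReal with hc
  have hc0 : 0 < c := by positivity
  have i1 : Integrable fun x => J.mol γ x * (Real.log c - 1) := (integrable_mol γ).mul_const _
  have i2 : Integrable fun x => 1 / c * J.mol γ x ^ 2 :=
    (integrable_of_continuous _ ((isSmooth_mol γ).continuous.pow 2)).const_mul _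
  have h := integral_mono (integrable_mol_mul_logMol (J := J) γ) (i1.add i2) fun x => by
    have hP := mol_pos (J := J) γ x
    have h := Real.log_le_sub_one_of_pos (div_pos hP hc0)
    rw [Real.log_div hP.ne' hc0.ne'] at h
    have h2 := mul_le_mul_of_nonneg_left h hP.le
    have e : J.mol γ x * (J.mol γ x / c - 1) = 1 / c * J.mol γ x ^ 2 - J.mol γ x := by
      field_simp
    simp only [logMol, Pi.add_apply]
    linarith
  rw [integral_add' i1 i2, integral_mul_const, integral_const_mul, integral_mol] at h
  have h3 := mul_le_mul_of_nonneg_left (J.integral_mol_sq_le hw) (one_div_pos.2 hc0).le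
  rw [← hc, one_div_mul_cancel hc0.ne'] at h3
  simp only [ent]
  linarith

/-- In the dual inequality the mollified measure appears linearly, so weak convergence passes to the
limit without any compactness of entropies. -/
lemma integral_le_of_ent_le {J : ℕ → Mollifier}
    (hJ : ∀ k, Tendsto (fun n => (J n).mult k) atTop (𝓝 1)) {L : ℝ} {ε : ℕ → ℝ}
    (hε : Tendsto ε atTop (𝓝 0)) (hL : ∀ n, (J n).ent γ ≤ L + ε n) {f : T2 → ℝ} (hf : Continuous f) :
    ∫ x, f x ∂(γ : Measure T2) ≤ L - 1 + ∫ x, Real.exp (f x) := by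
  have h1 : Tendsto (fun n => L + ε n - 1 + ∫ x, Real.exp (f x)) atTop
      (𝓝 (L - 1 + ∫ x, Real.exp (f x))) := by
    simpa using ((hε.const_add L).sub_const 1).add_const (∫ x, Real.exp (f x))
  refine le_of_tendsto_of_tendsto' (tendsto_integral_mol hJ γ hf) h1 fun n => ?_
  have := integral_mol_mul_le (J := J n) γ hf
  linarith [hL n]

end Mollifier

/-! ### Entropy bounds from the dual inequality. -/

section Variational

variable {γ : PT2} {L : ℝ}
  (h : ∀ f : T2 → ℝ, Continuous f → ∫ x, f x ∂(γ : Measure T2) ≤ L - 1 + ∫ x, Real.exp (f x))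
include h

/-- A continuous function approximates `f` in `L¹(γ + volume)`, hence for both measures at once.
Truncating it at the level `M` keeps the exponential Lipschitz with constant `exp M`. -/
lemma integral_le_of_bounded {f : T2 → ℝ} (hf : Measurable f) {M : ℝ} (hM : ∀ x, |f x| ≤ M) :
    ∫ x, f x ∂(γ : Measure T2) ≤ L - 1 + ∫ x, Real.exp (f x) := by
  have hint : ∀ μ : Measure T2, IsFiniteMeasure μ → Integrable f μ := fun μ _ =>
    Integrable.of_bound hf.aestronglyMeasurable M (Eventually.of_forall hM)
  set μ : Measure T2 := (γ : Measure T2) + volume with hμ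
  have hM0 : 0 ≤ M := (abs_nonneg _).trans (hM 0)
  have hei : Integrable fun x => Real.exp (f x) :=
    Integrable.of_bound hf.exp.aestronglyMeasurable (Real.exp M) (Eventually.of_forall fun x => by
      rw [Real.norm_eq_abs, Real.abs_exp]; exact Real.exp_le_exp.2 (le_of_abs_le (hM x)))
  refine le_of_forall_pos_le_add fun ε hε => ?_
  set δ : ℝ := ε / (1 + Real.exp M) with hδ
  have hden : 0 < 1 + Real.exp M := by positivity
  have hδ0 : 0 < δ := div_pos hε hden
  obtain ⟨g, hg, hgi⟩ := (hint μ inferInstance).exists_boundedContinuous_integral_sub_le hδ0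
  set u : T2 → ℝ := fun x => max (-M) (min M (g x)) with hu
  have huc : Continuous u := continuous_const.max (continuous_const.min g.continuous)
  have huM : ∀ x, u x ≤ M := fun x => max_le (by linarith) (min_le_left _ _)
  have hfu : ∀ x, |f x - u x| ≤ |f x - g x| := by
    intro x
    have e : f x = max (-M) (min M (f x)) := by
      rw [min_eq_right (le_of_abs_le (hM x)), max_eq_right (neg_le_of_abs_le (hM x))]
    conv_lhs => rw [e]
    have h1 := abs_max_sub_max_le_max (-M) (min M (f x)) (-M) (min M (g x))
    have h2 := abs_min_sub_min_le_max M (f x) M (g x)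
    rw [sub_self, abs_zero, max_eq_right (abs_nonneg (min M (f x) - min M (g x)))] at h1
    rw [sub_self, abs_zero, max_eq_right (abs_nonneg (f x - g x))] at h2
    exact h1.trans h2
  have i0 : Integrable (fun x => |f x - u x|) μ :=
    ((hint μ inferInstance).sub (integrable_of_continuous μ huc)).abs
  have hsum : (∫ x, |f x - u x| ∂(γ : Measure T2)) + ∫ x, |f x - u x| ≤ δ := by
    rw [← integral_add_measure (i0.mono_measure (Measure.le_add_right le_rfl))
      (i0.mono_measure (Measure.le_add_left le_rfl)), ← hμ]
    exact (integral_mono i0 ((hint μ inferInstance).sub hgi).abs hfu).trans hg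
  have h1 : ∫ x, f x ∂(γ : Measure T2) - ∫ x, u x ∂(γ : Measure T2) ≤
      ∫ x, |f x - u x| ∂(γ : Measure T2) := by
    rw [← integral_sub (hint _ inferInstance) (integrable_of_continuous _ huc)]
    exact integral_mono ((hint _ inferInstance).sub (integrable_of_continuous _ huc))
      (i0.mono_measure (Measure.le_add_right le_rfl)) fun x => le_abs_self _
  have h2 : ∫ x, Real.exp (u x) ≤ (∫ x, Real.exp (f x)) + Real.exp M * ∫ x, |f x - u x| := by
    have iv : Integrable (fun x => |f x - u x|) := i0.mono_measure (Measure.le_add_left le_rfl)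
    rw [← integral_const_mul, ← integral_add hei (iv.const_mul _)]
    refine integral_mono (integrable_of_continuous _ huc.rexp) (hei.add (iv.const_mul _)) fun x => ?_
    have e1 : Real.exp (u x) - Real.exp (f x) ≤ Real.exp (u x) * (u x - f x) := by
      have := Real.add_one_le_exp (f x - u x)
      have e2 : Real.exp (f x) = Real.exp (u x) * Real.exp (f x - u x) := by
        rw [← Real.exp_add]; ring_nf
      nlinarith [Real.exp_pos (u x)]
    have e3 : Real.exp (u x) * (u x - f x) ≤ Real.exp M * |f x - u x| := by
      rw [abs_sub_comm]
      exact (mul_le_mul_of_nonneg_left (le_abs_self _) (Real.exp_pos _).le).trans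
        (mul_le_mul_of_nonneg_right (Real.exp_le_exp.2 (huM x)) (abs_nonneg _))
    dsimp only
    linarith
  have h3 := h u huc
  have h4 : 0 ≤ ∫ x, |f x - u x| ∂(γ : Measure T2) := integral_nonneg fun _ => abs_nonneg _
  have h5 : 0 ≤ ∫ x, |f x - u x| := integral_nonneg fun _ => abs_nonneg _
  have h6 : δ * (1 + Real.exp M) = ε := div_mul_cancel₀ _ hden.ne'
  nlinarith [Real.exp_pos M]

/-- A large multiple of the indicator of a null set leaves the exponential integral equal to one. If
`γ` charged the set, the left side would exceed `L`. -/
lemma absolutelyContinuous_of_variational : (γ : Measure T2) ≪ volume := by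
  refine Measure.AbsolutelyContinuous.mk fun N hN h0 => ?_
  by_contra hne
  have hp : 0 < (γ : Measure T2).real N :=
    ENNReal.toReal_pos hne (measure_ne_top _ _)
  set M : ℝ := (|L| + 1) / (γ : Measure T2).real N with hM
  have hM0 : 0 ≤ M := by positivity
  have h1 := integral_le_of_bounded h (f := N.indicator fun _ => M) (measurable_const.indicator hN)
    (M := M) (fun x => by
      by_cases hx : x ∈ N <;> simp [hx, abs_of_nonneg hM0, hM0])
  have h2 : ∫ x, Real.exp (N.indicator (fun _ => M) x) = 1 := by
    have hae : ∀ᵐ x : T2, x ∉ N := measure_eq_zero_iff_ae_notMem.1 h0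
    rw [integral_congr_ae (g := fun _ => (1:ℝ)) (hae.mono fun x hx => by simp [hx])]
    simp
  rw [h2, integral_indicator_const _ hN, smul_eq_mul, hM, mul_div_cancel₀ _ hp.ne'] at h1
  linarith [le_abs_self L]

/-- The variational characterisation of the entropy. -/
theorem entropy_le_of_variational : entropy γ ≤ (L : EReal) := by
  have hac := absolutelyContinuous_of_variational h
  rw [entropy, if_pos hac]
  set D := density γ with hD
  have hDm : Measurable D := measurable_density γ
  have hD0 : ∀ x, 0 ≤ D x := density_nonneg γ
  have hDi : Integrable D := integrable_density γ
  have hD1 : ∫ x, D x = 1 := by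
    have := integral_density hac (fun _ => (1:ℝ))
    simpa using this.symm
  -- The optimal test function `log D` may be unbounded, so the density is truncated to `[1/(n+1),
  -- n+1]`. This raises the integral of `c n` above one by at most `1/(n+1)`.
  set c : ℕ → T2 → ℝ := fun n x => max (1 / ((n:ℝ) + 1)) (min ((n:ℝ) + 1) (D x)) with hc
  have hcm : ∀ n, Measurable (c n) := fun n => measurable_const.max (measurable_const.min hDm)
  have hc0 : ∀ n x, 0 < c n x := fun n x => lt_max_of_lt_left (by positivity)
  have hn1 : ∀ n : ℕ, 1 / ((n:ℝ) + 1) ≤ 1 := fun n => by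
    rw [div_le_one (by positivity)]; linarith [(Nat.cast_nonneg n : (0:ℝ) ≤ n)]
  have hn2 : ∀ n : ℕ, (1:ℝ) ≤ (n:ℝ) + 1 := fun n => by linarith [(Nat.cast_nonneg n : (0:ℝ) ≤ n)]
  have hlog : ∀ n x, |Real.log (c n x)| ≤ Real.log ((n:ℝ) + 1) := by
    intro n x
    rw [abs_le]
    constructor
    · rw [← Real.log_inv, ← one_div]
      exact Real.log_le_log (by positivity) (le_max_left _ _)
    · exact Real.log_le_log (hc0 n x) (max_le ((hn1 n).trans (hn2 n)) (min_le_left _ _))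
  have hlm : ∀ n, Measurable fun x => D x * Real.log (c n x) := fun n => hDm.mul (hcm n).log
  have hli : ∀ n, Integrable fun x => D x * Real.log (c n x) := fun n =>
    hDi.mul_bdd (hcm n).log.aestronglyMeasurable (Eventually.of_forall (hlog n))
  have hup : ∀ n, ∫ x, D x * Real.log (c n x) ≤ L + 1 / ((n:ℝ) + 1) := by
    intro n
    have h1 := integral_le_of_bounded h (hcm n).log (hlog n)
    rw [integral_density hac] at h1
    simp only [smul_eq_mul, Real.exp_log (hc0 n _)] at h1
    have h2 : ∫ x, c n x ≤ 1 + 1 / ((n:ℝ) + 1) := by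
      have i2 : Integrable fun x => D x + 1 / ((n:ℝ) + 1) := hDi.add (integrable_const _)
      have hle : ∀ x, c n x ≤ D x + 1 / ((n:ℝ) + 1) := fun x =>
        max_le (by linarith [hD0 x]) ((min_le_right _ _).trans (by
          have : 0 ≤ 1 / ((n:ℝ) + 1) := by positivity
          linarith))
      refine (integral_mono_of_nonneg (Eventually.of_forall fun x => (hc0 n x).le) i2
        (Eventually.of_forall hle)).trans_eq ?_
      rw [integral_add hDi (integrable_const _), hD1]; simp
    linarith
  set N := ∫⁻ x, ENNReal.ofReal (-(D x * Real.log (D x))) with hN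
  have hNfin : N ≠ ⊤ := by
    refine ((lintegral_mono (g := fun _ => 1) fun x => ?_).trans_lt (by simp)).ne
    rw [ENNReal.ofReal_le_one]
    rcases (hD0 x).eq_or_lt with h0 | h0
    · rw [← h0]; simp
    · have := Real.one_sub_inv_le_log_of_pos h0
      have h2 := mul_le_mul_of_nonneg_left this h0.le
      rw [mul_sub, mul_inv_cancel₀ h0.ne'] at h2
      linarith
  have hposle : ∀ n, ∫⁻ x, ENNReal.ofReal (D x * Real.log (c n x)) ≤
      ENNReal.ofReal (L + 1 / ((n:ℝ) + 1) + N.toReal) := by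
    intro n
    have h1 := integral_eq_lintegral_pos_part_sub_lintegral_neg_part (hli n)
    -- Where `D ≤ 1` the truncation can only raise the logarithm; where `D ≥ 1` its logarithm is
    -- nonnegative and the negative part vanishes.
    have hneg : ∫⁻ x, ENNReal.ofReal (-(D x * Real.log (c n x))) ≤ N := by
      refine lintegral_mono fun x => ENNReal.ofReal_le_ofReal_iff'.2 ?_
      rcases (hD0 x).eq_or_lt with h0 | h0
      · right; rw [← h0]; simp
      rcases le_total (D x) 1 with hx | hx
      · left
        refine neg_le_neg (mul_le_mul_of_nonneg_left (Real.log_le_log h0 ?_) h0.le)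
        refine le_max_of_le_right (le_min (hx.trans (hn2 n)) le_rfl)
      · right
        have : 0 ≤ Real.log (c n x) := Real.log_nonneg (le_max_of_le_right (le_min (hn2 n) hx))
        have := mul_nonneg h0.le this
        linarith
    have hpf : ∫⁻ x, ENNReal.ofReal (D x * Real.log (c n x)) ≠ ⊤ := (hli n).lintegral_lt_top.ne
    rw [← ENNReal.ofReal_toReal hpf]
    refine ENNReal.ofReal_le_ofReal ?_
    have h2 := ENNReal.toReal_mono hNfin hneg
    linarith [hup n]
  -- Fatou's lemma for the positive parts alone. At each point of positive density the truncation is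
  -- eventually inactive, and at zeros both products vanish.
  have hfat : ∫⁻ x, ENNReal.ofReal (D x * Real.log (D x)) ≤ ENNReal.ofReal (L + N.toReal) := by
    have hlim : ∀ x, Tendsto (fun n => ENNReal.ofReal (D x * Real.log (c n x))) atTop
        (𝓝 (ENNReal.ofReal (D x * Real.log (D x)))) := by
      intro x
      rcases (hD0 x).eq_or_lt with h0 | h0
      · simp [← h0]
      refine tendsto_const_nhds.congr' ?_
      have e1 : ∀ᶠ n : ℕ in atTop, D x ≤ (n:ℝ) + 1 :=
        (tendsto_atTop_add_const_right _ 1 tendsto_natCast_atTop_atTop).eventually_ge_atTop _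
      filter_upwards [e1,
        (tendsto_one_div_add_atTop_nhds_zero_nat (𝕜 := ℝ)).eventually_le_const h0] with n hn hn'
      simp only [hc]
      rw [min_eq_right hn, max_eq_right hn']
    calc ∫⁻ x, ENNReal.ofReal (D x * Real.log (D x))
        = ∫⁻ x, liminf (fun n => ENNReal.ofReal (D x * Real.log (c n x))) atTop :=
          lintegral_congr fun x => (hlim x).liminf_eq.symm
      _ ≤ liminf (fun n => ∫⁻ x, ENNReal.ofReal (D x * Real.log (c n x))) atTop :=
          lintegral_liminf_le fun n => (hlm n).ennreal_ofReal
      _ ≤ liminf (fun n : ℕ => ENNReal.ofReal (L + 1 / ((n:ℝ) + 1) + N.toReal)) atTop :=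
          liminf_le_liminf (Eventually.of_forall hposle)
      _ = _ := by
          refine Tendsto.liminf_eq ((ENNReal.continuous_ofReal.tendsto _).comp ?_)
          have := ((tendsto_one_div_add_atTop_nhds_zero_nat (𝕜 := ℝ)).const_add L).add_const N.toReal
          simpa using this
  have hL0 : 0 ≤ L := by simpa using h (fun _ => 0) continuous_const
  set P := ∫⁻ x, ENNReal.ofReal (D x * Real.log (D x)) with hP
  have hPfin : P ≠ ⊤ := (hfat.trans_lt ENNReal.ofReal_lt_top).ne
  have hP2 : P.toReal ≤ L + N.toReal :=
    ENNReal.toReal_le_of_le_ofReal (add_nonneg hL0 ENNReal.toReal_nonneg) hfat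
  rw [← ENNReal.ofReal_toReal hPfin, ← ENNReal.ofReal_toReal hNfin, EReal.coe_ennreal_ofReal,
    EReal.coe_ennreal_ofReal, max_eq_left ENNReal.toReal_nonneg, max_eq_left ENNReal.toReal_nonneg,
    ← EReal.coe_sub, EReal.coe_le_coe_iff]
  linarith

end Variational

end EntropyLimit

/-! ## Lower semicontinuity of the Fisher information -/

section FisherLimit

namespace Mollifier

/-- All Fourier coefficients of the Dirac mass at the origin equal one, which is the limit of the
multipliers. -/
lemma tendsto_integral_ker_mul {J : ℕ → Mollifier}
    (hJ : ∀ k, Tendsto (fun n => (J n).mult k) atTop (𝓝 1)) {φ : T2 → ℝ} (hφ : Continuous φ) :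
    Tendsto (fun n => ∫ z, (J n).ker z * φ z) atTop (𝓝 (φ 0)) := by
  have h := tendsto_integral_of_fourier (P := fun n => (J n).ker) (fun n => (J n).continuous_ker)
    (fun n x => ((J n).ker_pos x).le) (fun n => (J n).integral_ker)
    (⟨Measure.dirac 0, inferInstance⟩ : PT2) (fun k => by
      simp only [integral_ker_mul_ch]
      have e : fc (⟨Measure.dirac 0, inferInstance⟩ : PT2) k = 1 := by
        have : ch k 0 = 1 := by simp [ch_eq_prod]
        simp [fc, this]
      rw [e]
      exact_mod_cast (Complex.continuous_ofReal.tendsto 1).comp (hJ k)) hφ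
  simpa using h

/-- The oscillation of a continuous function at the scale of a mollifier tends to zero. -/
lemma tendsto_integral_oscillation {J : ℕ → Mollifier}
    (hJ : ∀ k, Tendsto (fun n => (J n).mult k) atTop (𝓝 1)) (γ : PT2) {u : T2 → ℝ}
    (hu : Continuous u) :
    Tendsto (fun n => ∫ x, (∫ y, (J n).ker (x - y) * (u x - u y) ^ 2) ∂(γ : Measure T2)) atTop
      (𝓝 0) := by
  have hcc : Continuous (Function.uncurry fun h x : T2 => (u x - u (x - h)) ^ 2) :=
    ((hu.comp continuous_snd).sub (hu.comp (continuous_snd.sub continuous_fst))).pow 2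
  have hψ : Continuous fun h : T2 => ∫ x, (u x - u (x - h)) ^ 2 ∂(γ : Measure T2) := by
    have := continuous_parametric_integral_of_continuous (μ := (γ : Measure T2)) hcc isCompact_univ
    simpa only [Measure.restrict_univ] using this
  have h := tendsto_integral_ker_mul hJ hψ
  simp only [sub_zero, sub_self, ne_eq, OfNat.ofNat_ne_zero, not_false_eq_true, zero_pow,
    integral_zero] at h
  refine h.congr fun n => ?_
  have h1 : ∀ x, ∫ y, (J n).ker (x - y) * (u x - u y) ^ 2 =
      ∫ h, (J n).ker h * (u x - u (x - h)) ^ 2 := by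
    intro x
    have := integral_sub_left_eq_self
      (fun h => (J n).ker h * (u x - u (x - h)) ^ 2) (volume : Measure T2) x
    simpa only [sub_sub_cancel] using this
  simp only [h1]
  have hc2 : Continuous (Function.uncurry fun x h : T2 => (J n).ker h * (u x - u (x - h)) ^ 2) :=
    ((J n).continuous_ker.comp continuous_snd).mul (((hu.comp continuous_fst).sub
      (hu.comp (continuous_fst.sub continuous_snd))).pow 2)
  rw [integral_integral_swap (integrable_of_continuous _ hc2)]
  simp only [integral_const_mul]

lemma integral_conv_sq_le_info (J : Mollifier) (γ : PT2) (i : Fin 2) :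
    ∫ x, J.conv (pd i (J.logMol γ)) x ^ 2 ∂(γ : Measure T2) ≤ J.info γ := by
  have hs := (isSmooth_logMol (J := J) γ).pd i
  have h0 : ∀ i, 0 ≤ ∫ x, J.mol γ x * pd i (J.logMol γ) x ^ 2 := fun i =>
    integral_nonneg fun x => mul_nonneg (mol_pos γ x).le (sq_nonneg _)
  refine le_trans ?_ ((Finset.single_le_sum (fun i _ => h0 i) (Finset.mem_univ i)).trans_eq
    (info_eq γ).symm)
  rw [integral_mol_mul γ (hs.continuous.fun_pow 2)]
  exact integral_mono (integrable_of_continuous _ ((J.continuous_conv hs.continuous).pow 2))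
    (integrable_of_continuous _ (J.continuous_conv (hs.continuous.pow 2)))
    fun x => J.conv_sq_le hs.continuous x

lemma integral_mol_mul_pd_logMol_sq_le (J : Mollifier) (γ : PT2) (i : Fin 2) :
    ∫ x, J.mol γ x * pd i (J.logMol γ) x ^ 2 ≤ J.info γ := by
  have h0 : ∀ i, 0 ≤ ∫ x, J.mol γ x * pd i (J.logMol γ) x ^ 2 := fun i =>
    integral_nonneg fun x => mul_nonneg (mol_pos γ x).le (sq_nonneg _)
  exact (Finset.single_le_sum (fun i _ => h0 i) (Finset.mem_univ i)).trans_eq (info_eq γ).symm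

/-- Bounds on the Fisher information of mollifications give a score function. -/
lemma exists_score {J : ℕ → Mollifier}
    (hJ : ∀ k, Tendsto (fun n => (J n).mult k) atTop (𝓝 1)) (γ : PT2) {c : ℝ} (hc : 0 ≤ c)
    (hfr : ∃ᶠ n in atTop, (J n).info γ ≤ c) (i : Fin 2) :
    ∃ F : T2 → ℝ, MemLp F 2 (γ : Measure T2) ∧ ∫ x, F x ^ 2 ∂(γ : Measure T2) ≤ c ∧
      ∀ φ, IsSmooth φ → ∫ x, F x * φ x ∂(γ : Measure T2) = -∫ x, pd i φ x ∂(γ : Measure T2) := by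
  classical
  -- The ultrafilter is chosen to concentrate on indices satisfying the information bound. At all
  -- others the sequence may be set to zero.
  set s : Set ℕ := {n | (J n).info γ ≤ c} with hs
  have : (atTop ⊓ 𝓟 s).NeBot := frequently_mem_iff_neBot.1 hfr
  set U : Ultrafilter ℕ := Ultrafilter.of (atTop ⊓ 𝓟 s)
  have hU : (U : Filter ℕ) ≤ atTop ⊓ 𝓟 s := Ultrafilter.of_le _
  have hUt : (U : Filter ℕ) ≤ atTop := hU.trans inf_le_left
  have hUs : ∀ᶠ n in (U : Filter ℕ), (J n).info γ ≤ c := hU.trans inf_le_right (mem_principal_self s)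
  have hsm := fun n => (isSmooth_logMol (J := J n) γ)
  have hcc := fun n => (J n).continuous_conv ((hsm n).pd i).continuous
  obtain ⟨F, hF, hFc, hlim⟩ := exists_weak_limit (μ := (γ : Measure T2))
    (w := fun n => if (J n).info γ ≤ c then (J n).conv (pd i ((J n).logMol γ)) else 0)
    (fun n => by
      split_ifs
      · exact memLp_two_of_continuous (hcc n) _
      · exact MemLp.zero) (C := c)
    (fun n => by
      split_ifs with h
      · exact ((J n).integral_conv_sq_le_info γ i).trans h
      · simpa using hc) U
  refine ⟨F, hF, hFc, ?_⟩
  have hle : ∀ φ, IsSmooth φ → ∫ x, F x * φ x ∂(γ : Measure T2) ≤ -∫ x, pd i φ x ∂(γ : Measure T2) := by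
    intro φ hφ
    have h1 : Tendsto (fun n => ∫ x, (J n).conv (pd i ((J n).logMol γ)) x * φ x ∂(γ : Measure T2))
        U (𝓝 (∫ x, F x * φ x ∂(γ : Measure T2))) := by
      refine (hlim φ (memLp_two_of_continuous hφ.continuous _)).congr' ?_
      filter_upwards [hUs] with n hn
      simp only [if_pos hn]
    have h2 : Tendsto (fun n => ∫ x, (J n).mol γ x * (pd i ((J n).logMol γ) x * φ x)) atTop
        (𝓝 (-∫ x, pd i φ x ∂(γ : Measure T2))) := by
      refine (tendsto_integral_mol hJ γ (hφ.pd i).continuous).neg.congr fun n => ?_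
      rw [integral_mul_pd (isSmooth_mol γ) hφ, neg_neg]
      simp only [← mul_assoc, mol_mul_pd_logMol]
    refine le_of_forall_pos_le_add fun ε hε => ?_
    -- This makes the cost `ν/4 · c` of Young's inequality at most `ε`. With `ν` fixed, the
    -- oscillation term vanishes in the limit despite its factor `1/ν`.
    set ν : ℝ := 4 * ε / (c + 1) with hν
    have hc1 : 0 < c + 1 := by linarith
    have hν0 : 0 < ν := by positivity
    have h3 := (h2.add_const (ν / 4 * c)).add
      ((tendsto_integral_oscillation hJ γ hφ.continuous).const_mul (1 / ν))
    rw [mul_zero, add_zero] at h3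
    have h4 := le_of_tendsto_of_tendsto h1 (h3.mono_left hUt) (by
      filter_upwards [hUs] with n hn
      have h5 := (J n).integral_conv_mul_le γ ((hsm n).pd i).continuous hφ.continuous hν0
      have h6 := mul_le_mul_of_nonneg_left (((J n).integral_mol_mul_pd_logMol_sq_le γ i).trans hn)
        (by positivity : 0 ≤ ν / 4)
      linarith)
    have h7 : ν / 4 * c ≤ ε := by
      rw [hν, div_div, div_mul_eq_mul_div, div_le_iff₀ (by positivity)]
      nlinarith
    linarith
  intro φ hφ
  refine le_antisymm (hle φ hφ) ?_
  -- The inequality is linear in the test function, so its version for `-φ` gives equality.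
  have h := hle (fun x => -1 * φ x) (hφ.const_mul (-1))
  have e : ∀ x, pd i (fun x => -1 * φ x) x = -1 * pd i φ x := hφ.pd_const_mul (-1) i
  simp only [e, mul_left_comm _ (-1 : ℝ), integral_const_mul] at h
  linarith

end Mollifier

/-- The distributional gradient is the density times the score, so the Fisher integrand becomes
`|F|²` integrated against `γ`. The factor two counts the coordinates. -/
lemma fisher_le_of_score {γ : PT2} (hac : (γ : Measure T2) ≪ volume) {F : Fin 2 → T2 → ℝ} {c : ℝ}
    (hF : ∀ i, MemLp (F i) 2 (γ : Measure T2)) (hc : ∀ i, ∫ x, F i x ^ 2 ∂(γ : Measure T2) ≤ c)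
    (hφ : ∀ i, ∀ φ, IsSmooth φ →
      ∫ x, F i x * φ x ∂(γ : Measure T2) = -∫ x, pd i φ x ∂(γ : Measure T2)) :
    fisher γ ≤ 2 * ENNReal.ofReal c := by
  obtain ⟨G, hGm, hGF⟩ : ∃ G : Fin 2 → T2 → ℝ, (∀ i, Measurable (G i)) ∧
      ∀ i, F i =ᵐ[(γ : Measure T2)] G i :=
    ⟨fun i => (hF i).1.mk (F i), fun i => (hF i).1.stronglyMeasurable_mk.measurable,
      fun i => (hF i).1.ae_eq_mk⟩
  have hDm := measurable_density γ
  have hG1 : ∀ i, Integrable (G i) (γ : Measure T2) := fun i =>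
    ((hF i).integrable one_le_two).congr (hGF i)
  have hG2 : ∀ i, Integrable (fun x => G i x ^ 2) (γ : Measure T2) := fun i =>
    (hF i).integrable_sq.congr ((hGF i).mono fun x hx => by simp only [hx])
  have hint : ∀ f : T2 → ℝ, ∫⁻ x, ENNReal.ofReal (f x) ∂(γ : Measure T2) =
      ∫⁻ x, ENNReal.ofReal (density γ x) * ENNReal.ofReal (f x) := by
    intro f
    conv_lhs => rw [withDensity_density hac]
    exact lintegral_withDensity_eq_lintegral_mul_non_measurable₀ _ hDm.ennreal_ofReal.aemeasurable
      (Eventually.of_forall fun x => ENNReal.ofReal_lt_top) _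
  have hwg : IsWeakGradient (density γ) fun i x => G i x * density γ x := by
    refine ⟨fun i => ⟨((hGm i).mul hDm).aestronglyMeasurable, ?_⟩, fun φ hs i => ?_⟩
    · rw [hasFiniteIntegral_iff_norm]
      have h := (hG1 i).2
      rw [hasFiniteIntegral_iff_norm, hint] at h
      refine lt_of_le_of_lt (le_of_eq (lintegral_congr fun x => ?_)) h
      rw [norm_mul, Real.norm_eq_abs (density γ x), abs_of_nonneg (density_nonneg γ x),
        ENNReal.ofReal_mul (norm_nonneg _), mul_comm]
    · have h1 := hφ i φ hs
      rw [integral_congr_ae (g := fun x => G i x * φ x) ((hGF i).mono fun x hx => by simp only [hx]),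
        integral_density hac, integral_density hac] at h1
      simp only [smul_eq_mul] at h1
      rw [← neg_eq_iff_eq_neg] at h1
      rw [← h1]
      congr 1
      exact integral_congr_ae (Eventually.of_forall fun x => by dsimp only; ring)
  refine (iInf₂_le _ ⟨hac, hwg⟩).trans ?_
  -- Where the density vanishes the gradient does too, and the convention `0 / 0 = 0` makes both
  -- sides zero.
  have hpt : ∀ x, ENNReal.ofReal (∑ i, (G i x * density γ x) ^ 2) / ENNReal.ofReal (density γ x) =
      ENNReal.ofReal (density γ x) * ENNReal.ofReal (∑ i, G i x ^ 2) := by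
    intro x
    rcases (density_nonneg γ x).eq_or_lt with h0 | h0
    · simp [← h0]
    rw [← ENNReal.ofReal_div_of_pos h0, ← ENNReal.ofReal_mul h0.le]
    congr 1
    simp only [mul_pow, ← Finset.sum_mul]
    field_simp
  simp only [hpt, ← hint]
  have hsum : ∀ x, ENNReal.ofReal (∑ i, G i x ^ 2) =
      ENNReal.ofReal (G 0 x ^ 2) + ENNReal.ofReal (G 1 x ^ 2) := fun x => by
    rw [Fin.sum_univ_two, ENNReal.ofReal_add (sq_nonneg _) (sq_nonneg _)]
  simp only [hsum]
  rw [lintegral_add_left ((hGm 0).pow_const 2).ennreal_ofReal, two_mul]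
  have hb : ∀ i, ∫⁻ x, ENNReal.ofReal (G i x ^ 2) ∂(γ : Measure T2) ≤ ENNReal.ofReal c := by
    intro i
    rw [← ofReal_integral_eq_lintegral_ofReal (hG2 i) (Eventually.of_forall fun x => sq_nonneg _)]
    refine ENNReal.ofReal_le_ofReal (le_trans (le_of_eq ?_) (hc i))
    exact integral_congr_ae ((hGF i).mono fun x hx => by simp only [hx])
  exact add_le_add (hb 0) (hb 1)

/-- Lower semicontinuity of the Fisher information along mollifications. -/
theorem fisher_le_liminf {J : ℕ → Mollifier}
    (hJ : ∀ k, Tendsto (fun n => (J n).mult k) atTop (𝓝 1)) {γ : PT2}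
    (hac : (γ : Measure T2) ≪ volume) :
    fisher γ ≤ 2 * liminf (fun n => ENNReal.ofReal ((J n).info γ)) atTop := by
  have key : ∀ c : NNReal, liminf (fun n => ENNReal.ofReal ((J n).info γ)) atTop < c →
      fisher γ ≤ 2 * (c : ℝ≥0∞) := by
    intro c hc
    have hfr : ∃ᶠ n in atTop, (J n).info γ ≤ c := by
      refine (frequently_lt_of_liminf_lt (by isBoundedDefault) hc).mono fun n hn => ?_
      have := hn.le
      rw [← ENNReal.ofReal_coe_nnreal] at this
      exact (ENNReal.ofReal_le_ofReal_iff c.2).1 this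
    choose F hF hFc hφ using fun i => Mollifier.exists_score hJ γ c.2 hfr i
    simpa using fisher_le_of_score hac hF hFc hφ
  rcases eq_or_ne (liminf (fun n => ENNReal.ofReal ((J n).info γ)) atTop) ⊤ with h | h
  · rw [h]; simp
  · rw [mul_comm, ← ENNReal.div_le_iff (by simp) (by simp)]
    -- The frequency argument requires a level strictly above the lower limit, which is then
    -- approached from above.
    refine ENNReal.le_of_forall_pos_le_add fun ε hε _ => ?_
    lift liminf (fun n => ENNReal.ofReal ((J n).info γ)) atTop to NNReal using h with l hl
    rw [ENNReal.div_le_iff (by simp) (by simp), mul_comm, ← ENNReal.coe_add]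
    refine key (l + ε) ?_
    rw [ENNReal.coe_lt_coe]
    exact lt_add_of_pos_right l hε

end FisherLimit

/-! ## Bounds for curves of finite action -/

section Bounds

lemma energy_add_eq (γ : PT2) (x : ℝ≥0∞) : energy γ + (x : EReal) =
    ((ENNReal.ofReal (1 / 2) * sobolevSq γ + x : ℝ≥0∞) : EReal) := by
  rw [energy_eq, EReal.coe_ennreal_add, EReal.coe_ennreal_mul, EReal.coe_ennreal_ofReal,
    max_eq_left (by norm_num)]

/-- The Fourier form makes the energy nonnegative, so both terms in the supremum can be bounded
separately in `[0, ∞]`. -/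
lemma energy_add_le_toReal_QT {ν T : ℝ} {ρ : ℝ → PT2} (hQ : QT ν T ρ < ⊤) {t : ℝ}
    (ht : t ∈ Icc 0 T) :
    ENNReal.ofReal (1 / 2) * sobolevSq (ρ t) + ENNReal.ofReal (ν / 2) * ∫⁻ s in Ioc 0 t, l2DistSq (ρ s) ≤
      ENNReal.ofReal (QT ν T ρ).toReal := by
  have h1 : ((ENNReal.ofReal (1 / 2) * sobolevSq (ρ t) +
      ENNReal.ofReal (ν / 2) * ∫⁻ s in Ioc 0 t, l2DistSq (ρ s) : ℝ≥0∞) : EReal) ≤ QT ν T ρ := by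
    rw [← energy_add_eq]
    exact le_iSup₂ (f := fun t _ => energy (ρ t) +
      ((ENNReal.ofReal (ν / 2) * ∫⁻ s in Ioc 0 t, l2DistSq (ρ s) : ℝ≥0∞) : EReal)) t ht
  have h0 : 0 ≤ QT ν T ρ := (EReal.coe_ennreal_nonneg _).trans h1
  rw [← EReal.coe_ennreal_le_coe_ennreal_iff, EReal.coe_ennreal_ofReal,
    max_eq_left (EReal.toReal_nonneg h0),
    EReal.coe_toReal hQ.ne (ne_bot_of_le_ne_bot (by simp) h0)]
  exact h1

lemma actionTest_le_toReal_action {ν T : ℝ} {ρ : ℝ → PT2} (hA : action ν T ρ < ⊤) {φ : ℝ → T2 → ℝ}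
    (hφ : IsSmoothInTime φ) : actionTest ν T ρ φ ≤ (action ν T ρ).toReal := by
  have h1 : (actionTest ν T ρ φ : EReal) ≤ action ν T ρ :=
    le_iSup₂ (f := fun φ (_ : IsSmoothInTime φ) => (actionTest ν T ρ φ : EReal)) φ hφ
  rwa [← EReal.coe_le_coe_iff,
    EReal.coe_toReal hA.ne (ne_bot_of_le_ne_bot (EReal.coe_ne_bot _) h1)]

/-- Only the values on `[0, T]` enter, so the curve may be replaced by a continuous extension to the
whole line. -/
lemma actionTest_congr {ν T : ℝ} (hT : 0 ≤ T) {ρ ρ' : ℝ → PT2} (h : ∀ t ∈ Icc 0 T, ρ t = ρ' t)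
    (φ : ℝ → T2 → ℝ) : actionTest ν T ρ φ = actionTest ν T ρ' φ := by
  have h' : ∀ t ∈ uIcc 0 T, ρ t = ρ' t := by rwa [uIcc_of_le hT]
  have e1 : ∫ s in (0:ℝ)..T, ∫ x, deriv (fun r => φ r x) s ∂(ρ s : Measure T2) =
      ∫ s in (0:ℝ)..T, ∫ x, deriv (fun r => φ r x) s ∂(ρ' s : Measure T2) :=
    intervalIntegral.integral_congr fun s hs => by simp only [h' s hs]
  have e2 : ∫ s in (0:ℝ)..T, ∫ x, lap (φ s) x ∂(ρ s : Measure T2) =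
      ∫ s in (0:ℝ)..T, ∫ x, lap (φ s) x ∂(ρ' s : Measure T2) :=
    intervalIntegral.integral_congr fun s hs => by simp only [h' s hs]
  have e3 : ∫ s in (0:ℝ)..T, pairR (φ s) (ρ s) = ∫ s in (0:ℝ)..T, pairR (φ s) (ρ' s) :=
    intervalIntegral.integral_congr fun s hs => by simp only [h' s hs]
  have e4 : ∫ s in (0:ℝ)..T, ∫ x, (∑ i, pd i (φ s) x ^ 2) ∂(ρ s : Measure T2) =
      ∫ s in (0:ℝ)..T, ∫ x, (∑ i, pd i (φ s) x ^ 2) ∂(ρ' s : Measure T2) :=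
    intervalIntegral.integral_congr fun s hs => by simp only [h' s hs]
  rw [actionTest, actionTest, e1, e2, e3, e4, h T ⟨hT, le_rfl⟩, h 0 ⟨le_rfl, hT⟩]

section Curve

variable {ν T q A : ℝ} {ρ : ℝ → PT2} (hν : 0 < ν) (hρ : Continuous ρ) (hq0 : 0 ≤ q)
  (hq : ∀ t ∈ Icc 0 T, ENNReal.ofReal (1 / 2) * sobolevSq (ρ t) +
    ENNReal.ofReal (ν / 2) * ∫⁻ s in Ioc 0 t, l2DistSq (ρ s) ≤ ENNReal.ofReal q)

include hq in
lemma sobolevSq_le {t : ℝ} (ht : t ∈ Icc 0 T) : sobolevSq (ρ t) ≤ ENNReal.ofReal (2 * q) := by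
  have h := le_self_add.trans (hq t ht)
  rw [ENNReal.ofReal_mul zero_le_two]
  calc sobolevSq (ρ t) = ENNReal.ofReal 2 * (ENNReal.ofReal (1 / 2) * sobolevSq (ρ t)) := by
        rw [← mul_assoc, ← ENNReal.ofReal_mul zero_le_two]; norm_num
    _ ≤ _ := by gcongr

include hν hq in
lemma lintegral_wsq_le {t : ℝ} (ht : t ∈ Icc 0 T) :
    ∫⁻ s in Ioc 0 t, wsq (ρ s) ≤ ENNReal.ofReal (2 * q / ν) := by
  have h := le_add_self.trans (hq t ht)
  calc ∫⁻ s in Ioc 0 t, wsq (ρ s) ≤ ∫⁻ s in Ioc 0 t, l2DistSq (ρ s) :=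
        lintegral_mono fun s => wsq_le_l2DistSq _
    _ = ENNReal.ofReal (2 / ν) * (ENNReal.ofReal (ν / 2) * ∫⁻ s in Ioc 0 t, l2DistSq (ρ s)) := by
        rw [← mul_assoc, ← ENNReal.ofReal_mul (by positivity)]
        rw [show 2 / ν * (ν / 2) = 1 by field_simp]; simp
    _ ≤ ENNReal.ofReal (2 / ν) * ENNReal.ofReal q := by gcongr
    _ = _ := by rw [← ENNReal.ofReal_mul (by positivity)]; congr 1; ring

include hν hρ hq0 hq in
-- Some time in `(0, t]` has a value not exceeding the average, and the average is controlled by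
-- `Q_T`.
lemma exists_wsq_le {t : ℝ} (ht : t ∈ Ioc 0 T) :
    ∃ s ∈ Ioc 0 t, wsq (ρ s) ≠ ⊤ ∧ (wsq (ρ s)).toReal ≤ 2 * q / (ν * t) := by
  obtain ⟨s, hs, hle⟩ := exists_le_setLAverage (μ := volume) (s := Ioc 0 t) (f := fun s => wsq (ρ s))
    (by simp [ht.1]) (by simp) (measurable_wsq_curve hρ).aemeasurable
  have h0 : 0 ≤ 2 * q / (ν * t) := by have := ht.1; positivity
  have h : wsq (ρ s) ≤ ENNReal.ofReal (2 * q / (ν * t)) := by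
    refine hle.trans ?_
    rw [setLAverage_eq, Real.volume_Ioc, sub_zero, ← div_div, ENNReal.ofReal_div_of_pos ht.1]
    exact ENNReal.div_le_div_right (lintegral_wsq_le hν hq (Ioc_subset_Icc_self ht)) _
  exact ⟨s, hs, (h.trans_lt ENNReal.ofReal_lt_top).ne, ENNReal.toReal_le_of_le_ofReal h0 h⟩

variable (hA : ∀ φ, IsSmoothInTime φ → actionTest ν T ρ φ ≤ A)
include hν hρ hq0 hq hA

/-- The starting time `s` depends on `τ` but not on the mollifier, and the error `ε n` is the
commutator over the full interval. Both uniformities are needed to let `n` tend to infinity. -/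
lemma exists_ent_add_info_le {J : ℕ → Mollifier}
    (hJ : ∀ k, Tendsto (fun n => (J n).mult k) atTop (𝓝 1)) : ∃ ε : ℕ → ℝ, Tendsto ε atTop (𝓝 0) ∧
      ∀ τ ∈ Ioc 0 T, ∃ s ∈ Ioc 0 τ, ∀ n, ∀ t ∈ Icc τ T,
        (J n).ent (ρ t) + ν / 4 * (∫ r in Ioc s t, (J n).info (ρ r)) ≤
          2 * A + Real.log (2 * q / (ν * τ) + 1) + ε n := by
  rcases lt_or_ge 0 T with hT | hT
  swap
  · exact ⟨0, tendsto_const_nhds, fun τ hτ => absurd hτ.1 (by linarith [hτ.2])⟩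
  have hw : ∫⁻ r in Ioc 0 T, wsq (ρ r) ≠ ⊤ :=
    ((lintegral_wsq_le hν hq ⟨hT.le, le_rfl⟩).trans_lt ENNReal.ofReal_lt_top).ne
  have hS : ∀ r ∈ Ioc 0 T, sobolevSq (ρ r) ≤ ENNReal.ofReal (2 * q) := fun r hr =>
    sobolevSq_le hq (Ioc_subset_Icc_self hr)
  have hS0 : 0 ≤ 2 * q := by positivity
  refine ⟨fun n => 1 / ν * ∫ r in Ioc 0 T, (J n).comm (ρ r), ?_, fun τ hτ => ?_⟩
  · simpa using (Mollifier.tendsto_integral_comm hρ hw hS0 hS hJ).const_mul (1 / ν)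
  obtain ⟨s, hs, hws, hsle⟩ := exists_wsq_le hν hρ hq0 hq hτ
  refine ⟨s, hs, fun n t ht => ?_⟩
  have h1 := Mollifier.ent_add_info_le hρ hw hS0 hS hν hA (J n) hs.1.le (hs.2.trans ht.1) ht.2
  have h2 := Mollifier.ent_le_log (J := J n) hws
  have h3 : Real.log (1 + (wsq (ρ s)).toReal) ≤ Real.log (2 * q / (ν * τ) + 1) :=
    Real.log_le_log (by positivity) (by linarith)
  linarith

/-- The entropy bound for curves of finite action. -/
theorem entropy_le_of_action {t : ℝ} (ht : t ∈ Ioc 0 T) :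
    entropy (ρ t) ≤ ((2 * A + Real.log (2 * q / (ν * t) + 1) : ℝ) : EReal) := by
  obtain ⟨J, hJ⟩ := exists_mollifier_seq
  obtain ⟨ε, hε, h⟩ := exists_ent_add_info_le hν hρ hq0 hq hA hJ
  obtain ⟨s, -, hb⟩ := h t ht
  -- The information term is nonnegative and is dropped; the entropy bound then survives removal of
  -- the mollifier.
  refine entropy_le_of_variational fun f hf => Mollifier.integral_le_of_ent_le _ hJ hε (fun n => ?_) hf
  have h1 := hb n t ⟨le_rfl, ht.2⟩
  have h2 : 0 ≤ ∫ r in Ioc s t, (J n).info (ρ r) := integral_nonneg fun r => Mollifier.info_nonneg _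
  have h3 := mul_nonneg (by positivity : 0 ≤ ν / 4) h2
  linarith

/-- The integrated Fisher information away from the initial time. -/
theorem lintegral_fisher_le {τ : ℝ} (hτ : τ ∈ Ioc 0 T) : ∫⁻ r in Ioc τ T, fisher (ρ r) ≤
    ENNReal.ofReal (8 / ν * (2 * A + Real.log (2 * q / (ν * τ) + 1))) := by
  obtain ⟨J, hJ⟩ := exists_mollifier_seq
  obtain ⟨ε, hε, h⟩ := exists_ent_add_info_le hν hρ hq0 hq hA hJ
  obtain ⟨s, hs, hb⟩ := h τ hτ
  set L := 2 * A + Real.log (2 * q / (ν * τ) + 1) with hL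
  have hT : 0 ≤ T := hτ.1.le.trans hτ.2
  have hw : ∫⁻ r in Ioc 0 T, wsq (ρ r) ≠ ⊤ :=
    ((lintegral_wsq_le hν hq ⟨hT, le_rfl⟩).trans_lt ENNReal.ofReal_lt_top).ne
  have hae := ae_restrict_of_ae_restrict_of_subset (Ioc_subset_Ioc_left hs.1.le)
    (ae_wsq_ne_top hρ hw)
  have hbn : ∀ n, ∫⁻ r in Ioc s T, ENNReal.ofReal ((J n).info (ρ r)) ≤
      ENNReal.ofReal (4 / ν * (L + ε n)) := by
    intro n
    rw [← ofReal_integral_eq_lintegral_ofReal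
      (Mollifier.continuous_info_curve hρ).integrableOn_Ioc
      (Eventually.of_forall fun r => Mollifier.info_nonneg _)]
    refine ENNReal.ofReal_le_ofReal ?_
    have h1 := hb n T ⟨hτ.2, le_rfl⟩
    -- Nonnegativity of the final entropy leaves a bound on the information alone.
    have h2 := Mollifier.ent_nonneg (J := J n) (ρ T)
    rw [div_mul_eq_mul_div, le_div_iff₀ hν]
    linarith
  calc ∫⁻ r in Ioc τ T, fisher (ρ r) ≤ ∫⁻ r in Ioc s T, fisher (ρ r) :=
        lintegral_mono_set (Ioc_subset_Ioc_left hs.2)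
    _ ≤ ∫⁻ r in Ioc s T, 2 * liminf (fun n => ENNReal.ofReal ((J n).info (ρ r))) atTop :=
        lintegral_mono_ae (hae.mono fun r hr => fisher_le_liminf hJ (density_of_wsq hr).1)
    _ = 2 * ∫⁻ r in Ioc s T, liminf (fun n => ENNReal.ofReal ((J n).info (ρ r))) atTop :=
        lintegral_const_mul' _ _ (by simp)
    _ ≤ 2 * liminf (fun n => ∫⁻ r in Ioc s T, ENNReal.ofReal ((J n).info (ρ r))) atTop := by
        gcongr
        exact lintegral_liminf_le fun n =>
          (Mollifier.continuous_info_curve hρ).measurable.ennreal_ofReal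
    _ ≤ 2 * liminf (fun n => ENNReal.ofReal (4 / ν * (L + ε n))) atTop := by
        gcongr
        exact liminf_le_liminf (Eventually.of_forall hbn)
    _ = 2 * ENNReal.ofReal (4 / ν * L) := by
        congr 1
        refine Tendsto.liminf_eq ((ENNReal.continuous_ofReal.tendsto _).comp ?_)
        simpa using (hε.const_add L).const_mul (4 / ν)
    _ = _ := by
        rw [show (2 : ℝ≥0∞) = ENNReal.ofReal 2 by simp, ← ENNReal.ofReal_mul zero_le_two]
        congr 1; ring

end Curve

/-- A logarithmic singularity at the origin is integrable against any positive power. -/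
lemma lintegral_rpow_mul_lt_top {f : ℝ → ℝ≥0∞} {T α a b c : ℝ} (hα : 0 < α) (hT : 0 < T)
    (ha : 0 ≤ a) (hc : 0 ≤ c)
    (h : ∀ τ ∈ Ioc 0 T, ∫⁻ t in Ioc τ T, f t ≤ ENNReal.ofReal (c * (b + Real.log (a / τ + 1)))) :
    ∫⁻ t in Ioc 0 T, ENNReal.ofReal (t ^ α) * f t < ⊤ := by
  -- Dyadic decomposition of `(0, T]`: the hypothesis is applied at the left end of each piece, and
  -- the power `t ^ α` is bounded at its right end.
  obtain ⟨p, hp⟩ : ∃ p : ℕ → ℝ, ∀ k, p k = T / 2 ^ k := ⟨_, fun _ => rfl⟩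
  have hp0 : ∀ k, 0 < p k := fun k => by rw [hp]; positivity
  have hpT : ∀ k, p k ≤ T := fun k => by rw [hp]; exact div_le_self hT.le (one_le_pow₀ one_le_two)
  have hcover : Ioc 0 T ⊆ ⋃ k, Ioc (p (k + 1)) (p k) := by
    intro t ht
    have hlim : Tendsto p atTop (𝓝 0) := by
      have := (tendsto_pow_atTop_nhds_zero_of_lt_one (r := (1 / 2 : ℝ)) (by norm_num)
        (by norm_num)).const_mul T
      simpa [funext hp, div_eq_mul_inv] using this
    classical
    have hex : ∃ k, p k < t := (hlim.eventually_lt_const ht.1).exists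
    have hk := Nat.find_spec hex
    have hne : Nat.find hex ≠ 0 := by
      intro h0
      rw [h0] at hk
      simp only [hp, pow_zero, div_one] at hk
      linarith [ht.2]
    obtain ⟨m, hm⟩ := Nat.exists_eq_succ_of_ne_zero hne
    refine mem_iUnion.2 ⟨m, ?_, ?_⟩
    · rw [hm] at hk; exact hk
    · exact not_lt.1 (Nat.find_min hex (by omega))
  obtain ⟨r, hr⟩ : ∃ r : ℝ, r = (1 / 2) ^ α := ⟨_, rfl⟩
  have hr0 : 0 < r := by rw [hr]; positivity
  have hr1 : r < 1 := hr ▸ Real.rpow_lt_one (by norm_num) (by norm_num) hα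
  obtain ⟨B, hB⟩ : ∃ B, B = |b| + Real.log (a / T + 1) + Real.log 2 := ⟨_, rfl⟩
  -- On the `k`-th piece the logarithm grows at most linearly in `k`, while the power contributes `r
  -- ^ k` with `r = 2^(-α) < 1`. The resulting series converges.
  have hterm : ∀ k, ∫⁻ t in Ioc (p (k + 1)) (p k), ENNReal.ofReal (t ^ α) * f t ≤
      ENNReal.ofReal (T ^ α * c * (B * r ^ k + Real.log 2 * ((k:ℝ) ^ 1 * r ^ k))) := by
    intro k
    calc ∫⁻ t in Ioc (p (k + 1)) (p k), ENNReal.ofReal (t ^ α) * f t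
        ≤ ∫⁻ t in Ioc (p (k + 1)) (p k), ENNReal.ofReal (p k ^ α) * f t := by
          refine setLIntegral_mono_ae' measurableSet_Ioc (Eventually.of_forall fun t ht => ?_)
          gcongr
          · exact (hp0 _).le.trans ht.1.le
          · exact ht.2
      _ = ENNReal.ofReal (p k ^ α) * ∫⁻ t in Ioc (p (k + 1)) (p k), f t :=
          lintegral_const_mul' _ _ ENNReal.ofReal_ne_top
      _ ≤ ENNReal.ofReal (p k ^ α) * ENNReal.ofReal (c * (b + Real.log (a / p (k + 1) + 1))) := by
          gcongr
          exact (lintegral_mono_set (Ioc_subset_Ioc_right (hpT k))).trans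
            (h _ ⟨hp0 _, hpT _⟩)
      _ ≤ _ := by
          rw [← ENNReal.ofReal_mul (by have := hp0 k; positivity)]
          refine ENNReal.ofReal_le_ofReal ?_
          have e1 : p k ^ α = T ^ α * r ^ k := by
            rw [hr, ← Real.rpow_natCast, ← Real.rpow_mul (by norm_num), mul_comm α,
              Real.rpow_mul (by norm_num), ← Real.mul_rpow hT.le (by positivity), Real.rpow_natCast]
            congr 1
            simp [hp, div_eq_mul_inv]
          have e2 : Real.log (a / p (k + 1) + 1) ≤ Real.log (a / T + 1) + (k + 1) * Real.log 2 := by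
            have hx : 0 ≤ a / T := by positivity
            have h2 : (1:ℝ) ≤ 2 ^ (k + 1) := one_le_pow₀ one_le_two
            have e3 : a / p (k + 1) = a / T * 2 ^ (k + 1) := by simp only [hp]; field_simp
            have e4 : Real.log (a / T + 1) + (k + 1) * Real.log 2 =
                Real.log ((a / T + 1) * 2 ^ (k + 1)) := by
              rw [Real.log_mul (by positivity) (by positivity), Real.log_pow]
              push_cast; ring
            rw [e3, e4]
            exact Real.log_le_log (by positivity) (by nlinarith)
          have e5 : b + Real.log (a / p (k + 1) + 1) ≤ B + Real.log 2 * k := by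
            rw [hB]; linarith [le_abs_self b]
          rw [e1]
          have h6 := mul_le_mul_of_nonneg_left e5 (by positivity : 0 ≤ T ^ α * r ^ k * c)
          nlinarith
  refine (lintegral_mono_set hcover).trans_lt ((lintegral_iUnion_le _ _).trans_lt ?_)
  have hs1 : Summable fun k : ℕ => r ^ k := summable_geometric_of_lt_one hr0.le hr1
  have hs2 : Summable fun k : ℕ => (k:ℝ) ^ 1 * r ^ k :=
    summable_pow_mul_geometric_of_norm_lt_one 1 (by rwa [Real.norm_eq_abs, abs_of_pos hr0])
  have hs3 : Summable fun k : ℕ => T ^ α * c * (B * r ^ k + Real.log 2 * ((k:ℝ) ^ 1 * r ^ k)) :=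
    ((hs1.mul_left B).add (hs2.mul_left (Real.log 2))).mul_left _
  exact (ENNReal.tsum_le_tsum hterm).trans_lt hs3.tsum_ofReal_lt_top

end Bounds

end VortexLDP

theorem lemma3p7 (ν T : ℝ) (hν : 0 < ν) (hT : 0 < T) (ρ : ℝ → VortexLDP.PT2)
    (hρ : ContinuousOn ρ (Set.Icc 0 T))
    (hQ : VortexLDP.QT ν T ρ < ⊤) (hA : VortexLDP.action ν T ρ < ⊤) :
    (∀ t ∈ Set.Ioc (0 : ℝ) T,
      VortexLDP.entropy (ρ t) ≤
        ((2 * (VortexLDP.action ν T ρ).toReal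
          + Real.log (2 * (VortexLDP.QT ν T ρ).toReal / (ν * t) + 1) : ℝ) : EReal)) ∧
    (∀ α : ℝ, 0 < α →
      ∫⁻ t in Set.Ioc (0 : ℝ) T, ENNReal.ofReal (t ^ α) * VortexLDP.fisher (ρ t) < ⊤) := by
  -- Constant extension beyond the endpoints gives a globally continuous curve that agrees with `ρ`
  -- on `[0, T]`.
  set ρ' : ℝ → VortexLDP.PT2 := IccExtend hT.le ((Icc 0 T).domRestrict ρ) with hρ'
  have hc : Continuous ρ' := (continuousOn_iff_continuous_domRestrict.1 hρ).Icc_extend'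
  have heq : ∀ t ∈ Icc 0 T, ρ' t = ρ t := fun t ht => by
    rw [hρ', IccExtend_of_mem _ _ ht, domRestrict_apply]
  have hq0 : 0 ≤ (VortexLDP.QT ν T ρ).toReal := by
    refine EReal.toReal_nonneg (le_trans ?_ (le_iSup₂ (f := fun t _ => VortexLDP.energy (ρ t) +
      ((ENNReal.ofReal (ν / 2) * ∫⁻ s in Ioc 0 t, VortexLDP.l2DistSq (ρ s) : ℝ≥0∞) : EReal)) 0
      (⟨le_rfl, hT.le⟩ : (0:ℝ) ∈ Icc 0 T)))
    rw [VortexLDP.energy_add_eq]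
    exact EReal.coe_ennreal_nonneg _
  have hq : ∀ t ∈ Icc 0 T, ENNReal.ofReal (1 / 2) * VortexLDP.sobolevSq (ρ' t) +
      ENNReal.ofReal (ν / 2) * ∫⁻ s in Ioc 0 t, VortexLDP.l2DistSq (ρ' s) ≤
        ENNReal.ofReal (VortexLDP.QT ν T ρ).toReal := by
    intro t ht
    rw [heq t ht, setLIntegral_congr_fun measurableSet_Ioc fun s hs => by
      rw [heq s ⟨hs.1.le, hs.2.trans ht.2⟩]]
    exact VortexLDP.energy_add_le_toReal_QT hQ ht
  have hA' : ∀ φ, VortexLDP.IsSmoothInTime φ →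
      VortexLDP.actionTest ν T ρ' φ ≤ (VortexLDP.action ν T ρ).toReal := by
    intro φ hφ
    rw [VortexLDP.actionTest_congr hT.le heq]
    exact VortexLDP.actionTest_le_toReal_action hA hφ
  refine ⟨fun t ht => ?_, fun α hα => ?_⟩
  · rw [← heq t (Ioc_subset_Icc_self ht)]
    exact VortexLDP.entropy_le_of_action hν hc hq0 hq hA' ht
  · refine VortexLDP.lintegral_rpow_mul_lt_top (a := 2 * (VortexLDP.QT ν T ρ).toReal / ν)
      (b := 2 * (VortexLDP.action ν T ρ).toReal) (c := 8 / ν) hα hT (by positivity) (by positivity)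
      fun τ hτ => ?_
    have e : ∫⁻ s in Ioc τ T, VortexLDP.fisher (ρ s) = ∫⁻ s in Ioc τ T, VortexLDP.fisher (ρ' s) :=
      setLIntegral_congr_fun measurableSet_Ioc fun s hs => by
        simp only [heq s ⟨hτ.1.le.trans hs.1.le, hs.2⟩]
    rw [div_div, e]
    exact VortexLDP.lintegral_fisher_le hν hc hq0 hq hA' hτ
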